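/- **Setting.** There are $N$ agents and, in each of $T$ periods, $M$ parallel auctions with at most $\gamma$ winners each, $1\le\gamma\le N-1$; winning saves a fraction $\Delta\in(0,1]$ of an agent's delay cost. In period $t$, agent $i$ draws a valuation $v_{i,t}\in[0,1]$ from a law $\mathcal V_i$ and an auction $m_{i,t}$ from a distribution $\pi_i$ on $\{1,\dots,M\}$; all draws are independent across agents and periods. Given bids $b_{1,t},\dots,b_{N,t}$, the competing bid $d_{i,t}$ is the $\gamma$-th largest of the numbers $1\{m_{j,t}=m_{i,t}\}b_{j,t}$, $j\ne i$; agent $i$ wins iff $b_{i,t}>d_{i,t}$ ($x_{i,t}=1\{b_{i,t}>d_{i,t}\}$), pays $z_{i,t}=x_{i,t}d_{i,t}$ and incurs the cost $c_{i,t}=v_{i,t}(1-x_{i,t}\Delta)$. Budgets start at $k_{i,1}=\rho_iT$ with $\rho_i>0$ and evolve without gains, $k_{i,t+1}=k_{i,t}-z_{i,t}$. A strategy maps the agent's own history $\big((v_{i,s},k_{i,s},b_{i,s},z_{i,s},c_{i,s})_{s<t},v_{i,t},k_{i,t}\big)$ measurably to a probability distribution of the bid on $[0,k_{i,t}]$;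 agents randomize independently. For a profile $\beta$ of strategies let $\mathcal C_i^{\beta}=\mathbb E\big[\sum_{t=1}^Tc_{i,t}\big]$. Adaptive pacing $A$ with multiplier bounds $0<\underline\mu<\overline\mu$, step size $\epsilon>0$ and initial multipliers $\mu_{i,1}\in[\underline\mu,\overline\mu]$ bids $b_{i,t}=\min\{\Delta v_{i,t}/\mu_{i,t},\,k_{i,t}\}$ and updates $\mu_{i,t+1}=P_{[\underline\mu,\overline\mu]}\big(\mu_{i,t}+\epsilon(z_{i,t}-\rho_i)\big)$, where $P$ is the projection. Write $\mathcal C_i^{A}$ for the cost when all agents follow $A$ and $\mathcal C_i^{\beta,A_{-i}}$ for the cost when only $i$ deviates, to $\beta$. Let $a_{i,j}=P(m_{i,t}=m_{j,t})$, $\|a_i\|_2=\big(\sum_{j\ne i}a_{i,j}^2\big)^{1/2}$, and let $Z_i(\mu)$ be the expected one-period payment of agent $i$ when every agent $j$ bids $\Delta v_j/\mu_j$. **Assumptions.** Fix real constants $\Delta$, $0<\underline\mu<\overline\mu$, $0<\underline\nu\le\overline\nu$, $\lambda>0$, $\kappa$. Every market considered satisfies: 1. each $\mathcal V_i$ has a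 density on $[0,1]$ with values in $[\underline\nu,\overline\nu]$; 2. $Z$ is $\lambda$-strongly monotone: $\sum_i(\mu_i-\mu_i')\big(Z_i(\mu)-Z_i(\mu')\big)\le-\lambda\|\mu-\mu'\|_2^2$ for all $\mu,\mu'\in(\underline\mu,\overline\mu)^N$; 3. there is a stationary profile $\mu^\star\in(\underline\mu,\overline\mu)^N$, i.e. $Z_i(\mu^\star)=\rho_i$ for all $i$; 4. $\rho_i\ge\Delta/\overline\mu$ for all $i$; 5. $\sqrt N\,\|a_i\|_2\le\kappa$ for all $i$. **Theorem.** (a) For every $\eta>0$ there is a constant $C\ge0$, depending only on $\eta,\Delta,\underline\mu,\overline\mu,\underline\nu,\overline\nu,\lambda,\kappa$, such that for every market satisfying 1–5 (with any $N,M,\gamma,\pi_i,\rho_i$) whose stationary profile in 3 satisfies $\mu_i^\star\ge\underline\mu+\eta$ for all $i$, every $T\ge1$, every $\epsilon>0$, all initial multipliers in $[\underline\mu,\overline\mu]$, every agent $i$ and every strategy $\beta$, $$\frac1T\Big(\mathcal C_i^{A}-\mathcal C_i^{\beta,A_{-i}}\Big)\le C\left(\|a_i\|_2\Big(\sqrt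 N\Big(\epsilon+\frac1{\epsilon T}\Big)+\|a_i\|_2\Big)+\frac{1+\epsilon}{\epsilon T}\right).$$ (b) Consider a sequence of markets satisfying 1–5 (with the same constants $\Delta,\underline\mu,\overline\mu,\underline\nu,\overline\nu,\lambda,\kappa$), horizons and step sizes with $T,N,M\to\infty$, $\epsilon\to0$, $T\epsilon\to\infty$, $M\gamma/N$ constant and $\max_i\|a_i\|_2\to0$. Then $A$ is an $\varepsilon$-Nash equilibrium in the limit: for every choice of an agent $i$ in each market, $$\lim_{T,N,M\to\infty}\frac1T\Big(\mathcal C_i^{A}-\inf_{\beta}\mathcal C_i^{\beta,A_{-i}}\Big)=0 .$$ -/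

import Mathlib

open MeasureTheory ProbabilityTheory Filter
open scoped Topology

noncomputable section

namespace Pacing

/-- A repeated-auction environment with artificial currency and `M` parallel auctions per period:
`N` agents, `γ` winners per auction, time saving `Δ`, valuation laws `V i` on `[0, 1]`,
matching distributions `π i` over the auctions and target expenditure rates `ρ i`. -/
structure Market where
  N : ℕ
  M : ℕ
  γ : ℕ
  Δ : ℝ
  V : Fin N → Measure ℝ
  π : Fin N → PMF (Fin M)
  ρ : Fin N → ℝ
  one_le_γ : 1 ≤ γ
  γ_lt_N : γ < N
  Δ_pos : 0 < Δ
  Δ_le_one : Δ ≤ 1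
  V_prob : ∀ i, IsProbabilityMeasure (V i)
  V_supp : ∀ i, V i (Set.Icc 0 1)ᶜ = 0
  ρ_pos : ∀ i, 0 < ρ i

attribute [instance] Market.V_prob

/-- What an agent records about one past period. -/
abbrev Record : Type := ℝ × ℝ × ℝ × ℝ × ℝ

/-- The record `(v, k, b, z, c)`: valuation, budget, bid, payment and cost of a period. -/
def mkRecord (v k b z c : ℝ) : Record := (v, k, b, z, c)

/-- The payment component of a record. -/
def Record.pay (r : Record) : ℝ := r.2.2.2.1

/-- The cost component of a record. -/
def Record.cost (r : Record) : ℝ := r.2.2.2.2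

/-- The history of an agent after `t` completed periods: the `t` past records,
the current valuation and the current budget. -/
abbrev History (t : ℕ) : Type := (Fin t → Record) × ℝ × ℝ

/-- A bidding strategy: with `t` completed periods, `bid t` maps the history to a probability
distribution over the feasible bids `[0, k]`, where `k` is the current budget. -/
structure Strategy where
  bid : (t : ℕ) → Kernel (History t) ℝ
  markov : ∀ t, IsMarkovKernel (bid t)
  feasible : ∀ t (h : History t), h.2.1 ∈ Set.Icc (0 : ℝ) 1 → 0 ≤ h.2.2 →
    ∀ᵐ b ∂(bid t h), b ∈ Set.Icc 0 h.2.2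

attribute [instance] Strategy.markov

namespace Market

variable (mkt : Market)

/-- The law of the valuations and of the auctions joined in one period:
independent across agents. -/
def draw : Measure ((Fin mkt.N → ℝ) × (Fin mkt.N → Fin mkt.M)) :=
  (Measure.pi mkt.V).prod (Measure.pi fun i => (mkt.π i).toMeasure)

open Classical in
/-- The competing bid of agent `i`: the `γ`-th largest of the numbers `1{m_j = m_i} b_j`,
`j ≠ i`, i.e. the largest `x` that at least `γ` of them reach. -/
def competingBid (m : Fin mkt.N → Fin mkt.M) (b : Fin mkt.N → ℝ) (i : Fin mkt.N) : ℝ :=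
  sSup {x : ℝ | mkt.γ ≤
    (Finset.univ.filter fun j => j ≠ i ∧ x ≤ if m j = m i then b j else 0).card}

open Classical in
/-- The allocation `x_i = 1{b_i > d_i}`. -/
def wins (m : Fin mkt.N → Fin mkt.M) (b : Fin mkt.N → ℝ) (i : Fin mkt.N) : ℝ :=
  if mkt.competingBid m b i < b i then 1 else 0

/-- The payment `z_i = x_i d_i`. -/
def payment (m : Fin mkt.N → Fin mkt.M) (b : Fin mkt.N → ℝ) (i : Fin mkt.N) : ℝ :=
  mkt.wins m b i * mkt.competingBid m b i

/-- The past records of all agents after `t` periods. -/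
abbrev Past (t : ℕ) : Type := Fin mkt.N → Fin t → Record

/-- The current budget of agent `i` over horizon `T`: the initial budget `ρ_i T` minus all past
payments (there are no budget gains). -/
def budget (T : ℕ) {t : ℕ} (past : mkt.Past t) (i : Fin mkt.N) : ℝ :=
  mkt.ρ i * T - ∑ s, (past i s).pay

/-- The records after one more period with valuations `w.1.2.1`, auctions `w.1.2.2` and
bids `w.2`. -/
def nextPast (T t : ℕ)
    (w : (mkt.Past t × ((Fin mkt.N → ℝ) × (Fin mkt.N → Fin mkt.M))) × (Fin mkt.N → ℝ)) :
    mkt.Past (t + 1) :=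
  fun i => Fin.snoc (α := fun _ => Record) (w.1.1 i)
    (mkRecord (w.1.2.1 i) (mkt.budget T w.1.1 i) (w.2 i) (mkt.payment w.1.2.2 w.2 i)
      (w.1.2.1 i * (1 - mkt.wins w.1.2.2 w.2 i * mkt.Δ)))

/-- The history available to agent `i` when it bids. -/
def historyOf (T t : ℕ) (i : Fin mkt.N)
    (w : mkt.Past t × ((Fin mkt.N → ℝ) × (Fin mkt.N → Fin mkt.M))) : History t :=
  (w.1 i, w.2.1 i, mkt.budget T w.1 i)

theorem measurable_historyOf (T t : ℕ) (i : Fin mkt.N) : Measurable (mkt.historyOf T t i) := by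
  unfold historyOf budget Record.pay
  fun_prop

/-- The bids of one period: given the past and the draws, agents bid independently, each according
to its strategy and its own history. -/
def bids (T : ℕ) (β : Fin mkt.N → Strategy) (t : ℕ) :
    Kernel (mkt.Past t × ((Fin mkt.N → ℝ) × (Fin mkt.N → Fin mkt.M))) (Fin mkt.N → ℝ) where
  toFun w := Measure.pi fun i => (β i).bid t (mkt.historyOf T t i w)
  measurable' := by
    refine Measurable.measure_of_isPiSystem_of_isProbabilityMeasure
      generateFrom_pi.symm isPiSystem_pi ?_
    rintro _ ⟨s, hs, rfl⟩
    simp_rw [Measure.pi_pi]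
    refine Finset.measurable_prod _ fun i _ => ?_
    exact ((β i).bid t).measurable_coe (hs i (Set.mem_univ i)) |>.comp
      (mkt.measurable_historyOf T t i)

/-- The law of the records of all agents after `t` periods under the strategy profile `β`. -/
def law (T : ℕ) (β : Fin mkt.N → Strategy) : (t : ℕ) → Measure (mkt.Past t)
  | 0 => Measure.dirac fun _ => Fin.elim0
  | t + 1 => ((((law T β t).prod mkt.draw) ⊗ₘ mkt.bids T β t)).map (mkt.nextPast T t)

/-- The strategic competition cost: the expected total cost of agent `i` over horizon `T` when the
agents follow the profile `β`. -/
def totalCost (T : ℕ) (β : Fin mkt.N → Strategy) (i : Fin mkt.N) : ℝ :=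
  ∫ h, ∑ t, (h i t).cost ∂(mkt.law T β T)

/-- The matching probability `a_{i,j} = P(m_j = m_i)` of two distinct agents. -/
def matchProb (i j : Fin mkt.N) : ℝ :=
  ((mkt.π i).toMeasure.prod (mkt.π j).toMeasure).real {p | p.2 = p.1}

/-- The Euclidean norm of `a_i = (a_{i,j})_{j ≠ i}`. -/
def matchNorm (i : Fin mkt.N) : ℝ :=
  Real.sqrt (∑ j ∈ Finset.univ.erase i, mkt.matchProb i j ^ 2)

/-- The expected expenditure `Z_i(μ)` of agent `i` when every agent `j` bids `Δ v_j / μ_j`. -/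
def expenditure (μ : Fin mkt.N → ℝ) (i : Fin mkt.N) : ℝ :=
  ∫ w, mkt.payment w.2 (fun j => mkt.Δ * w.1 j / μ j) i ∂mkt.draw

/-- The valuations have densities on `[0, 1]` with values in `[νlo, νhi]`. -/
def HasDensities (νlo νhi : ℝ) : Prop :=
  ∀ i, ∃ f : ℝ → ℝ, Measurable f ∧ (∀ x ∈ Set.Icc (0 : ℝ) 1, f x ∈ Set.Icc νlo νhi) ∧
    mkt.V i = (volume.restrict (Set.Icc 0 1)).withDensity fun x => ENNReal.ofReal (f x)

/-- The expected expenditure is `lam`-strongly monotone over the box `(lo, hi)^N`. -/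
def StronglyMonotone (lam lo hi : ℝ) : Prop :=
  ∀ μ μ' : Fin mkt.N → ℝ, (∀ i, μ i ∈ Set.Ioo lo hi) → (∀ i, μ' i ∈ Set.Ioo lo hi) →
    ∑ i, (μ i - μ' i) * (mkt.expenditure μ i - mkt.expenditure μ' i)
      ≤ -lam * ∑ i, (μ i - μ' i) ^ 2

/-- `μ` is a stationary multiplier profile. -/
def IsStationary (μ : Fin mkt.N → ℝ) : Prop :=
  (∀ i, 0 < μ i) ∧ ∀ i, mkt.expenditure μ i = mkt.ρ i

end Market

/-- Input parameters of adaptive pacing for `n` agents: multiplier bounds, gradient step size and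
initial multipliers. -/
structure Params (n : ℕ) where
  lo : ℝ
  hi : ℝ
  eps : ℝ
  init : Fin n → ℝ
  lo_pos : 0 < lo
  lo_lt_hi : lo < hi
  eps_pos : 0 < eps
  init_mem : ∀ i, init i ∈ Set.Icc lo hi

/-- The multiplier of adaptive pacing after the given past records:
`μ_1` initially, then `μ_{t+1} = P_{[lo, hi]} (μ_t + eps (z_t - ρ))`. -/
def multiplier (lo hi eps ρ μ₁ : ℝ) : (t : ℕ) → (Fin t → Record) → ℝ
  | 0, _ => μ₁
  | t + 1, h => min (max (multiplier lo hi eps ρ μ₁ t (fun s => h s.castSucc) +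
      eps * ((h (Fin.last t)).pay - ρ)) lo) hi

theorem measurable_multiplier (lo hi eps ρ μ₁ : ℝ) (t : ℕ) :
    Measurable (multiplier lo hi eps ρ μ₁ t) := by
  induction t with
  | zero => exact measurable_const
  | succ t ih =>
    have h1 : Measurable fun h : Fin (t + 1) → Record =>
        multiplier lo hi eps ρ μ₁ t (fun s => h s.castSucc) :=
      ih.comp (by fun_prop)
    have h2 : Measurable fun h : Fin (t + 1) → Record => (h (Fin.last t)).pay := by
      unfold Record.pay
      fun_prop
    exact ((h1.add ((h2.sub_const ρ).const_mul eps)).max measurable_const).min measurable_const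

theorem multiplier_pos {lo hi eps ρ μ₁ : ℝ} (hlo : 0 < lo) (hlh : lo < hi)
    (hμ : lo ≤ μ₁) (t : ℕ) (h : Fin t → Record) : 0 < multiplier lo hi eps ρ μ₁ t h := by
  cases t with
  | zero => exact hlo.trans_le hμ
  | succ t => exact lt_min (hlo.trans_le (le_max_right _ _)) (hlo.trans hlh)

/-- The adaptive pacing strategy `A` of agent `i`: bid `min (Δ v / μ) k`. -/
def pacing (mkt : Market) (p : Params mkt.N) (i : Fin mkt.N) : Strategy where
  bid t := Kernel.deterministic
    (fun h : History t =>
      min (mkt.Δ * h.2.1 / multiplier p.lo p.hi p.eps (mkt.ρ i) (p.init i) t h.1) h.2.2) (by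
        have := (measurable_multiplier p.lo p.hi p.eps (mkt.ρ i) (p.init i) t).comp
          (measurable_fst : Measurable fun h : History t => h.1)
        simp only [Function.comp_def] at this
        fun_prop)
  markov t := inferInstance
  feasible t h hv hk := by
    have hb : min (mkt.Δ * h.2.1 /
        multiplier p.lo p.hi p.eps (mkt.ρ i) (p.init i) t h.1) h.2.2 ∈ Set.Icc 0 h.2.2 :=
      ⟨le_min (div_nonneg (mul_nonneg mkt.Δ_pos.le hv.1)
        (multiplier_pos p.lo_pos p.lo_lt_hi (p.init_mem i).1 t h.1).le) hk, min_le_right _ _⟩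
    rw [Kernel.deterministic_apply]
    exact (ae_dirac_iff measurableSet_Icc).2 hb

end Pacing

end

namespace Pacing

namespace Market

variable (mkt : Market)

/-! The proof compares everything with one auxiliary process: unconstrained multipliers `ν_t`,
driven by the draws of the actual auctions, in which every agent `j` bids `Δ v_j / ν_j` whatever its
budget (`idealStep`). This process reads no actual bids, so its law is the same under every strategy
profile (`map_fst_joint`). It is a projected stochastic gradient scheme with drift `ε (Z(ν) - ρ)`,
and strong monotonicity pulls it towards the stationary profile `μ⋆`.

Both costs are expressed through `ν`. If all agents pace, the rate assumption keeps the upper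
projection inactive for small `ε`. Overspending is then bounded by `(hi - lo) / ε`, budgets bind
only in `O(1 + 1/ε)` final periods (`ae_bids_shade`), and before that the actual multipliers equal
`ν` (`ae_joint_mult_eq`). If `i` deviates, it disturbs another agent only when the two meet. The
multipliers of the others then stay within mean square distance of order `‖a_i‖² + ε² N + ε` of `ν`
(`sum_gapSq_le`), and this gap enters the competing bid of `i` with a further factor `‖a_i‖`.

Lagrangian duality gives the regret. For any bid and any `θ ≥ 0`, cost plus `θ` times payment is at
least `v - (Δ v - θ d)⁺`. With `θ = μ⋆_i` and total payments at most `ρ_i T` this bounds the cost of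
a deviation from below (`le_totalCost`). With `θ = ν_i` it is an equality for the pacing bid
(`cost_shade_eq`). Convexity of the surplus in `θ` leaves, in each period
(`Regular.surplus_gap_le`), a second-order term in `ν - μ⋆`, the term `(ν_i - lo)(ρ_i - Z_i(ν))` and
`lo (ρ_i - Z_i(ν))`.

These are summed by drift arguments. The `i`-th squared distance to `μ⋆` sums to `O(1/ε + Tε)`,
because the total distance carries a factor `N` but acts on agent `i` only with weight `‖a_i‖² ≤
κ²/N` (`sum_coord_sq_le`). The second term telescopes through the squared distance to `lo`, wherever
`μ⋆` lies (`sum_slackness_le`). The last term is unspent budget. It telescopes through `ν_i` itself,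
up to cuts at `lo`, which are rare if `μ⋆_i ≥ lo + η` (`sum_underspend_le`). Without a margin,
Lipschitz continuity of `Z` still gives a bound of square root order (`integral_underspend_le`),
which suffices for the limit in (b).

Altogether the regret per period is of order `1/(εT) + ε + 1/T + ‖a_i‖²` plus the unspent budget
(`exists_regret_bound`). This is dominated by the stated rate because the attained expenditure rates
force `√N ‖a_i‖ ≥ lo / hi`. -/

/-- The realization of one period: valuations and auctions. -/
abbrev Draw : Type := (Fin mkt.N → ℝ) × (Fin mkt.N → Fin mkt.M)

/-! ### Order statistics: how the competing bid depends on the bids. -/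

section OrderStatistics

variable {mkt}
variable {m : Fin mkt.N → Fin mkt.M} {b b' : Fin mkt.N → ℝ} {i : Fin mkt.N}

open Classical in
theorem bddAbove_competing (m : Fin mkt.N → Fin mkt.M) (b : Fin mkt.N → ℝ) (i : Fin mkt.N) :
    BddAbove {x : ℝ | mkt.γ ≤
      (Finset.univ.filter fun j => j ≠ i ∧ x ≤ if m j = m i then b j else 0).card} := by
  refine ⟨∑ j, |if m j = m i then b j else 0|, fun x hx => ?_⟩
  obtain ⟨j, hj⟩ := Finset.card_pos.1 (lt_of_lt_of_le mkt.one_le_γ hx)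
  simp only [Finset.mem_filter, Finset.mem_univ, true_and] at hj
  exact hj.2.trans ((le_abs_self _).trans
    (Finset.single_le_sum (f := fun j => |if m j = m i then b j else 0|)
      (fun _ _ => abs_nonneg _) (Finset.mem_univ j)))

open Classical in
theorem le_competingBid {c : ℝ} (h : ∀ j, j ≠ i → c ≤ if m j = m i then b j else 0) :
    c ≤ mkt.competingBid m b i := by
  refine le_csSup (bddAbove_competing m b i) ?_
  have : (Finset.univ.filter fun j => j ≠ i ∧ c ≤ if m j = m i then b j else 0)
      = Finset.univ.erase i := by
    ext j
    simp only [Finset.mem_filter, Finset.mem_univ, true_and, Finset.mem_erase, and_true]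
    exact ⟨fun h => h.1, fun hj => ⟨hj, h j hj⟩⟩
  simp only [Set.mem_ofPred_eq, this]
  rw [Finset.card_erase_of_mem (Finset.mem_univ i), Finset.card_univ, Fintype.card_fin]
  have := mkt.γ_lt_N
  omega

open Classical in
theorem nonempty_competing (m : Fin mkt.N → Fin mkt.M) (b : Fin mkt.N → ℝ) (i : Fin mkt.N) :
    {x : ℝ | mkt.γ ≤
      (Finset.univ.filter fun j => j ≠ i ∧ x ≤ if m j = m i then b j else 0).card}.Nonempty := by
  refine ⟨-∑ j, |if m j = m i then b j else 0|, ?_⟩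
  have : (Finset.univ.filter fun j => j ≠ i ∧ -∑ j, |if m j = m i then b j else 0| ≤
      if m j = m i then b j else 0) = Finset.univ.erase i := by
    ext j
    simp only [Finset.mem_filter, Finset.mem_univ, true_and, Finset.mem_erase, and_true]
    refine ⟨fun h => h.1, fun hj => ⟨hj, ?_⟩⟩
    exact (neg_le_neg (Finset.single_le_sum (f := fun j => |if m j = m i then b j else 0|)
      (fun _ _ => abs_nonneg _) (Finset.mem_univ j))).trans (neg_abs_le _)
  simp only [Set.mem_ofPred_eq, this]
  rw [Finset.card_erase_of_mem (Finset.mem_univ i), Finset.card_univ, Fintype.card_fin]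
  have := mkt.γ_lt_N
  omega

/-- An order statistic is monotone and commutes with shifts. Agents in other auctions contribute the
constant 0, so they impose no condition on the bids but force `0 ≤ c`. Most properties of the
competing bid below follow from this comparison. -/
theorem competingBid_le_add {c : ℝ} (hc : 0 ≤ c)
    (h : ∀ j, j ≠ i → m j = m i → b j ≤ b' j + c) :
    mkt.competingBid m b i ≤ mkt.competingBid m b' i + c := by
  classical
  refine csSup_le (nonempty_competing m b i) fun x hx => ?_
  rw [← sub_le_iff_le_add]
  refine le_csSup (bddAbove_competing m b' i) (le_trans hx (Finset.card_le_card fun j hj => ?_))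
  simp only [Finset.mem_filter, Finset.mem_univ, true_and] at hj ⊢
  refine ⟨hj.1, ?_⟩
  have h2 := hj.2
  split_ifs at h2 ⊢ with hm
  · linarith [h j hj.1 hm]
  · linarith

theorem competingBid_congr (h : ∀ j, j ≠ i → b j = b' j) :
    mkt.competingBid m b i = mkt.competingBid m b' i :=
  le_antisymm
    (by simpa using competingBid_le_add (c := 0) le_rfl fun j hj _ => by simp [h j hj])
    (by simpa using competingBid_le_add (c := 0) le_rfl fun j hj _ => by simp [h j hj])

theorem competingBid_nonneg (h : ∀ j, j ≠ i → 0 ≤ b j) : 0 ≤ mkt.competingBid m b i :=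
  le_competingBid fun j hj => by split_ifs <;> simp [h j hj]

theorem competingBid_le {c : ℝ} (hc : 0 ≤ c) (h : ∀ j, j ≠ i → b j ≤ c) :
    mkt.competingBid m b i ≤ c := by
  classical
  refine csSup_le (nonempty_competing m b i) fun x hx => ?_
  obtain ⟨j, hj⟩ := Finset.card_pos.1 (lt_of_lt_of_le mkt.one_le_γ hx)
  simp only [Finset.mem_filter, Finset.mem_univ, true_and] at hj
  have h2 := hj.2
  split_ifs at h2
  · exact h2.trans (h j hj.1)
  · exact h2.trans hc

theorem competingBid_eq_zero (hb : ∀ j, j ≠ i → 0 ≤ b j) (h : ∀ j, j ≠ i → m j ≠ m i) :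
    mkt.competingBid m b i = 0 := by
  refine le_antisymm ?_ (competingBid_nonneg hb)
  have h1 := competingBid_le_add (m := m) (b := b) (b' := fun _ => 0) (i := i) (c := 0) le_rfl
    fun j hj hm => absurd hm (h j hj)
  have h2 : mkt.competingBid m (fun _ => 0) i ≤ 0 := competingBid_le le_rfl fun _ _ => le_rfl
  linarith

theorem abs_competingBid_sub_le (m : Fin mkt.N → Fin mkt.M) (b b' : Fin mkt.N → ℝ)
    (i : Fin mkt.N) :
    |mkt.competingBid m b i - mkt.competingBid m b' i| ≤
      ∑ j ∈ Finset.univ.erase i, if m j = m i then |b j - b' j| else 0 := by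
  have h0 : ∀ j ∈ Finset.univ.erase i, 0 ≤ if m j = m i then |b j - b' j| else 0 := by
    intro j _
    split_ifs <;> simp
  have h1 : ∀ j, j ≠ i → m j = m i →
      |b j - b' j| ≤ ∑ j ∈ Finset.univ.erase i, if m j = m i then |b j - b' j| else 0 := by
    intro j hj hm
    refine le_trans ?_ (Finset.single_le_sum h0 (Finset.mem_erase.2 ⟨hj, Finset.mem_univ j⟩))
    simp [hm]
  have hs := Finset.sum_nonneg h0
  rw [abs_le]
  constructor
  · have := competingBid_le_add (m := m) (b := b') (b' := b) (i := i) hs fun j hj hm => by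
      have := (abs_le.1 (h1 j hj hm)).1
      linarith
    linarith
  · have := competingBid_le_add (m := m) (b := b) (b' := b') (i := i) hs fun j hj hm => by
      have := (abs_le.1 (h1 j hj hm)).2
      linarith
    linarith

theorem wins_mem (m : Fin mkt.N → Fin mkt.M) (b : Fin mkt.N → ℝ) (i : Fin mkt.N) :
    mkt.wins m b i ∈ Set.Icc (0 : ℝ) 1 := by
  unfold wins
  split_ifs <;> simp

theorem payment_of_lt (h : mkt.competingBid m b i < b i) :
    mkt.payment m b i = mkt.competingBid m b i := by
  simp [payment, wins, h]

theorem payment_of_le (h : b i ≤ mkt.competingBid m b i) : mkt.payment m b i = 0 := by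
  simp [payment, wins, not_lt.2 h]

theorem payment_nonneg (h : ∀ j, j ≠ i → 0 ≤ b j) : 0 ≤ mkt.payment m b i :=
  mul_nonneg (wins_mem m b i).1 (competingBid_nonneg h)

theorem payment_le_bid (h : 0 ≤ b i) : mkt.payment m b i ≤ b i := by
  rcases lt_or_ge (mkt.competingBid m b i) (b i) with h' | h'
  · rw [payment_of_lt h']
    exact h'.le
  · rw [payment_of_le h']
    exact h

end OrderStatistics

/-! ### Measurability of prices, payments and records. -/

section Measurability

theorem measurable_competingBid (i : Fin mkt.N) :
    Measurable fun p : (Fin mkt.N → Fin mkt.M) × (Fin mkt.N → ℝ) =>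
      mkt.competingBid p.1 p.2 i := by
  -- There are finitely many assignments `m`, and for each of them the price is 1-Lipschitz in the
  -- bids.
  refine measurable_from_prod_countable_right fun m => ?_
  have : LipschitzWith 1 fun b : Fin mkt.N → ℝ => mkt.competingBid m b i := by
    refine LipschitzWith.of_le_add fun b b' => competingBid_le_add dist_nonneg fun j _ _ => ?_
    have h1 := dist_le_pi_dist b b' j
    rw [Real.dist_eq] at h1
    linarith [le_abs_self (b j - b' j)]
  exact this.continuous.measurable

variable {α : Type*} [MeasurableSpace α]

theorem measurable_competingBid_comp {m : α → Fin mkt.N → Fin mkt.M} {b : α → Fin mkt.N → ℝ}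
    (hm : Measurable m) (hb : Measurable b) (i : Fin mkt.N) :
    Measurable fun a => mkt.competingBid (m a) (b a) i := by
  have h := hm.prodMk hb
  have h2 := (mkt.measurable_competingBid i).comp h
  exact h2

theorem measurable_wins_comp {m : α → Fin mkt.N → Fin mkt.M} {b : α → Fin mkt.N → ℝ}
    (hm : Measurable m) (hb : Measurable b) (i : Fin mkt.N) :
    Measurable fun a => mkt.wins (m a) (b a) i :=
  Measurable.ite (measurableSet_lt (mkt.measurable_competingBid_comp hm hb i) (measurable_pi_iff.1 hb i))
    measurable_const measurable_const

theorem measurable_payment_comp {m : α → Fin mkt.N → Fin mkt.M} {b : α → Fin mkt.N → ℝ}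
    (hm : Measurable m) (hb : Measurable b) (i : Fin mkt.N) :
    Measurable fun a => mkt.payment (m a) (b a) i :=
  (mkt.measurable_wins_comp hm hb i).mul (mkt.measurable_competingBid_comp hm hb i)

theorem measurable_budget (T t : ℕ) (i : Fin mkt.N) :
    Measurable fun past : mkt.Past t => mkt.budget T past i := by
  unfold budget Record.pay
  fun_prop

theorem measurable_nextPast (T t : ℕ) : Measurable (mkt.nextPast T t) := by
  refine measurable_pi_lambda _ fun i => measurable_pi_lambda _ fun s => ?_
  refine Fin.lastCases ?_ (fun s => ?_) s
  · simp only [nextPast, Fin.snoc_last, mkRecord]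
    have h1 := (measurable_snd.comp (measurable_snd.comp measurable_fst) :
      Measurable fun w : (mkt.Past t × mkt.Draw) × (Fin mkt.N → ℝ) => w.1.2.2)
    have h2 := mkt.measurable_payment_comp h1 measurable_snd i
    have h3 := mkt.measurable_wins_comp h1 measurable_snd i
    have h4 := (mkt.measurable_budget T t i).comp
      (measurable_fst.comp measurable_fst :
        Measurable fun w : (mkt.Past t × mkt.Draw) × (Fin mkt.N → ℝ) => w.1.1)
    simp only [Function.comp_def] at h4
    fun_prop
  · simp only [nextPast, Fin.snoc_castSucc]
    fun_prop

end Measurability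

/-! ### The law of one period: matching probabilities and resampling of a valuation. -/

section Draws

instance : IsProbabilityMeasure mkt.draw := by
  unfold draw
  infer_instance

theorem ae_draw_mem : ∀ᵐ w ∂mkt.draw, ∀ i, w.1 i ∈ Set.Icc (0 : ℝ) 1 := by
  have h : ∀ᵐ v ∂Measure.pi mkt.V, ∀ i, v i ∈ Set.Icc (0 : ℝ) 1 :=
    ae_all_iff.2 fun i => Measure.tendsto_eval_ae_ae (mkt.V_supp i)
  exact (Measure.quasiMeasurePreserving_fst (μ := Measure.pi mkt.V)
    (ν := Measure.pi fun i => (mkt.π i).toMeasure)).ae h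

theorem integral_match {i j : Fin mkt.N} (hij : i ≠ j) :
    ∫ w, (if w.2 j = w.2 i then (1 : ℝ) else 0) ∂mkt.draw = mkt.matchProb i j := by
  have h1 : (fun w : mkt.Draw => if w.2 j = w.2 i then (1 : ℝ) else 0)
      = Set.indicator ((fun w : mkt.Draw => (w.2 i, w.2 j)) ⁻¹' {p | p.2 = p.1}) 1 := by
    ext w
    simp [Set.indicator_apply]
  have hm : Measurable fun w : mkt.Draw => (w.2 i, w.2 j) := by fun_prop
  have hs : MeasurableSet {p : Fin mkt.M × Fin mkt.M | p.2 = p.1} := Set.Finite.measurableSet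
    (Set.toFinite _)
  rw [h1, integral_indicator_one (hm hs), matchProb, ← map_measureReal_apply hm hs]
  congr 1
  have h2 : mkt.draw.map (fun w => (w.2 i, w.2 j)) =
      (mkt.draw.map Prod.snd).map fun m => (m i, m j) := by
    rw [Measure.map_map (by fun_prop) measurable_snd]
    rfl
  have h3 : iIndepFun (fun k (m : Fin mkt.N → Fin mkt.M) => m k)
      (Measure.pi fun k => (mkt.π k).toMeasure) :=
    iIndepFun_pi (X := fun _ x => x) fun _ => aemeasurable_id
  rw [h2, draw, Measure.map_snd_prod, measure_univ, one_smul,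
    (indepFun_iff_map_prod_eq_prod_map_map (measurable_pi_apply i).aemeasurable
      (measurable_pi_apply j).aemeasurable).1 (h3.indepFun hij)]
  congr 1
  · exact (measurePreserving_eval (fun k => (mkt.π k).toMeasure) i).map_eq
  · exact (measurePreserving_eval (fun k => (mkt.π k).toMeasure) j).map_eq

theorem matchProb_nonneg (i j : Fin mkt.N) : 0 ≤ mkt.matchProb i j := measureReal_nonneg

theorem matchNorm_nonneg (i : Fin mkt.N) : 0 ≤ mkt.matchNorm i := Real.sqrt_nonneg _

/-- Replacing the valuation of one agent by an independent copy preserves the law. -/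
theorem map_update_pi (i : Fin mkt.N) :
    ((mkt.V i).prod (Measure.pi mkt.V)).map (fun p => Function.update p.2 i p.1)
      = Measure.pi mkt.V := by
  have hm : Measurable fun p : ℝ × (Fin mkt.N → ℝ) => Function.update p.2 i p.1 := by
    refine measurable_pi_lambda _ fun j => ?_
    rcases eq_or_ne j i with rfl | hj
    · simpa using measurable_fst
    · simp only [Function.update_of_ne hj]
      fun_prop
  refine (Measure.pi_eq fun s hs => ?_).symm
  rw [Measure.map_apply hm (MeasurableSet.univ_pi hs)]
  have : (fun p : ℝ × (Fin mkt.N → ℝ) => Function.update p.2 i p.1) ⁻¹' Set.univ.pi s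
      = s i ×ˢ Set.univ.pi (Function.update s i Set.univ) := by
    ext ⟨x, v⟩
    simp only [Set.mem_preimage, Set.mem_pi, Set.mem_univ, true_implies, Set.mem_prod]
    constructor
    · refine fun h => ⟨by simpa using h i, fun j => ?_⟩
      rcases eq_or_ne j i with rfl | hj
      · simp
      · simpa [Function.update_of_ne hj] using h j
    · rintro ⟨h1, h2⟩ j
      rcases eq_or_ne j i with rfl | hj
      · simpa using h1
      · simpa [Function.update_of_ne hj] using h2 j
  rw [this, Measure.prod_prod, Measure.pi_pi, ← Finset.mul_prod_erase _ _ (Finset.mem_univ i),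
    ← Finset.mul_prod_erase (a := i) _ (fun j => mkt.V j (s j)) (Finset.mem_univ i)]
  simp only [Function.update_self, measure_univ, one_mul]
  congr 1
  refine Finset.prod_congr rfl fun j hj => ?_
  rw [Function.update_of_ne (Finset.ne_of_mem_erase hj)]

end Draws

end Market

end Pacing

/-! ### Expected payments and their Lipschitz dependence on the multipliers. -/

namespace Pacing

/-- A Lipschitz constant of the expected payments as functions of the multipliers. -/
noncomputable def payLip (Δ lo hi νhi : ℝ) : ℝ :=
  2 * νhi / lo * (Δ / lo) + (1 + 2 * νhi * hi / lo) * (Δ / lo ^ 2)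

namespace Market

variable (mkt : Market)

/-- The bids `Δ v_j / μ_j`. -/
noncomputable def shade (μ v : Fin mkt.N → ℝ) : Fin mkt.N → ℝ := fun j => mkt.Δ * v j / μ j

theorem expenditure_eq (μ : Fin mkt.N → ℝ) (i : Fin mkt.N) :
    mkt.expenditure μ i = ∫ w, mkt.payment w.2 (mkt.shade μ w.1) i ∂mkt.draw := rfl

theorem measurable_shade (μ : Fin mkt.N → ℝ) : Measurable (mkt.shade μ) := by
  unfold shade
  fun_prop

variable {mkt}
variable {lo hi : ℝ}

theorem shade_nonneg {μ v : Fin mkt.N → ℝ} (j : Fin mkt.N) (hμ : 0 < μ j)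
    (hv : v j ∈ Set.Icc (0 : ℝ) 1) : 0 ≤ mkt.shade μ v j :=
  div_nonneg (mul_nonneg mkt.Δ_pos.le hv.1) hμ.le

theorem shade_le_div {μ v : Fin mkt.N → ℝ} (j : Fin mkt.N) (hμ : 0 < μ j)
    (hv : v j ∈ Set.Icc (0 : ℝ) 1) : mkt.shade μ v j ≤ mkt.Δ / μ j := by
  unfold shade
  have := mkt.Δ_pos
  gcongr
  nlinarith [hv.2]

theorem shade_le (hlo : 0 < lo) {μ v : Fin mkt.N → ℝ} (j : Fin mkt.N) (hμ : lo ≤ μ j)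
    (hv : v j ∈ Set.Icc (0 : ℝ) 1) : mkt.shade μ v j ≤ mkt.Δ / lo :=
  (shade_le_div j (hlo.trans_le hμ) hv).trans (div_le_div_of_nonneg_left mkt.Δ_pos.le hlo hμ)

theorem abs_shade_sub_le (hlo : 0 < lo) {μ μ' v : Fin mkt.N → ℝ} (j : Fin mkt.N) (hμ : lo ≤ μ j)
    (hμ' : lo ≤ μ' j) (hv : v j ∈ Set.Icc (0 : ℝ) 1) :
    |mkt.shade μ v j - mkt.shade μ' v j| ≤ mkt.Δ / lo ^ 2 * |μ j - μ' j| := by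
  have h1 : 0 < μ j := hlo.trans_le hμ
  have h2 : 0 < μ' j := hlo.trans_le hμ'
  have hΔ := mkt.Δ_pos
  have h3 : mkt.shade μ v j - mkt.shade μ' v j
      = mkt.Δ * v j / (μ j * μ' j) * (μ' j - μ j) := by
    unfold shade
    field_simp
  rw [h3, abs_mul, abs_sub_comm (μ' j), abs_of_nonneg (by have := hv.1; positivity)]
  gcongr
  · nlinarith [hv.2]
  · nlinarith

theorem competingBid_shade_mem (hlo : 0 < lo) {μ : Fin mkt.N → ℝ} (hμ : ∀ j, lo ≤ μ j)
    {w : mkt.Draw} (hw : ∀ j, w.1 j ∈ Set.Icc (0 : ℝ) 1) (i : Fin mkt.N) :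
    mkt.competingBid w.2 (mkt.shade μ w.1) i ∈ Set.Icc 0 (mkt.Δ / lo) :=
  ⟨competingBid_nonneg fun j _ => shade_nonneg j (hlo.trans_le (hμ j)) (hw j),
    competingBid_le (div_nonneg mkt.Δ_pos.le hlo.le) fun j _ => shade_le hlo j (hμ j) (hw j)⟩

theorem payment_shade_mem (hlo : 0 < lo) {μ : Fin mkt.N → ℝ} (hμ : ∀ j, lo ≤ μ j)
    {w : mkt.Draw} (hw : ∀ j, w.1 j ∈ Set.Icc (0 : ℝ) 1) (i : Fin mkt.N) :
    mkt.payment w.2 (mkt.shade μ w.1) i ∈ Set.Icc 0 (mkt.Δ / lo) :=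
  ⟨payment_nonneg fun j _ => shade_nonneg j (hlo.trans_le (hμ j)) (hw j),
    (payment_le_bid (shade_nonneg i (hlo.trans_le (hμ i)) (hw i))).trans
      (shade_le hlo i (hμ i) (hw i))⟩

theorem measurable_competingBid_shade (μ : Fin mkt.N → ℝ) (i : Fin mkt.N) :
    Measurable fun w : mkt.Draw => mkt.competingBid w.2 (mkt.shade μ w.1) i :=
  mkt.measurable_competingBid_comp measurable_snd
    ((mkt.measurable_shade μ).comp measurable_fst) i

theorem measurable_payment_shade (μ : Fin mkt.N → ℝ) (i : Fin mkt.N) :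
    Measurable fun w : mkt.Draw => mkt.payment w.2 (mkt.shade μ w.1) i :=
  mkt.measurable_payment_comp measurable_snd
    ((mkt.measurable_shade μ).comp measurable_fst) i

theorem integrable_competingBid_shade (hlo : 0 < lo) {μ : Fin mkt.N → ℝ} (hμ : ∀ j, lo ≤ μ j)
    (i : Fin mkt.N) :
    Integrable (fun w : mkt.Draw => mkt.competingBid w.2 (mkt.shade μ w.1) i) mkt.draw := by
  refine Integrable.of_bound (measurable_competingBid_shade μ i).aestronglyMeasurable
    (mkt.Δ / lo) ?_
  filter_upwards [mkt.ae_draw_mem] with w hw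
  have h := competingBid_shade_mem hlo hμ hw i
  rw [Real.norm_of_nonneg h.1]
  exact h.2

theorem integrable_payment_shade (hlo : 0 < lo) {μ : Fin mkt.N → ℝ} (hμ : ∀ j, lo ≤ μ j)
    (i : Fin mkt.N) :
    Integrable (fun w : mkt.Draw => mkt.payment w.2 (mkt.shade μ w.1) i) mkt.draw := by
  refine Integrable.of_bound (measurable_payment_shade μ i).aestronglyMeasurable
    (mkt.Δ / lo) ?_
  filter_upwards [mkt.ae_draw_mem] with w hw
  have h := payment_shade_mem hlo hμ hw i
  rw [Real.norm_of_nonneg h.1]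
  exact h.2

theorem integrable_match (i j : Fin mkt.N) :
    Integrable (fun w : mkt.Draw => if w.2 j = w.2 i then (1 : ℝ) else 0) mkt.draw := by
  refine Integrable.of_bound (Measurable.aestronglyMeasurable ?_) 1 (ae_of_all _ fun w => ?_)
  · exact Measurable.ite (measurableSet_eq_fun (by fun_prop) (by fun_prop)) measurable_const
      measurable_const
  · split_ifs <;> simp

theorem integral_sum_match (i : Fin mkt.N) (c : Fin mkt.N → ℝ) :
    ∫ w, ∑ j ∈ Finset.univ.erase i, c j * (if w.2 j = w.2 i then (1 : ℝ) else 0) ∂mkt.draw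
      = ∑ j ∈ Finset.univ.erase i, mkt.matchProb i j * c j := by
  rw [integral_finsetSum _ fun j _ => (integrable_match i j).const_mul _]
  refine Finset.sum_congr rfl fun j hj => ?_
  rw [integral_const_mul, mkt.integral_match (Finset.ne_of_mem_erase hj).symm, mul_comm]

theorem integrable_sum_match (i : Fin mkt.N) (c : Fin mkt.N → ℝ) :
    Integrable (fun w : mkt.Draw => ∑ j ∈ Finset.univ.erase i,
      c j * (if w.2 j = w.2 i then (1 : ℝ) else 0)) mkt.draw :=
  integrable_finsetSum _ fun j _ => (integrable_match i j).const_mul _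

/-- Agent `j` can move the price of `i` only when they meet, hence the weight `matchProb i j`. These
weights are the source of every factor `‖a_i‖` in the theorem. -/
theorem integral_abs_competingBid_sub_le (hlo : 0 < lo) {μ μ' : Fin mkt.N → ℝ}
    (hμ : ∀ j, lo ≤ μ j) (hμ' : ∀ j, lo ≤ μ' j) (i : Fin mkt.N) :
    ∫ w, |mkt.competingBid w.2 (mkt.shade μ w.1) i
        - mkt.competingBid w.2 (mkt.shade μ' w.1) i| ∂mkt.draw
      ≤ mkt.Δ / lo ^ 2 * ∑ j ∈ Finset.univ.erase i, mkt.matchProb i j * |μ j - μ' j| := by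
  have h1 := integral_sum_match i fun j => mkt.Δ / lo ^ 2 * |μ j - μ' j|
  rw [Finset.mul_sum]
  refine le_trans (integral_mono_ae
    ((integrable_competingBid_shade hlo hμ i).sub (integrable_competingBid_shade hlo hμ' i)).abs
    (integrable_sum_match i fun j => mkt.Δ / lo ^ 2 * |μ j - μ' j|) ?_)
    (h1.le.trans (Finset.sum_le_sum fun j _ => le_of_eq (by ring)))
  filter_upwards [mkt.ae_draw_mem] with w hw
  refine (abs_competingBid_sub_le _ _ _ i).trans (Finset.sum_le_sum fun j _ => ?_)
  split_ifs
  · rw [mul_one]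
    exact abs_shade_sub_le hlo j (hμ j) (hμ' j) (hw j)
  · simp

theorem expenditure_nonneg (hlo : 0 < lo) {μ : Fin mkt.N → ℝ} (hμ : ∀ j, lo ≤ μ j)
    (i : Fin mkt.N) : 0 ≤ mkt.expenditure μ i :=
  integral_nonneg_of_ae (by
    filter_upwards [mkt.ae_draw_mem] with w hw using (payment_shade_mem hlo hμ hw i).1)

theorem expenditure_le (hlo : 0 < lo) {μ : Fin mkt.N → ℝ} (hμ : ∀ j, lo ≤ μ j)
    (i : Fin mkt.N) : mkt.expenditure μ i ≤ mkt.Δ / lo := by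
  have h := integral_mono_ae (integrable_payment_shade hlo hμ i)
    (integrable_const (mkt.Δ / lo)) (by
      filter_upwards [mkt.ae_draw_mem] with w hw using (payment_shade_mem hlo hμ hw i).2)
  rw [expenditure_eq]
  simpa using h

/-- An agent pays only if it meets another agent. -/
theorem expenditure_le_sum_match (hlo : 0 < lo) {μ : Fin mkt.N → ℝ} (hμ : ∀ j, lo ≤ μ j)
    (i : Fin mkt.N) :
    mkt.expenditure μ i ≤ ∑ j ∈ Finset.univ.erase i, mkt.matchProb i j * (mkt.Δ / lo) := by
  rw [← integral_sum_match i fun _ => mkt.Δ / lo]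
  refine integral_mono_ae (integrable_payment_shade hlo hμ i)
    (integrable_sum_match i fun _ => mkt.Δ / lo) ?_
  filter_upwards [mkt.ae_draw_mem] with w hw
  have hB : 0 ≤ mkt.Δ / lo := div_nonneg mkt.Δ_pos.le hlo.le
  have h0 : ∀ j ∈ Finset.univ.erase i,
      0 ≤ mkt.Δ / lo * (if w.2 j = w.2 i then (1 : ℝ) else 0) := by
    intro j _
    split_ifs <;> simp [hB]
  by_cases h : ∀ j, j ≠ i → w.2 j ≠ w.2 i
  · have h2 := competingBid_eq_zero (mkt := mkt) (b := mkt.shade μ w.1) (fun j _ =>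
      shade_nonneg j (hlo.trans_le (hμ j)) (hw j)) h
    change mkt.payment w.2 (mkt.shade μ w.1) i ≤ _
    rw [payment, h2, mul_zero]
    exact Finset.sum_nonneg h0
  · push Not at h
    obtain ⟨j, hj, hm⟩ := h
    refine (payment_shade_mem hlo hμ hw i).2.trans ?_
    refine le_trans ?_ (Finset.single_le_sum h0 (Finset.mem_erase.2 ⟨hj, Finset.mem_univ j⟩))
    simp [hm]

section Density

variable {νlo νhi : ℝ}

theorem HasDensities.nonneg (hV : mkt.HasDensities νlo νhi) (hν : 0 < νlo) : 0 ≤ νhi := by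
  obtain ⟨f, -, hf, -⟩ := hV ⟨0, by have := mkt.γ_lt_N; omega⟩
  have := hf 0 (by simp)
  exact (hν.le.trans this.1).trans this.2

theorem HasDensities.measure_Ioc_le (hV : mkt.HasDensities νlo νhi) (i : Fin mkt.N) (a b : ℝ) :
    mkt.V i (Set.Ioc a b) ≤ ENNReal.ofReal νhi * ENNReal.ofReal (b - a) := by
  obtain ⟨f, hfm, hf, hVi⟩ := hV i
  rw [hVi, withDensity_apply _ measurableSet_Ioc, Measure.restrict_restrict measurableSet_Ioc]
  calc ∫⁻ x in Set.Ioc a b ∩ Set.Icc 0 1, ENNReal.ofReal (f x)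
      ≤ ∫⁻ _ in Set.Ioc a b ∩ Set.Icc 0 1, ENNReal.ofReal νhi :=
        setLIntegral_mono measurable_const fun x hx => ENNReal.ofReal_le_ofReal (hf x hx.2).2
    _ ≤ ENNReal.ofReal νhi * ENNReal.ofReal (b - a) := by
        rw [setLIntegral_const]
        gcongr
        exact (measure_mono Set.inter_subset_left).trans (by rw [Real.volume_Ioc])

theorem map_update_draw (i : Fin mkt.N) :
    ((mkt.V i).prod mkt.draw).map (fun p => (Function.update p.2.1 i p.1, p.2.2))
      = mkt.draw := by
  have hm : Measurable fun p : ℝ × (Fin mkt.N → ℝ) => Function.update p.2 i p.1 := by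
    refine measurable_pi_lambda _ fun j => ?_
    rcases eq_or_ne j i with rfl | hj
    · simpa using measurable_fst
    · simp only [Function.update_of_ne hj]
      fun_prop
  have h1 := Measure.map_prod_map ((mkt.V i).prod (Measure.pi mkt.V))
    (Measure.pi fun i => (mkt.π i).toMeasure) hm measurable_id
  rw [map_update_pi, Measure.map_id] at h1
  have h2 := (measurePreserving_prodAssoc (mkt.V i) (Measure.pi mkt.V)
    (Measure.pi fun i => (mkt.π i).toMeasure)).map_eq
  have hm2 : Measurable fun p : ℝ × mkt.Draw => (Function.update p.2.1 i p.1, p.2.2) :=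
    (hm.comp (by fun_prop : Measurable fun p : ℝ × mkt.Draw => (p.1, p.2.1))).prodMk (by fun_prop)
  rw [draw, ← h2, Measure.map_map hm2 (MeasurableEquiv.measurable _), h1]
  rfl

theorem lintegral_draw_eq (i : Fin mkt.N) {F : mkt.Draw → ENNReal} (hF : Measurable F) :
    ∫⁻ w, F w ∂mkt.draw
      = ∫⁻ w, ∫⁻ x, F (Function.update w.1 i x, w.2) ∂mkt.V i ∂mkt.draw := by
  have hm : Measurable fun p : ℝ × mkt.Draw => (Function.update p.2.1 i p.1, p.2.2) := by
    refine Measurable.prodMk (measurable_pi_lambda _ fun j => ?_) (by fun_prop)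
    rcases eq_or_ne j i with rfl | hj
    · simpa using measurable_fst
    · simp only [Function.update_of_ne hj]
      fun_prop
  conv_lhs => rw [← map_update_draw i]
  rw [lintegral_map hF hm]
  exact lintegral_prod_symm _ (hF.comp hm).aemeasurable

/-- The probability that a valuation falls between two thresholds that do not depend on it. -/
theorem HasDensities.draw_between_le (hV : mkt.HasDensities νlo νhi) (hν : 0 < νlo)
    (i : Fin mkt.N) {U U' : mkt.Draw → ℝ} (hU : Measurable U) (hU' : Measurable U')
    (hUi : ∀ w x, U (Function.update w.1 i x, w.2) = U w)
    (hUi' : ∀ w x, U' (Function.update w.1 i x, w.2) = U' w)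
    (hint : Integrable (fun w => |U w - U' w|) mkt.draw) :
    mkt.draw.real {w | w.1 i ∈ Set.Ioc (U w) (U' w)} ≤ νhi * ∫ w, |U w - U' w| ∂mkt.draw := by
  have hνhi := hV.nonneg hν
  have hS : MeasurableSet {w : mkt.Draw | w.1 i ∈ Set.Ioc (U w) (U' w)} :=
    (measurableSet_lt hU (by fun_prop)).inter (measurableSet_le (by fun_prop) hU')
  have h1 : mkt.draw {w | w.1 i ∈ Set.Ioc (U w) (U' w)}
      ≤ ENNReal.ofReal (νhi * ∫ w, |U w - U' w| ∂mkt.draw) := by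
    -- The valuation of `i` is resampled with all else fixed. The thresholds do not move, and an
    -- interval has mass at most `νhi` times its length.
    rw [← lintegral_indicator_one hS, lintegral_draw_eq i (measurable_one.indicator hS),
      ENNReal.ofReal_mul hνhi, ofReal_integral_eq_lintegral_ofReal hint
        (ae_of_all _ fun _ => abs_nonneg _),
      ← lintegral_const_mul _ (by fun_prop)]
    refine lintegral_mono fun w => ?_
    have h2 : ∀ x, Set.indicator {w : mkt.Draw | w.1 i ∈ Set.Ioc (U w) (U' w)}
        (1 : mkt.Draw → ENNReal) (Function.update w.1 i x, w.2)
        = Set.indicator (Set.Ioc (U w) (U' w)) 1 x := by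
      intro x
      simp only [Set.indicator_apply, Set.mem_ofPred_eq, hUi, hUi', Function.update_self,
        Pi.one_apply]
    simp only [h2]
    rw [lintegral_indicator_one measurableSet_Ioc]
    refine (hV.measure_Ioc_le i _ _).trans ?_
    gcongr
    rw [abs_sub_comm]
    exact le_abs_self _
  have h3 : 0 ≤ νhi * ∫ w, |U w - U' w| ∂mkt.draw :=
    mul_nonneg hνhi (integral_nonneg fun _ => abs_nonneg _)
  exact ENNReal.toReal_le_of_le_ofReal h3 h1

theorem competingBid_shade_update (μ : Fin mkt.N → ℝ) (i : Fin mkt.N) (w : mkt.Draw) (x : ℝ) :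
    mkt.competingBid w.2 (mkt.shade μ (Function.update w.1 i x)) i
      = mkt.competingBid w.2 (mkt.shade μ w.1) i :=
  competingBid_congr fun j hj => by simp [shade, Function.update_of_ne hj]

theorem payLip_nonneg {Δ : ℝ} (hΔ : 0 ≤ Δ) (hlo : 0 < lo) (hhi : 0 ≤ hi) (hν : 0 ≤ νhi) :
    0 ≤ payLip Δ lo hi νhi := by
  unfold payLip
  positivity

/-- Payments jump when a win turns into a loss, so Lipschitz continuity holds only in the mean.
Agent `i` wins iff its valuation exceeds the threshold `μ i * d / Δ`, which does not involve that
valuation. The bounded density makes a change of outcome as unlikely as the two thresholds are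
close. -/
theorem HasDensities.integral_abs_payment_sub_le (hV : mkt.HasDensities νlo νhi) (hν : 0 < νlo)
    (hlo : 0 < lo) {μ μ' : Fin mkt.N → ℝ} (hμ : ∀ j, μ j ∈ Set.Icc lo hi)
    (hμ' : ∀ j, μ' j ∈ Set.Icc lo hi) (i : Fin mkt.N) :
    ∫ w, |mkt.payment w.2 (mkt.shade μ w.1) i - mkt.payment w.2 (mkt.shade μ' w.1) i| ∂mkt.draw
      ≤ payLip mkt.Δ lo hi νhi *
        (|μ i - μ' i| + ∑ j ∈ Finset.univ.erase i, mkt.matchProb i j * |μ j - μ' j|) := by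
  have hνhi := hV.nonneg hν
  have hΔ := mkt.Δ_pos
  have hhi : 0 < hi := hlo.trans_le ((hμ i).1.trans (hμ i).2)
  set d : mkt.Draw → ℝ := fun w => mkt.competingBid w.2 (mkt.shade μ w.1) i with hd
  set d' : mkt.Draw → ℝ := fun w => mkt.competingBid w.2 (mkt.shade μ' w.1) i with hd'
  have hdi : Integrable d mkt.draw := integrable_competingBid_shade hlo (fun j => (hμ j).1) i
  have hdi' : Integrable d' mkt.draw := integrable_competingBid_shade hlo (fun j => (hμ' j).1) i
  have hdi2 : Integrable (fun w => |d w - d' w|) mkt.draw := (hdi.sub hdi').abs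
  have hdm : Measurable d := measurable_competingBid_shade μ i
  have hdm' : Measurable d' := measurable_competingBid_shade μ' i
  set U : mkt.Draw → ℝ := fun w => μ i * d w / mkt.Δ with hU
  set U' : mkt.Draw → ℝ := fun w => μ' i * d' w / mkt.Δ with hU'
  have hUm : Measurable U := by fun_prop
  have hUm' : Measurable U' := by fun_prop
  have hUi : Integrable (fun w => |U w - U' w|) mkt.draw :=
    (((hdi.const_mul _).div_const _).sub ((hdi'.const_mul _).div_const _)).abs
  have hUi' : Integrable (fun w => |U' w - U w|) mkt.draw := by
    simpa only [abs_sub_comm] using hUi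
  have hinv : ∀ w x, U (Function.update w.1 i x, w.2) = U w := fun w x => by
    simp only [hU, hd, competingBid_shade_update]
  have hinv' : ∀ w x, U' (Function.update w.1 i x, w.2) = U' w := fun w x => by
    simp only [hU', hd', competingBid_shade_update]
  have hp1 := hV.draw_between_le hν i hUm hUm' hinv hinv' hUi
  have hp2 := hV.draw_between_le hν i hUm' hUm hinv' hinv hUi'
  simp only [abs_sub_comm (U' _)] at hp2
  have hS1 : MeasurableSet {w : mkt.Draw | w.1 i ∈ Set.Ioc (U w) (U' w)} :=
    (measurableSet_lt hUm (by fun_prop)).inter (measurableSet_le (by fun_prop) hUm')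
  have hS2 : MeasurableSet {w : mkt.Draw | w.1 i ∈ Set.Ioc (U' w) (U w)} :=
    (measurableSet_lt hUm' (by fun_prop)).inter (measurableSet_le (by fun_prop) hUm)
  have hdd := integral_abs_competingBid_sub_le hlo (fun j => (hμ j).1) (fun j => (hμ' j).1) i
  set A := ∑ j ∈ Finset.univ.erase i, mkt.matchProb i j * |μ j - μ' j| with hA
  have hUU : ∫ w, |U w - U' w| ∂mkt.draw
      ≤ (1 / lo) * |μ i - μ' i| + hi / mkt.Δ * ∫ w, |d w - d' w| ∂mkt.draw := by
    have : ∫ w, ((1 / lo) * |μ i - μ' i| + hi / mkt.Δ * |d w - d' w|) ∂mkt.draw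
        = (1 / lo) * |μ i - μ' i| + hi / mkt.Δ * ∫ w, |d w - d' w| ∂mkt.draw := by
      rw [integral_add (integrable_const _) (hdi2.const_mul _), integral_const_mul (hi / mkt.Δ)]
      simp
    rw [← this]
    refine integral_mono_ae hUi ((integrable_const _).add (hdi2.const_mul _)) ?_
    filter_upwards [mkt.ae_draw_mem] with w hw
    have hdw := competingBid_shade_mem hlo (fun j => (hμ j).1) hw i
    -- The threshold moves with the agent's own multiplier and with the price.
    have h1 : U w - U' w = d w / mkt.Δ * (μ i - μ' i) + μ' i / mkt.Δ * (d w - d' w) := by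
      simp only [hU, hU']
      field_simp
      ring
    have h2 : d w / mkt.Δ ≤ 1 / lo := by
      rw [div_le_div_iff₀ hΔ hlo, one_mul, ← le_div_iff₀ hlo]
      exact hdw.2
    have h3 : 0 ≤ d w / mkt.Δ := div_nonneg hdw.1 hΔ.le
    have h4 : 0 ≤ μ' i / mkt.Δ := div_nonneg (hlo.le.trans (hμ' i).1) hΔ.le
    have h5 : μ' i / mkt.Δ ≤ hi / mkt.Δ := div_le_div_of_nonneg_right (hμ' i).2 hΔ.le
    simp only [h1]
    refine (abs_add_le _ _).trans ?_
    rw [abs_mul, abs_mul, abs_of_nonneg h3, abs_of_nonneg h4]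
    gcongr
  have hmain : ∫ w, |mkt.payment w.2 (mkt.shade μ w.1) i
        - mkt.payment w.2 (mkt.shade μ' w.1) i| ∂mkt.draw
      ≤ ∫ w, |d w - d' w| ∂mkt.draw
        + mkt.Δ / lo * (mkt.draw.real {w | w.1 i ∈ Set.Ioc (U w) (U' w)}
          + mkt.draw.real {w | w.1 i ∈ Set.Ioc (U' w) (U w)}) := by
    have hi1 : Integrable (Set.indicator {w : mkt.Draw | w.1 i ∈ Set.Ioc (U w) (U' w)}
      (1 : mkt.Draw → ℝ)) mkt.draw := (integrable_const (1 : ℝ)).indicator hS1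
    have hi2 : Integrable (Set.indicator {w : mkt.Draw | w.1 i ∈ Set.Ioc (U' w) (U w)}
      (1 : mkt.Draw → ℝ)) mkt.draw := (integrable_const (1 : ℝ)).indicator hS2
    have hi3 : Integrable (fun w => mkt.Δ / lo *
        (Set.indicator {w : mkt.Draw | w.1 i ∈ Set.Ioc (U w) (U' w)} (1 : mkt.Draw → ℝ) w
          + Set.indicator {w : mkt.Draw | w.1 i ∈ Set.Ioc (U' w) (U w)} (1 : mkt.Draw → ℝ) w))
        mkt.draw := (hi1.add hi2).const_mul _
    rw [← integral_indicator_one hS1, ← integral_indicator_one hS2, ← integral_add hi1 hi2,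
      ← integral_const_mul, ← integral_add hdi2 hi3]
    refine integral_mono_ae ((integrable_payment_shade hlo (fun j => (hμ j).1) i).sub
      (integrable_payment_shade hlo (fun j => (hμ' j).1) i)).abs
      (hdi2.add hi3) ?_
    filter_upwards [mkt.ae_draw_mem] with w hw
    have hdw := competingBid_shade_mem hlo (fun j => (hμ j).1) hw i
    have hdw' := competingBid_shade_mem hlo (fun j => (hμ' j).1) hw i
    have hB : 0 ≤ mkt.Δ / lo := div_nonneg hΔ.le hlo.le
    have hμi : 0 < μ i := hlo.trans_le (hμ i).1
    have hμi' : 0 < μ' i := hlo.trans_le (hμ' i).1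
    have e1 : d w < mkt.shade μ w.1 i ↔ U w < w.1 i := by
      simp only [hU, shade]
      rw [lt_div_iff₀ hμi, div_lt_iff₀ hΔ, mul_comm, mul_comm (w.1 i)]
    have e2 : d' w < mkt.shade μ' w.1 i ↔ U' w < w.1 i := by
      simp only [hU', shade]
      rw [lt_div_iff₀ hμi', div_lt_iff₀ hΔ, mul_comm, mul_comm (w.1 i)]
    have n1 : 0 ≤ Set.indicator {w : mkt.Draw | w.1 i ∈ Set.Ioc (U w) (U' w)}
      (1 : mkt.Draw → ℝ) w := Set.indicator_nonneg (fun _ _ => zero_le_one) _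
    have n2 : 0 ≤ Set.indicator {w : mkt.Draw | w.1 i ∈ Set.Ioc (U' w) (U w)}
      (1 : mkt.Draw → ℝ) w := Set.indicator_nonneg (fun _ _ => zero_le_one) _
    -- With equal outcomes the payments differ at most by the prices. With different outcomes the
    -- valuation lies between the thresholds, and the only payment is at most `Δ / lo`.
    rcases lt_or_ge (d w) (mkt.shade μ w.1 i) with h1 | h1 <;>
      rcases lt_or_ge (d' w) (mkt.shade μ' w.1 i) with h2 | h2
    · rw [payment_of_lt h1, payment_of_lt h2]
      have : 0 ≤ mkt.Δ / lo * (Set.indicator {w : mkt.Draw | w.1 i ∈ Set.Ioc (U w) (U' w)}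
        (1 : mkt.Draw → ℝ) w + Set.indicator {w : mkt.Draw | w.1 i ∈ Set.Ioc (U' w) (U w)}
        (1 : mkt.Draw → ℝ) w) := mul_nonneg hB (add_nonneg n1 n2)
      exact le_add_of_nonneg_right this
    · rw [payment_of_lt h1, payment_of_le h2, sub_zero, abs_of_nonneg hdw.1]
      have h3 : w ∈ {w : mkt.Draw | w.1 i ∈ Set.Ioc (U w) (U' w)} :=
        ⟨e1.1 h1, not_lt.1 fun h => not_lt.2 h2 (e2.2 h)⟩
      rw [Set.indicator_of_mem h3, Pi.one_apply]
      nlinarith [abs_nonneg (d w - d' w), hdw.2]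
    · rw [payment_of_le h1, payment_of_lt h2, zero_sub, abs_neg, abs_of_nonneg hdw'.1]
      have h3 : w ∈ {w : mkt.Draw | w.1 i ∈ Set.Ioc (U' w) (U w)} :=
        ⟨e2.1 h2, not_lt.1 fun h => not_lt.2 h1 (e1.2 h)⟩
      rw [Set.indicator_of_mem h3, Pi.one_apply]
      nlinarith [abs_nonneg (d w - d' w), hdw'.2]
    · rw [payment_of_le h1, payment_of_le h2, sub_zero, abs_zero]
      exact add_nonneg (abs_nonneg _) (mul_nonneg hB (add_nonneg n1 n2))
  have hA0 : 0 ≤ A := Finset.sum_nonneg fun j _ => mul_nonneg (matchProb_nonneg _ _ _)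
    (abs_nonneg _)
  have hD0 := abs_nonneg (μ i - μ' i)
  calc _ ≤ _ := hmain
    _ ≤ ∫ w, |d w - d' w| ∂mkt.draw
        + mkt.Δ / lo * (2 * (νhi * ((1 / lo) * |μ i - μ' i|
          + hi / mkt.Δ * ∫ w, |d w - d' w| ∂mkt.draw))) := by
        gcongr
        nlinarith [mul_le_mul_of_nonneg_left hUU hνhi]
    _ = 2 * νhi / lo * (mkt.Δ / lo) * |μ i - μ' i|
        + (1 + 2 * νhi * hi / lo) * ∫ w, |d w - d' w| ∂mkt.draw := by
        field_simp
        ring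
    _ ≤ 2 * νhi / lo * (mkt.Δ / lo) * |μ i - μ' i|
        + (1 + 2 * νhi * hi / lo) * (mkt.Δ / lo ^ 2 * A) := by
        gcongr
    _ ≤ payLip mkt.Δ lo hi νhi * (|μ i - μ' i| + A) := by
        unfold payLip
        have h1 : 0 ≤ 2 * νhi / lo * (mkt.Δ / lo) * A := by positivity
        have h2 : 0 ≤ (1 + 2 * νhi * hi / lo) * (mkt.Δ / lo ^ 2) * |μ i - μ' i| := by positivity
        nlinarith

theorem HasDensities.abs_expenditure_sub_le (hV : mkt.HasDensities νlo νhi) (hν : 0 < νlo)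
    (hlo : 0 < lo) {μ μ' : Fin mkt.N → ℝ} (hμ : ∀ j, μ j ∈ Set.Icc lo hi)
    (hμ' : ∀ j, μ' j ∈ Set.Icc lo hi) (i : Fin mkt.N) :
    |mkt.expenditure μ i - mkt.expenditure μ' i| ≤ payLip mkt.Δ lo hi νhi *
        (|μ i - μ' i| + ∑ j ∈ Finset.univ.erase i, mkt.matchProb i j * |μ j - μ' j|) := by
  rw [expenditure_eq, expenditure_eq,
    ← integral_sub (integrable_payment_shade hlo (fun j => (hμ j).1) i)
      (integrable_payment_shade hlo (fun j => (hμ' j).1) i)]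
  exact abs_integral_le_integral_abs.trans (hV.integral_abs_payment_sub_le hν hlo hμ hμ' i)

end Density

end Market

end Pacing

/-! ### Projection, strong monotonicity and one step of the unconstrained dynamics. -/

namespace Pacing

/-- The projection onto `[lo, hi]`. -/
noncomputable def clip (lo hi x : ℝ) : ℝ := min (max x lo) hi

section Clip

variable {lo hi : ℝ}

theorem clip_mem (h : lo ≤ hi) (x : ℝ) : clip lo hi x ∈ Set.Icc lo hi :=
  ⟨le_min (le_max_right _ _) h, min_le_right _ _⟩

theorem clip_of_mem {x : ℝ} (hx : x ∈ Set.Icc lo hi) : clip lo hi x = x := by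
  rw [clip, max_eq_left hx.1, min_eq_left hx.2]

theorem abs_clip_sub_clip_le (x y : ℝ) : |clip lo hi x - clip lo hi y| ≤ |x - y| := by
  unfold clip
  refine (abs_min_sub_min_le_max _ _ _ _).trans (max_le ?_ (by simp))
  exact (abs_max_sub_max_le_max _ _ _ _).trans (max_le le_rfl (by simp))

theorem sq_clip_sub_clip_le (x y : ℝ) : (clip lo hi x - clip lo hi y) ^ 2 ≤ (x - y) ^ 2 :=
  sq_le_sq.2 (abs_clip_sub_clip_le x y)

theorem sq_clip_sub_le {c : ℝ} (hc : c ∈ Set.Icc lo hi) (x : ℝ) :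
    (clip lo hi x - c) ^ 2 ≤ (x - c) ^ 2 := by
  simpa only [clip_of_mem hc] using sq_clip_sub_clip_le (lo := lo) (hi := hi) x c

theorem measurable_clip (lo hi : ℝ) : Measurable (clip lo hi) := by
  unfold clip
  fun_prop

end Clip

namespace Market

variable {mkt : Market}

theorem sum_match_mul_le (i : Fin mkt.N) (x : Fin mkt.N → ℝ) :
    ∑ j ∈ Finset.univ.erase i, mkt.matchProb i j * x j
      ≤ mkt.matchNorm i * √(∑ j ∈ Finset.univ.erase i, x j ^ 2) :=
  Real.sum_mul_le_sqrt_mul_sqrt _ _ _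

theorem sum_match_mul_le_univ (i : Fin mkt.N) (x : Fin mkt.N → ℝ) :
    ∑ j ∈ Finset.univ.erase i, mkt.matchProb i j * x j
      ≤ mkt.matchNorm i * √(∑ j, x j ^ 2) :=
  (sum_match_mul_le i x).trans (mul_le_mul_of_nonneg_left
    (Real.sqrt_le_sqrt (Finset.sum_le_sum_of_subset_of_nonneg (Finset.erase_subset _ _)
      fun _ _ _ => sq_nonneg _)) (mkt.matchNorm_nonneg i))

theorem sum_match_le (i : Fin mkt.N) :
    ∑ j ∈ Finset.univ.erase i, mkt.matchProb i j ≤ √mkt.N * mkt.matchNorm i := by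
  have h := sum_match_mul_le_univ i fun _ => 1
  simpa [mul_comm] using h

section Monotone

variable {lo hi lam νlo νhi : ℝ}

/-- Strong monotonicity extends from the open to the closed box. -/
theorem StronglyMonotone.closedBox (hmono : mkt.StronglyMonotone lam lo hi)
    (hV : mkt.HasDensities νlo νhi) (hν : 0 < νlo) (hlo : 0 < lo) (hlh : lo < hi)
    {μ μ' : Fin mkt.N → ℝ} (hμ : ∀ j, μ j ∈ Set.Icc lo hi) (hμ' : ∀ j, μ' j ∈ Set.Icc lo hi) :
    ∑ j, (μ j - μ' j) * (mkt.expenditure μ j - mkt.expenditure μ' j)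
      ≤ -lam * ∑ j, (μ j - μ' j) ^ 2 := by
  -- Projected multipliers may sit on the boundary of the box. Both profiles are shrunk slightly
  -- towards the centre, where the assumption applies, and continuity of the expenditure gives the
  -- limit.
  set c := (lo + hi) / 2 with hc
  set u : ℕ → ℝ := fun n => 1 / ((n : ℝ) + 1) with hu
  have hu0 : Tendsto u atTop (𝓝 0) := tendsto_one_div_add_atTop_nhds_zero_nat
  have hupos : ∀ n, 0 < u n := fun n => by positivity
  have hule : ∀ n, u n ≤ 1 := fun n => by
    rw [hu, div_le_one (by positivity)]
    linarith [n.cast_nonneg (α := ℝ)]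
  have hmem : ∀ {x : ℝ} (n : ℕ), x ∈ Set.Icc lo hi → x + u n * (c - x) ∈ Set.Ioo lo hi := by
    intro x n hx
    have h1 := hupos n
    have h2 := hule n
    constructor
    · nlinarith [mul_nonneg (sub_nonneg.2 h2) (sub_nonneg.2 hx.1), mul_pos h1 (sub_pos.2 hlh)]
    · nlinarith [mul_nonneg (sub_nonneg.2 h2) (sub_nonneg.2 hx.2), mul_pos h1 (sub_pos.2 hlh)]
  have hcoord : ∀ x : ℝ, Tendsto (fun n => x + u n * (c - x)) atTop (𝓝 x) := by
    intro x
    simpa using (tendsto_const_nhds (x := x)).add (hu0.mul_const (c - x))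
  have hexp : ∀ {x : Fin mkt.N → ℝ}, (∀ j, x j ∈ Set.Icc lo hi) → ∀ j,
      Tendsto (fun n => mkt.expenditure (fun k => x k + u n * (c - x k)) j) atTop
        (𝓝 (mkt.expenditure x j)) := by
    intro x hx j
    rw [tendsto_iff_dist_tendsto_zero]
    have h0 : ∀ k, Tendsto (fun n => |x k + u n * (c - x k) - x k|) atTop (𝓝 0) := by
      intro k
      simpa using ((hcoord (x k)).sub_const (x k)).abs
    have h1 : Tendsto (fun n => payLip mkt.Δ lo hi νhi *
        (|x j + u n * (c - x j) - x j| + ∑ k ∈ Finset.univ.erase j,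
          mkt.matchProb j k * |x k + u n * (c - x k) - x k|)) atTop (𝓝 0) := by
      simpa using ((h0 j).add (tendsto_finsetSum (Finset.univ.erase j)
        fun k _ => (h0 k).const_mul (mkt.matchProb j k))).const_mul (payLip mkt.Δ lo hi νhi)
    refine squeeze_zero (fun _ => dist_nonneg) (fun n => ?_) h1
    rw [Real.dist_eq]
    exact hV.abs_expenditure_sub_le hν hlo (fun k => Set.Ioo_subset_Icc_self (hmem n (hx k))) hx j
  refine le_of_tendsto_of_tendsto (tendsto_finsetSum Finset.univ fun j _ =>
      ((hcoord (μ j)).sub (hcoord (μ' j))).mul ((hexp hμ j).sub (hexp hμ' j)))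
    ((tendsto_finsetSum Finset.univ fun j _ =>
      ((hcoord (μ j)).sub (hcoord (μ' j))).pow 2).const_mul (-lam))
    (Eventually.of_forall fun n => ?_)
  exact hmono _ _ (fun j => hmem n (hμ j)) (fun j => hmem n (hμ' j))

end Monotone

/-- The standing assumptions on a market, the parameters of adaptive pacing and a stationary
profile `μs`. -/
structure Regular (mkt : Market) (p : Params mkt.N) (νlo νhi lam κ : ℝ) (μs : Fin mkt.N → ℝ) :
    Prop where
  νlo_pos : 0 < νlo
  lam_pos : 0 < lam
  dens : mkt.HasDensities νlo νhi
  mono : mkt.StronglyMonotone lam p.lo p.hi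
  stat_mem : ∀ i, μs i ∈ Set.Ioo p.lo p.hi
  stat : ∀ i, mkt.expenditure μs i = mkt.ρ i
  rate : ∀ i, mkt.Δ / p.hi ≤ mkt.ρ i
  matching : ∀ i, √mkt.N * mkt.matchNorm i ≤ κ

/-- One step of adaptive pacing of all agents in the absence of budget constraints. -/
noncomputable def idealStep (p : Params mkt.N) (ν : Fin mkt.N → ℝ) (w : mkt.Draw) :
    Fin mkt.N → ℝ :=
  fun j => clip p.lo p.hi (ν j + p.eps * (mkt.payment w.2 (mkt.shade ν w.1) j - mkt.ρ j))

/-- The expected surplus of agent `i` that values its payments with the multiplier `θ` against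
the multipliers `μ` of the others. -/
noncomputable def surplus (μ : Fin mkt.N → ℝ) (θ : ℝ) (i : Fin mkt.N) : ℝ :=
  ∫ w, max (mkt.Δ * w.1 i - θ * mkt.competingBid w.2 (mkt.shade μ w.1) i) 0 ∂mkt.draw

theorem measurable_idealStep (p : Params mkt.N) :
    Measurable fun s : (Fin mkt.N → ℝ) × mkt.Draw => idealStep p s.1 s.2 := by
  refine measurable_pi_lambda _ fun j => (measurable_clip _ _).comp ?_
  have h1 : Measurable fun s : (Fin mkt.N → ℝ) × mkt.Draw => mkt.shade s.1 s.2.1 := by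
    unfold shade
    fun_prop
  have h2 := mkt.measurable_payment_comp
    (measurable_snd.comp measurable_snd : Measurable fun s : (Fin mkt.N → ℝ) × mkt.Draw => s.2.2)
    h1 j
  fun_prop

theorem idealStep_mem (p : Params mkt.N) (ν : Fin mkt.N → ℝ) (w : mkt.Draw)
    (j : Fin mkt.N) : idealStep p ν w j ∈ Set.Icc p.lo p.hi :=
  clip_mem p.lo_lt_hi.le _

theorem measurable_idealStep_apply (p : Params mkt.N) (ν : Fin mkt.N → ℝ)
    (j : Fin mkt.N) : Measurable fun w => idealStep p ν w j :=
  measurable_pi_iff.1 ((measurable_idealStep p).comp measurable_prodMk_left) j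

theorem integrable_idealStep_sq (p : Params mkt.N) (ν : Fin mkt.N → ℝ) (j : Fin mkt.N) {c : ℝ}
    (hc : c ∈ Set.Icc p.lo p.hi) :
    Integrable (fun w => (idealStep p ν w j - c) ^ 2) mkt.draw := by
  refine Integrable.of_bound (((measurable_idealStep_apply p ν j).sub_const c).pow_const
    2).aestronglyMeasurable ((p.hi - p.lo) ^ 2) (ae_of_all _ fun w => ?_)
  have h := idealStep_mem p ν w j
  rw [Real.norm_of_nonneg (sq_nonneg _)]
  refine sq_le_sq.2 ?_
  rw [abs_of_pos (sub_pos.2 p.lo_lt_hi), abs_le]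
  constructor <;> linarith [h.1, h.2, hc.1, hc.2]

theorem integrable_idealStep (p : Params mkt.N) (ν : Fin mkt.N → ℝ) (j : Fin mkt.N) :
    Integrable (fun w => idealStep p ν w j) mkt.draw := by
  refine Integrable.of_bound (measurable_idealStep_apply p ν j).aestronglyMeasurable p.hi
    (ae_of_all _ fun w => ?_)
  have h := idealStep_mem p ν w j
  rw [Real.norm_of_nonneg (p.lo_pos.le.trans h.1)]
  exact h.2

namespace Regular

variable {p : Params mkt.N} {νlo νhi lam κ : ℝ} {μs : Fin mkt.N → ℝ}

theorem hi_pos (_ : mkt.Regular p νlo νhi lam κ μs) : 0 < p.hi := p.lo_pos.trans p.lo_lt_hi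

theorem stat_Icc (H : mkt.Regular p νlo νhi lam κ μs) (j : Fin mkt.N) : μs j ∈ Set.Icc p.lo p.hi :=
  Set.Ioo_subset_Icc_self (H.stat_mem j)

theorem ρ_le (H : mkt.Regular p νlo νhi lam κ μs) (i : Fin mkt.N) : mkt.ρ i ≤ mkt.Δ / p.lo := by
  rw [← H.stat i]
  exact expenditure_le p.lo_pos (fun j => (H.stat_Icc j).1) i

theorem κ_nonneg (H : mkt.Regular p νlo νhi lam κ μs) : 0 ≤ κ := by
  have h : 0 < mkt.N := by have := mkt.γ_lt_N; omega
  exact (mul_nonneg (Real.sqrt_nonneg _) (mkt.matchNorm_nonneg _)).trans (H.matching ⟨0, h⟩)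

/-- The matching probabilities are not small, since the target rates are attained. -/
theorem le_sqrt_mul_matchNorm (H : mkt.Regular p νlo νhi lam κ μs) (i : Fin mkt.N) : p.lo / p.hi ≤ √mkt.N * mkt.matchNorm i := by
  have h1 := expenditure_le_sum_match p.lo_pos (fun j => (H.stat_Icc j).1) i
  rw [H.stat i, ← Finset.sum_mul] at h1
  have h2 := (H.rate i).trans h1
  have hΔ := mkt.Δ_pos
  have hlo := p.lo_pos
  have hhi := H.hi_pos
  refine le_trans ?_ (sum_match_le i)
  rw [div_le_iff₀ hhi]
  rw [div_le_iff₀ hhi] at h2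
  have h3 : mkt.Δ * p.lo ≤ mkt.Δ * ((∑ j ∈ Finset.univ.erase i, mkt.matchProb i j) * p.hi) := by
    calc mkt.Δ * p.lo ≤ (∑ j ∈ Finset.univ.erase i, mkt.matchProb i j) * (mkt.Δ / p.lo)
          * p.hi * p.lo := by gcongr
      _ = _ := by field_simp
  exact le_of_mul_le_mul_left h3 hΔ

theorem L_nonneg (H : mkt.Regular p νlo νhi lam κ μs) : 0 ≤ payLip mkt.Δ p.lo p.hi νhi :=
  payLip_nonneg mkt.Δ_pos.le p.lo_pos H.hi_pos.le (H.dens.nonneg H.νlo_pos)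

/-- The expected payment of an agent is strongly decreasing in its own multiplier. -/
theorem mono_update (H : mkt.Regular p νlo νhi lam κ μs) {ν : Fin mkt.N → ℝ} (hν : ∀ j, ν j ∈ Set.Icc p.lo p.hi) (i : Fin mkt.N)
    {x : ℝ} (hx : x ∈ Set.Icc p.lo p.hi) :
    (ν i - x) * (mkt.expenditure ν i - mkt.expenditure (Function.update ν i x) i)
      ≤ -lam * (ν i - x) ^ 2 := by
  have hx' : ∀ j, Function.update ν i x j ∈ Set.Icc p.lo p.hi := by
    intro j
    rcases eq_or_ne j i with rfl | hj
    · simpa using hx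
    · simpa [Function.update_of_ne hj] using hν j
  -- The two profiles differ in coordinate `i` only, so each sum reduces to one term.
  have h := H.mono.closedBox H.dens H.νlo_pos p.lo_pos p.lo_lt_hi hν hx'
  rw [Finset.sum_eq_single i, Finset.sum_eq_single i] at h
  · simpa using h
  · intro j _ hj
    simp [Function.update_of_ne hj]
  · simp
  · intro j _ hj
    simp [Function.update_of_ne hj]
  · simp

/-- Once the own multiplier is stationary, the target rate is missed only because of the others, and
Cauchy–Schwarz turns the matching weights into `‖a_i‖`. -/
theorem abs_expenditure_update_sub_le (H : mkt.Regular p νlo νhi lam κ μs) {ν : Fin mkt.N → ℝ} (hν : ∀ j, ν j ∈ Set.Icc p.lo p.hi)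
    (i : Fin mkt.N) :
    |mkt.expenditure (Function.update ν i (μs i)) i - mkt.ρ i|
      ≤ payLip mkt.Δ p.lo p.hi νhi * (mkt.matchNorm i * √(∑ j, (ν j - μs j) ^ 2)) := by
  have hx' : ∀ j, Function.update ν i (μs i) j ∈ Set.Icc p.lo p.hi := by
    intro j
    rcases eq_or_ne j i with rfl | hj
    · simpa using H.stat_Icc j
    · simpa [Function.update_of_ne hj] using hν j
  rw [← H.stat i]
  refine (H.dens.abs_expenditure_sub_le H.νlo_pos p.lo_pos hx' H.stat_Icc i).trans ?_
  refine mul_le_mul_of_nonneg_left ?_ H.L_nonneg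
  have h := sum_match_mul_le_univ i fun j => |ν j - μs j|
  simp only [sq_abs] at h
  refine le_trans (le_of_eq ?_) h
  simp only [Function.update_self, sub_self, abs_zero, zero_add]
  refine Finset.sum_congr rfl fun j hj => ?_
  rw [Function.update_of_ne (Finset.ne_of_mem_erase hj)]

theorem abs_expenditure_sub_rate_le (H : mkt.Regular p νlo νhi lam κ μs) {ν : Fin mkt.N → ℝ} (hν : ∀ j, ν j ∈ Set.Icc p.lo p.hi)
    (i : Fin mkt.N) :
    |mkt.expenditure ν i - mkt.ρ i| ≤ payLip mkt.Δ p.lo p.hi νhi *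
      (|ν i - μs i| + mkt.matchNorm i * √(∑ j, (ν j - μs j) ^ 2)) := by
  rw [← H.stat i]
  refine (H.dens.abs_expenditure_sub_le H.νlo_pos p.lo_pos hν H.stat_Icc i).trans ?_
  refine mul_le_mul_of_nonneg_left (add_le_add_right ?_ _) H.L_nonneg
  have h := sum_match_mul_le_univ i fun j => |ν j - μs j|
  simpa only [sq_abs] using h

theorem abs_payment_sub_le (H : mkt.Regular p νlo νhi lam κ μs) {ν : Fin mkt.N → ℝ} (hν : ∀ j, ν j ∈ Set.Icc p.lo p.hi)
    {w : mkt.Draw} (hw : ∀ j, w.1 j ∈ Set.Icc (0 : ℝ) 1) (j : Fin mkt.N) :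
    |mkt.payment w.2 (mkt.shade ν w.1) j - mkt.ρ j| ≤ mkt.Δ / p.lo := by
  have h1 := payment_shade_mem p.lo_pos (fun j => (hν j).1) hw j
  have h2 := H.ρ_le j
  have h3 := mkt.ρ_pos j
  rw [abs_le]
  constructor <;> linarith [h1.1, h1.2]

/-- The basic drift inequality of projected stochastic gradient: projection does not increase the
distance to a point of the box. The reference point `c` is free. It is taken to be the stationary
multiplier for contraction and `lo` for complementary slackness. -/
theorem integral_idealStep_sq_le (H : mkt.Regular p νlo νhi lam κ μs) {ν : Fin mkt.N → ℝ} (hν : ∀ j, ν j ∈ Set.Icc p.lo p.hi)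
    (j : Fin mkt.N) {c : ℝ} (hc : c ∈ Set.Icc p.lo p.hi) :
    ∫ w, (idealStep p ν w j - c) ^ 2 ∂mkt.draw
      ≤ (ν j - c) ^ 2 + 2 * p.eps * ((ν j - c) * (mkt.expenditure ν j - mkt.ρ j))
        + p.eps ^ 2 * (mkt.Δ / p.lo) ^ 2 := by
  have hi := integrable_payment_shade p.lo_pos (fun j => (hν j).1) j
  have hi2 : Integrable (fun w => 2 * p.eps * (ν j - c) *
      (mkt.payment w.2 (mkt.shade ν w.1) j - mkt.ρ j)) mkt.draw :=
    (hi.sub (integrable_const _)).const_mul _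
  have h1 : ∫ w, ((ν j - c) ^ 2 + p.eps ^ 2 * (mkt.Δ / p.lo) ^ 2 + 2 * p.eps * (ν j - c) *
      (mkt.payment w.2 (mkt.shade ν w.1) j - mkt.ρ j)) ∂mkt.draw
      = (ν j - c) ^ 2 + 2 * p.eps * ((ν j - c) * (mkt.expenditure ν j - mkt.ρ j))
        + p.eps ^ 2 * (mkt.Δ / p.lo) ^ 2 := by
    rw [integral_add (integrable_const _) hi2, integral_const_mul,
      integral_sub hi (integrable_const _), ← expenditure_eq]
    simp
    ring
  rw [← h1]
  refine integral_mono_ae (integrable_idealStep_sq p ν j hc) ((integrable_const _).add hi2) ?_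
  filter_upwards [mkt.ae_draw_mem] with w hw
  have h2 := sq_le_sq.2 ((H.abs_payment_sub_le hν hw j).trans (le_abs_self _))
  refine (sq_clip_sub_le hc _).trans ?_
  nlinarith [mul_le_mul_of_nonneg_left h2 (sq_nonneg p.eps)]

/-- Contraction of the unconstrained multipliers towards the stationary profile. -/
theorem integral_sum_sq_le (H : mkt.Regular p νlo νhi lam κ μs) {ν : Fin mkt.N → ℝ} (hν : ∀ j, ν j ∈ Set.Icc p.lo p.hi) :
    ∫ w, ∑ j, (idealStep p ν w j - μs j) ^ 2 ∂mkt.draw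
      ≤ (1 - 2 * lam * p.eps) * ∑ j, (ν j - μs j) ^ 2
        + p.eps ^ 2 * (mkt.N * (mkt.Δ / p.lo) ^ 2) := by
  rw [integral_finsetSum _ fun j _ => integrable_idealStep_sq p ν j (H.stat_Icc j)]
  have h1 := H.mono.closedBox H.dens H.νlo_pos p.lo_pos p.lo_lt_hi hν H.stat_Icc
  simp only [H.stat] at h1
  refine (Finset.sum_le_sum fun j _ => H.integral_idealStep_sq_le hν j (H.stat_Icc j)).trans ?_
  rw [Finset.sum_add_distrib, Finset.sum_add_distrib, ← Finset.mul_sum]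
  simp only [Finset.sum_const, Finset.card_univ, Fintype.card_fin, nsmul_eq_mul]
  nlinarith [mul_le_mul_of_nonneg_left h1 p.eps_pos.le]

/-- The contraction of the whole profile says nothing useful about a single agent, since its noise
grows with `N`. Here the monotonicity in the own multiplier contracts coordinate `i`, and the others
act as a disturbance of weight `‖a_i‖²`. -/
theorem integral_coord_sq_le (H : mkt.Regular p νlo νhi lam κ μs) {ν : Fin mkt.N → ℝ} (hν : ∀ j, ν j ∈ Set.Icc p.lo p.hi)
    (i : Fin mkt.N) :
    ∫ w, (idealStep p ν w i - μs i) ^ 2 ∂mkt.draw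
      ≤ (1 - lam * p.eps) * (ν i - μs i) ^ 2
        + p.eps * (payLip mkt.Δ p.lo p.hi νhi ^ 2 * mkt.matchNorm i ^ 2 / lam
          * ∑ j, (ν j - μs j) ^ 2)
        + p.eps ^ 2 * (mkt.Δ / p.lo) ^ 2 := by
  refine (H.integral_idealStep_sq_le hν i (H.stat_Icc i)).trans ?_
  have h1 := H.mono_update hν i (H.stat_Icc i)
  have h2 := H.abs_expenditure_update_sub_le hν i
  set Z' := mkt.expenditure (Function.update ν i (μs i)) i
  set S := ∑ j, (ν j - μs j) ^ 2 with hS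
  have hS0 : 0 ≤ S := Finset.sum_nonneg fun _ _ => sq_nonneg _
  set X := payLip mkt.Δ p.lo p.hi νhi * (mkt.matchNorm i * √S)
  have hX : payLip mkt.Δ p.lo p.hi νhi ^ 2 * mkt.matchNorm i ^ 2 / lam * S = X ^ 2 / lam := by
    simp only [X, mul_pow, Real.sq_sqrt hS0]
    ring
  rw [hX]
  set δ := ν i - μs i
  have h3 : δ * (Z' - mkt.ρ i) ≤ |δ| * X := by
    refine (le_abs_self _).trans ?_
    rw [abs_mul]
    gcongr
  -- Half of the contraction `2 * lam * δ ^ 2` pays for the disturbance by the others.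
  have h4 : 2 * (|δ| * X) ≤ lam * δ ^ 2 + X ^ 2 / lam := by
    have hl := H.lam_pos
    have h5 : 0 ≤ (lam * |δ| - X) ^ 2 / lam := by positivity
    have h6 : (lam * |δ| - X) ^ 2 / lam = lam * δ ^ 2 + X ^ 2 / lam - 2 * (|δ| * X) := by
      rw [← sq_abs δ]
      field_simp
      ring
    linarith
  have h7 : 2 * (δ * (mkt.expenditure ν i - mkt.ρ i)) ≤ -lam * δ ^ 2 + X ^ 2 / lam := by
    linarith [mul_sub δ (mkt.expenditure ν i) (mkt.ρ i), mul_sub δ (mkt.expenditure ν i) Z',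
      mul_sub δ Z' (mkt.ρ i)]
  nlinarith [mul_le_mul_of_nonneg_left h7 p.eps_pos.le]

/-- The projection at the lower bound is rarely active when the stationary multiplier is not
close to it. -/
theorem integral_idealStep_le (H : mkt.Regular p νlo νhi lam κ μs) {ν : Fin mkt.N → ℝ} (hν : ∀ j, ν j ∈ Set.Icc p.lo p.hi)
    {i : Fin mkt.N} {η : ℝ} (hη : 0 < η) (hηi : p.lo + η ≤ μs i)
    (hε : p.eps * (mkt.Δ / p.lo) ≤ η / 2) :
    ∫ w, idealStep p ν w i ∂mkt.draw
      ≤ ν i + p.eps * (mkt.expenditure ν i - mkt.ρ i)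
        + p.eps * (mkt.Δ / p.lo * (4 / η ^ 2)) * (ν i - μs i) ^ 2 := by
  have hi := integrable_payment_shade p.lo_pos (fun j => (hν j).1) i
  have hi2 : Integrable (fun w => p.eps *
      (mkt.payment w.2 (mkt.shade ν w.1) i - mkt.ρ i)) mkt.draw :=
    (hi.sub (integrable_const _)).const_mul _
  have h1 : ∫ w, ((ν i + p.eps * (mkt.Δ / p.lo * (4 / η ^ 2)) * (ν i - μs i) ^ 2) +
      p.eps * (mkt.payment w.2 (mkt.shade ν w.1) i - mkt.ρ i)) ∂mkt.draw
      = ν i + p.eps * (mkt.expenditure ν i - mkt.ρ i)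
        + p.eps * (mkt.Δ / p.lo * (4 / η ^ 2)) * (ν i - μs i) ^ 2 := by
    rw [integral_add (integrable_const _) hi2, integral_const_mul,
      integral_sub hi (integrable_const _), ← expenditure_eq]
    simp
    ring
  rw [← h1]
  refine integral_mono_ae (integrable_idealStep p ν i) ((integrable_const _).add hi2) ?_
  filter_upwards [mkt.ae_draw_mem] with w hw
  have h2 := (abs_le.1 (H.abs_payment_sub_le hν hw i)).1
  have hB : 0 ≤ mkt.Δ / p.lo := div_nonneg mkt.Δ_pos.le p.lo_pos.le
  have hε0 := p.eps_pos
  have h3 : 0 ≤ p.eps * (mkt.Δ / p.lo * (4 / η ^ 2)) * (ν i - μs i) ^ 2 := by positivity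
  -- A cut at `hi` only lowers the value, so only the cut at `lo` matters.
  refine (min_le_left _ _).trans (max_le ?_ ?_)
  · linarith
  -- One step moves the multiplier down by at most `eps * (Δ / lo)`, so far from `lo` there is no
  -- cut. Near `lo` the stationary multiplier is at least `η / 2` away, and the quadratic error term
  -- covers the step.
  · rcases le_or_gt (p.lo + p.eps * (mkt.Δ / p.lo)) (ν i) with h | h
    · nlinarith
    · have h4 : η / 2 ≤ μs i - ν i := by linarith
      have h5 : 1 ≤ 4 / η ^ 2 * (ν i - μs i) ^ 2 := by
        rw [div_mul_eq_mul_div, one_le_div (by positivity)]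
        nlinarith
      have h6 : p.eps * (mkt.Δ / p.lo) ≤
          p.eps * (mkt.Δ / p.lo * (4 / η ^ 2)) * (ν i - μs i) ^ 2 := by
        have := mul_le_mul_of_nonneg_left h5 (mul_nonneg hε0.le hB)
        linarith
      nlinarith [(hν i).1]

end Regular

end Market

end Pacing

/-! ### One step of the coupling between a deviation and the unconstrained multipliers. -/

namespace Pacing

namespace Market

variable {mkt : Market}

/-- A pathwise bound on the squared distance after one step between the multipliers `μ` of the
agents other than `i`, when `i` bids arbitrarily, and the unconstrained multipliers `ν`. -/
noncomputable def couplingBound (p : Params mkt.N) (μ ν : Fin mkt.N → ℝ) (i : Fin mkt.N)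
    (w : mkt.Draw) : ℝ :=
  ∑ j ∈ Finset.univ.erase i, ((μ j - ν j) ^ 2
    + 2 * p.eps * (μ j - ν j) *
      (mkt.payment w.2 (mkt.shade μ w.1) j - mkt.payment w.2 (mkt.shade ν w.1) j)
    + (2 * p.eps * |μ j - ν j| * (mkt.Δ / p.lo) + p.eps ^ 2 * (mkt.Δ / p.lo) ^ 2) *
      (if w.2 j = w.2 i then 1 else 0)
    + p.eps ^ 2 * (mkt.Δ / p.lo) *
      |mkt.payment w.2 (mkt.shade μ w.1) j - mkt.payment w.2 (mkt.shade ν w.1) j|)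

/-- A deviation of agent `i` changes the payment of `j` only if the two meet. -/
theorem abs_payment_deviation_le {lo : ℝ} (hlo : 0 < lo) {μ b : Fin mkt.N → ℝ}
    (hμ : ∀ j, lo ≤ μ j) {i : Fin mkt.N} {w : mkt.Draw} (hw : ∀ j, w.1 j ∈ Set.Icc (0 : ℝ) 1)
    (hb : ∀ j, j ≠ i → b j = mkt.shade μ w.1 j) (hbi : 0 ≤ b i) {j : Fin mkt.N} (hj : j ≠ i) :
    |mkt.payment w.2 b j - mkt.payment w.2 (mkt.shade μ w.1) j|
      ≤ mkt.Δ / lo * (if w.2 j = w.2 i then 1 else 0) := by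
  have hs : ∀ k, 0 ≤ mkt.shade μ w.1 k := fun k => shade_nonneg k (hlo.trans_le (hμ k)) (hw k)
  split_ifs with h
  · have hb0 : ∀ k, 0 ≤ b k := fun k => by
      rcases eq_or_ne k i with rfl | hk
      · exact hbi
      · rw [hb k hk]
        exact hs k
    have h1 : 0 ≤ mkt.payment w.2 b j := payment_nonneg fun k _ => hb0 k
    have h2 : mkt.payment w.2 b j ≤ mkt.Δ / lo := by
      refine (payment_le_bid (hb0 j)).trans ?_
      rw [hb j hj]
      exact shade_le hlo j (hμ j) (hw j)
    have h3 := payment_shade_mem hlo hμ hw j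
    rw [mul_one, abs_le]
    constructor <;> linarith [h3.1, h3.2]
  · have hne : ∀ k, k ≠ j → w.2 k = w.2 j → b k = mkt.shade μ w.1 k := fun k _ hm =>
      hb k fun hki => h (by rw [← hm, hki])
    have hc : mkt.competingBid w.2 b j = mkt.competingBid w.2 (mkt.shade μ w.1) j :=
      le_antisymm
        (by simpa using competingBid_le_add (c := 0) le_rfl fun k hk hm => by simp [hne k hk hm])
        (by simpa using competingBid_le_add (c := 0) le_rfl fun k hk hm => by simp [hne k hk hm])
    simp [payment, wins, hc, hb j hj]

/-- The bound does not involve the bid of `i`, so it holds for every strategy. The payment error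
splits into the effect of the multipliers, which monotonicity controls in the mean, and the effect
of the deviation, which is confined to the event of meeting `i`. -/
theorem sum_sq_step_le_couplingBound (p : Params mkt.N) {μ ν b : Fin mkt.N → ℝ}
    (hμ : ∀ j, p.lo ≤ μ j) (hν : ∀ j, p.lo ≤ ν j) {i : Fin mkt.N} {w : mkt.Draw}
    (hw : ∀ j, w.1 j ∈ Set.Icc (0 : ℝ) 1)
    (hb : ∀ j, j ≠ i → b j = mkt.shade μ w.1 j) (hbi : 0 ≤ b i) :
    ∑ j ∈ Finset.univ.erase i,
      (clip p.lo p.hi (μ j + p.eps * (mkt.payment w.2 b j - mkt.ρ j)) - idealStep p ν w j) ^ 2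
      ≤ couplingBound p μ ν i w := by
  refine Finset.sum_le_sum fun j hj => ?_
  have hji := Finset.ne_of_mem_erase hj
  have hs : ∀ k, 0 ≤ mkt.shade μ w.1 k := fun k => shade_nonneg k (p.lo_pos.trans_le (hμ k)) (hw k)
  have hb0 : ∀ k, 0 ≤ b k := fun k => by
    rcases eq_or_ne k i with rfl | hk
    · exact hbi
    · rw [hb k hk]
      exact hs k
  have h1 : 0 ≤ mkt.payment w.2 b j := payment_nonneg fun k _ => hb0 k
  have h2 : mkt.payment w.2 b j ≤ mkt.Δ / p.lo := by
    refine (payment_le_bid (hb0 j)).trans ?_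
    rw [hb j hji]
    exact shade_le p.lo_pos j (hμ j) (hw j)
  have h3 := payment_shade_mem p.lo_pos hν hw j
  have h4 := abs_payment_deviation_le p.lo_pos hμ hw hb hbi hji
  refine (sq_clip_sub_clip_le _ _).trans ?_
  set z := mkt.payment w.2 b j
  set z1 := mkt.payment w.2 (mkt.shade μ w.1) j
  set z2 := mkt.payment w.2 (mkt.shade ν w.1) j
  set I : ℝ := if w.2 j = w.2 i then 1 else 0
  set B := mkt.Δ / p.lo
  set δ := μ j - ν j
  have hB : 0 ≤ B := div_nonneg mkt.Δ_pos.le p.lo_pos.le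
  -- One factor is bounded by `B` and the other kept linear, because expected payments are Lipschitz
  -- only in first moment.
  have h5 : (z - z2) ^ 2 ≤ B * (B * I + |z1 - z2|) := by
    have h6 : |z - z2| ≤ B := by
      rw [abs_le]
      constructor <;> linarith [h3.1, h3.2]
    have h7 : |z - z2| ≤ B * I + |z1 - z2| := (abs_sub_le z z1 z2).trans (by linarith)
    rw [← sq_abs, sq]
    exact mul_le_mul h6 h7 (abs_nonneg _) hB
  have h8 : δ * (z - z1) ≤ |δ| * (B * I) := by
    refine (le_abs_self _).trans ?_
    rw [abs_mul]
    exact mul_le_mul_of_nonneg_left h4 (abs_nonneg _)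
  have h9 : (μ j + p.eps * (z - mkt.ρ j) - (ν j + p.eps * (z2 - mkt.ρ j))) ^ 2
      = δ ^ 2 + 2 * p.eps * δ * (z1 - z2) + 2 * p.eps * (δ * (z - z1))
        + p.eps ^ 2 * (z - z2) ^ 2 := by
    simp only [δ]
    ring
  rw [h9]
  have hε := p.eps_pos
  have h10 := mul_le_mul_of_nonneg_left h8 (by positivity : 0 ≤ 2 * p.eps)
  have h11 := mul_le_mul_of_nonneg_left h5 (sq_nonneg p.eps)
  linarith

theorem integrable_payment_shade_sub (p : Params mkt.N) {μ ν : Fin mkt.N → ℝ}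
    (hμ : ∀ j, p.lo ≤ μ j) (hν : ∀ j, p.lo ≤ ν j) (j : Fin mkt.N) :
    Integrable (fun w : mkt.Draw => mkt.payment w.2 (mkt.shade μ w.1) j
      - mkt.payment w.2 (mkt.shade ν w.1) j) mkt.draw :=
  (integrable_payment_shade p.lo_pos hμ j).sub (integrable_payment_shade p.lo_pos hν j)

theorem integrable_couplingBound (p : Params mkt.N) {μ ν : Fin mkt.N → ℝ}
    (hμ : ∀ j, p.lo ≤ μ j) (hν : ∀ j, p.lo ≤ ν j) (i : Fin mkt.N) :
    Integrable (couplingBound p μ ν i) mkt.draw := by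
  have hz := integrable_payment_shade_sub p hμ hν
  exact integrable_finsetSum _ fun j _ => (((integrable_const _).add ((hz j).const_mul _)).add
    ((integrable_match i j).const_mul _)).add ((hz j).abs.const_mul _)

namespace Regular

variable {p : Params mkt.N} {νlo νhi lam κ : ℝ} {μs : Fin mkt.N → ℝ}

/-- Since `μ i = ν i`, the term of agent `i` vanishes, and the monotonicity of the whole market
applies to the sum over the others. -/
theorem integral_couplingBound_le (H : mkt.Regular p νlo νhi lam κ μs) {μ ν : Fin mkt.N → ℝ}
    (hμ : ∀ j, μ j ∈ Set.Icc p.lo p.hi) (hν : ∀ j, ν j ∈ Set.Icc p.lo p.hi) {i : Fin mkt.N}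
    (hi : μ i = ν i) :
    ∫ w, couplingBound p μ ν i w ∂mkt.draw
      ≤ (1 - lam * p.eps) * ∑ j ∈ Finset.univ.erase i, (μ j - ν j) ^ 2
        + p.eps * ((2 * (mkt.Δ / p.lo) * mkt.matchNorm i
            + p.eps * √mkt.N * (mkt.Δ / p.lo * payLip mkt.Δ p.lo p.hi νhi * (1 + κ))) ^ 2
            / (4 * lam))
        + p.eps ^ 2 * ((mkt.Δ / p.lo) ^ 2 * κ) := by
  have hμl := fun j => (hμ j).1
  have hνl := fun j => (hν j).1
  have hε := p.eps_pos
  have hlam := H.lam_pos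
  have hκ := H.κ_nonneg
  have hL := H.L_nonneg
  set B := mkt.Δ / p.lo with hB
  set L := payLip mkt.Δ p.lo p.hi νhi with hLdef
  have hB0 : 0 ≤ B := div_nonneg mkt.Δ_pos.le p.lo_pos.le
  have hz := integrable_payment_shade_sub p hμl hνl
  have e1 : ∀ j, Integrable (fun w : mkt.Draw => 2 * p.eps * (μ j - ν j) *
      (mkt.payment w.2 (mkt.shade μ w.1) j - mkt.payment w.2 (mkt.shade ν w.1) j)) mkt.draw :=
    fun j => (hz j).const_mul _
  have e2 : ∀ j, Integrable (fun w : mkt.Draw =>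
      (2 * p.eps * |μ j - ν j| * B + p.eps ^ 2 * B ^ 2) *
      (if w.2 j = w.2 i then (1 : ℝ) else 0)) mkt.draw :=
    fun j => (integrable_match i j).const_mul _
  have e3 : ∀ j, Integrable (fun w : mkt.Draw => p.eps ^ 2 * B *
      |mkt.payment w.2 (mkt.shade μ w.1) j - mkt.payment w.2 (mkt.shade ν w.1) j|) mkt.draw :=
    fun j => (hz j).abs.const_mul _
  have e0 : ∀ j, Integrable (fun _ : mkt.Draw => (μ j - ν j) ^ 2) mkt.draw :=
    fun j => integrable_const _
  have e01 : ∀ j, Integrable (fun w : mkt.Draw => (μ j - ν j) ^ 2 + 2 * p.eps * (μ j - ν j) *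
      (mkt.payment w.2 (mkt.shade μ w.1) j - mkt.payment w.2 (mkt.shade ν w.1) j)) mkt.draw :=
    fun j => (e0 j).add (e1 j)
  have e012 : ∀ j, Integrable (fun w : mkt.Draw => (μ j - ν j) ^ 2 + 2 * p.eps * (μ j - ν j) *
      (mkt.payment w.2 (mkt.shade μ w.1) j - mkt.payment w.2 (mkt.shade ν w.1) j)
      + (2 * p.eps * |μ j - ν j| * B + p.eps ^ 2 * B ^ 2) *
      (if w.2 j = w.2 i then (1 : ℝ) else 0)) mkt.draw :=
    fun j => (e01 j).add (e2 j)
  set D := ∑ j ∈ Finset.univ.erase i, (μ j - ν j) ^ 2 with hD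
  have hDuniv : ∑ j, (μ j - ν j) ^ 2 = D := by
    rw [hD, ← Finset.add_sum_erase _ _ (Finset.mem_univ i), hi]
    simp
  have hD0 : 0 ≤ D := Finset.sum_nonneg fun _ _ => sq_nonneg _
  have hmono : ∑ j ∈ Finset.univ.erase i,
      (μ j - ν j) * (mkt.expenditure μ j - mkt.expenditure ν j) ≤ -lam * D := by
    have h := H.mono.closedBox H.dens H.νlo_pos p.lo_pos p.lo_lt_hi hμ hν
    rw [hDuniv, ← Finset.add_sum_erase _ _ (Finset.mem_univ i), hi] at h
    simpa using h
  have hcs : ∀ k : Fin mkt.N, ∑ j ∈ Finset.univ.erase k, mkt.matchProb k j * |μ j - ν j|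
      ≤ mkt.matchNorm k * √D := by
    intro k
    have h := sum_match_mul_le_univ k fun j => |μ j - ν j|
    simp only [sq_abs] at h
    rwa [hDuniv] at h
  have hsq : √(mkt.N : ℝ) * √mkt.N = mkt.N := Real.mul_self_sqrt (Nat.cast_nonneg _)
  have habs : ∑ j, |μ j - ν j| ≤ √mkt.N * √D := by
    have h := Real.sum_mul_le_sqrt_mul_sqrt Finset.univ (fun _ : Fin mkt.N => (1 : ℝ))
      fun j => |μ j - ν j|
    simp only [one_mul, one_pow, sq_abs, Finset.sum_const, Finset.card_univ, Fintype.card_fin,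
      nsmul_eq_mul, mul_one] at h
    rwa [hDuniv] at h
  have hnoise : ∑ j ∈ Finset.univ.erase i, ∫ w, |mkt.payment w.2 (mkt.shade μ w.1) j
      - mkt.payment w.2 (mkt.shade ν w.1) j| ∂mkt.draw ≤ L * (√mkt.N * (1 + κ) * √D) := by
    calc _ ≤ ∑ j, ∫ w, |mkt.payment w.2 (mkt.shade μ w.1) j
          - mkt.payment w.2 (mkt.shade ν w.1) j| ∂mkt.draw :=
          Finset.sum_le_sum_of_subset_of_nonneg (Finset.erase_subset _ _)
            fun _ _ _ => integral_nonneg fun _ => abs_nonneg _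
      _ ≤ ∑ j, L * (|μ j - ν j| + mkt.matchNorm j * √D) := by
          refine Finset.sum_le_sum fun j _ => ?_
          refine (H.dens.integral_abs_payment_sub_le H.νlo_pos p.lo_pos hμ hν j).trans ?_
          gcongr
          exact hcs j
      _ = L * (∑ j, |μ j - ν j| + (∑ j, mkt.matchNorm j) * √D) := by
          rw [← Finset.mul_sum, Finset.sum_add_distrib, Finset.sum_mul]
      _ ≤ L * (√mkt.N * √D + √mkt.N * κ * √D) := by
          gcongr
          -- Each of the `N` norms is at most `κ / √N`. Multiplying by `√N` avoids the division.
          have h1 : √(mkt.N : ℝ) * ∑ j, mkt.matchNorm j ≤ √(mkt.N : ℝ) * (√mkt.N * κ) := by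
            rw [Finset.mul_sum, ← mul_assoc, hsq]
            refine (Finset.sum_le_sum fun j _ => H.matching j).trans ?_
            simp
          have hN : 0 < mkt.N := Fin.pos i
          have hN' : 0 < √(mkt.N : ℝ) := Real.sqrt_pos.2 (by exact_mod_cast hN)
          exact le_of_mul_le_mul_left h1 hN'
      _ = _ := by ring
  have hcross : ∑ j ∈ Finset.univ.erase i, mkt.matchProb i j * (2 * p.eps * |μ j - ν j| * B
      + p.eps ^ 2 * B ^ 2) ≤ 2 * p.eps * B * (mkt.matchNorm i * √D) + p.eps ^ 2 * (B ^ 2 * κ) := by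
    have h1 : ∑ j ∈ Finset.univ.erase i, mkt.matchProb i j * (2 * p.eps * |μ j - ν j| * B
        + p.eps ^ 2 * B ^ 2) = 2 * p.eps * B *
          (∑ j ∈ Finset.univ.erase i, mkt.matchProb i j * |μ j - ν j|)
          + p.eps ^ 2 * (B ^ 2 * ∑ j ∈ Finset.univ.erase i, mkt.matchProb i j) := by
      simp only [Finset.mul_sum, ← Finset.sum_add_distrib]
      exact Finset.sum_congr rfl fun j _ => by ring
    rw [h1]
    gcongr
    · exact hcs i
    · exact (sum_match_le i).trans (H.matching i)
  have hint : ∫ w, couplingBound p μ ν i w ∂mkt.draw = D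
      + 2 * p.eps * ∑ j ∈ Finset.univ.erase i,
        (μ j - ν j) * (mkt.expenditure μ j - mkt.expenditure ν j)
      + ∑ j ∈ Finset.univ.erase i, mkt.matchProb i j * (2 * p.eps * |μ j - ν j| * B
        + p.eps ^ 2 * B ^ 2)
      + p.eps ^ 2 * B * ∑ j ∈ Finset.univ.erase i, ∫ w, |mkt.payment w.2 (mkt.shade μ w.1) j
        - mkt.payment w.2 (mkt.shade ν w.1) j| ∂mkt.draw := by
    unfold couplingBound
    refine (integral_finsetSum (Finset.univ.erase i) fun j _ => (e012 j).add (e3 j)).trans ?_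
    rw [hD, Finset.mul_sum, Finset.mul_sum, ← Finset.sum_add_distrib, ← Finset.sum_add_distrib,
      ← Finset.sum_add_distrib]
    refine Finset.sum_congr rfl fun j hj => ?_
    refine (integral_add (e012 j) (e3 j)).trans ?_
    rw [integral_add (e01 j) (e2 j), integral_add (e0 j) (e1 j),
      integral_const_mul, integral_const_mul, integral_const_mul,
      integral_sub (integrable_payment_shade p.lo_pos hμl j)
        (integrable_payment_shade p.lo_pos hνl j),
      mkt.integral_match (Finset.ne_of_mem_erase hj).symm, ← expenditure_eq, ← expenditure_eq]
    simp only [integral_const, probReal_univ, one_smul]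
    ring
  rw [hint]
  set X := 2 * B * mkt.matchNorm i + p.eps * √mkt.N * (B * L * (1 + κ)) with hX
  -- Young's inequality with weights that use up `lam` out of the contraction rate `2 * lam`.
  have h1 : √D * X ≤ lam * D + X ^ 2 / (4 * lam) := by
    have h5 : 0 ≤ (2 * lam * √D - X) ^ 2 / (4 * lam) := by positivity
    have h6 : (2 * lam * √D - X) ^ 2 / (4 * lam)
        = lam * √D ^ 2 + X ^ 2 / (4 * lam) - √D * X := by
      field_simp
      ring
    rw [Real.sq_sqrt hD0] at h6
    linarith
  have h2 := mul_le_mul_of_nonneg_left h1 hε.le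
  have h3 := mul_le_mul_of_nonneg_left hmono (by positivity : 0 ≤ 2 * p.eps)
  have h4 := mul_le_mul_of_nonneg_left hnoise (by positivity : 0 ≤ p.eps ^ 2 * B)
  have h5 : p.eps * (√D * X) = 2 * p.eps * B * (mkt.matchNorm i * √D)
      + p.eps ^ 2 * B * (L * (√mkt.N * (1 + κ) * √D)) := by
    rw [hX]
    ring
  linarith

end Regular

/-! ### Lagrangian duality in one period. -/

section Surplus

theorem measurable_surplus_integrand (μ : Fin mkt.N → ℝ) (θ : ℝ) (i : Fin mkt.N) :
    Measurable fun w : mkt.Draw =>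
      max (mkt.Δ * w.1 i - θ * mkt.competingBid w.2 (mkt.shade μ w.1) i) 0 := by
  have := measurable_competingBid_shade μ i
  fun_prop

theorem surplus_integrand_mem {lo : ℝ} (hlo : 0 < lo) {μ : Fin mkt.N → ℝ}
    (hμ : ∀ j, lo ≤ μ j) {θ : ℝ} (hθ : 0 ≤ θ) (i : Fin mkt.N) {w : mkt.Draw}
    (hw : ∀ j, w.1 j ∈ Set.Icc (0 : ℝ) 1) :
    max (mkt.Δ * w.1 i - θ * mkt.competingBid w.2 (mkt.shade μ w.1) i) 0 ∈ Set.Icc 0 1 := by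
  refine ⟨le_max_right _ _, max_le ?_ zero_le_one⟩
  have h1 := mul_nonneg hθ (competingBid_shade_mem hlo hμ hw i).1
  nlinarith [(hw i).1, (hw i).2, mkt.Δ_pos, mkt.Δ_le_one]

theorem integrable_surplus_integrand {lo : ℝ} (hlo : 0 < lo) {μ : Fin mkt.N → ℝ}
    (hμ : ∀ j, lo ≤ μ j) {θ : ℝ} (hθ : 0 ≤ θ) (i : Fin mkt.N) :
    Integrable (fun w : mkt.Draw =>
      max (mkt.Δ * w.1 i - θ * mkt.competingBid w.2 (mkt.shade μ w.1) i) 0) mkt.draw := by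
  refine Integrable.of_bound (measurable_surplus_integrand μ θ i).aestronglyMeasurable 1 ?_
  filter_upwards [mkt.ae_draw_mem] with w hw
  have h := surplus_integrand_mem hlo hμ hθ i hw
  rw [Real.norm_of_nonneg h.1]
  exact h.2

theorem integrable_valuation (i : Fin mkt.N) :
    Integrable (fun w : mkt.Draw => w.1 i) mkt.draw := by
  refine Integrable.of_bound (by fun_prop) 1 ?_
  filter_upwards [mkt.ae_draw_mem] with w hw
  rw [Real.norm_of_nonneg (hw i).1]
  exact (hw i).2

theorem surplus_le_add {lo : ℝ} (hlo : 0 < lo) {μ ν : Fin mkt.N → ℝ}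
    (hμ : ∀ j, lo ≤ μ j) (hν : ∀ j, lo ≤ ν j) {θ : ℝ} (hθ : 0 ≤ θ) (i : Fin mkt.N) :
    surplus μ θ i ≤ surplus ν θ i + θ * (mkt.Δ / lo ^ 2 *
      ∑ j ∈ Finset.univ.erase i, mkt.matchProb i j * |μ j - ν j|) := by
  have hd : Integrable (fun w : mkt.Draw => |mkt.competingBid w.2 (mkt.shade μ w.1) i
      - mkt.competingBid w.2 (mkt.shade ν w.1) i|) mkt.draw :=
    ((integrable_competingBid_shade hlo hμ i).sub (integrable_competingBid_shade hlo hν i)).abs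
  refine le_trans ?_ (add_le_add_right (mul_le_mul_of_nonneg_left
    (integral_abs_competingBid_sub_le hlo hμ hν i) hθ) _)
  unfold surplus
  rw [← integral_const_mul, ← integral_add (integrable_surplus_integrand hlo hν hθ i)
    (hd.const_mul θ)]
  refine integral_mono (integrable_surplus_integrand hlo hμ hθ i)
    ((integrable_surplus_integrand hlo hν hθ i).add (hd.const_mul θ)) fun w => ?_
  set d := mkt.competingBid w.2 (mkt.shade μ w.1) i
  set d' := mkt.competingBid w.2 (mkt.shade ν w.1) i
  have h1 : 0 ≤ θ * |d - d'| := mul_nonneg hθ (abs_nonneg _)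
  refine max_le ?_ (add_nonneg (le_max_right _ _) h1)
  have h2 := mul_le_mul_of_nonneg_left (neg_abs_le (d - d')) hθ
  have h3 := le_max_left (mkt.Δ * w.1 i - θ * d') 0
  change _ ≤ max (mkt.Δ * w.1 i - θ * d') 0 + θ * |d - d'|
  linarith

/-- Weak duality in one period, for an arbitrary bid. -/
theorem valuation_sub_max_le (m : Fin mkt.N → Fin mkt.M) (b : Fin mkt.N → ℝ) (i : Fin mkt.N)
    (v θ : ℝ) :
    v - max (mkt.Δ * v - θ * mkt.competingBid m b i) 0
      ≤ v * (1 - mkt.wins m b i * mkt.Δ) + θ * mkt.payment m b i := by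
  unfold payment wins
  split_ifs
  · linarith [le_max_left (mkt.Δ * v - θ * mkt.competingBid m b i) 0]
  · linarith [le_max_right (mkt.Δ * v - θ * mkt.competingBid m b i) 0]

theorem competingBid_lt_shade_iff {ν v : Fin mkt.N → ℝ} {i : Fin mkt.N} (hν : 0 < ν i) (d : ℝ) :
    d < mkt.shade ν v i ↔ ν i * d < mkt.Δ * v i := by
  rw [shade, lt_div_iff₀ hν, mul_comm]

/-- Weak duality is tight for the pacing bid, because `Δ v / ν` exceeds the price exactly when the
Lagrangian surplus `Δ v - ν d` is positive. -/
theorem cost_shade_eq {ν : Fin mkt.N → ℝ} {i : Fin mkt.N} (hν : 0 < ν i) (w : mkt.Draw) :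
    w.1 i * (1 - mkt.wins w.2 (mkt.shade ν w.1) i * mkt.Δ)
      = w.1 i - max (mkt.Δ * w.1 i - ν i * mkt.competingBid w.2 (mkt.shade ν w.1) i) 0
        - ν i * mkt.payment w.2 (mkt.shade ν w.1) i := by
  rw [payment]
  unfold wins
  simp only [competingBid_lt_shade_iff hν]
  split_ifs with h
  · rw [max_eq_left (by linarith)]
    ring
  · rw [max_eq_right (by linarith)]
    ring

theorem integral_cost_shade {lo : ℝ} (hlo : 0 < lo) {ν : Fin mkt.N → ℝ} (hν : ∀ j, lo ≤ ν j)
    (i : Fin mkt.N) :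
    ∫ w, w.1 i * (1 - mkt.wins w.2 (mkt.shade ν w.1) i * mkt.Δ) ∂mkt.draw
      = ∫ w, w.1 i ∂mkt.draw - surplus ν (ν i) i - ν i * mkt.expenditure ν i := by
  have hνi : 0 < ν i := hlo.trans_le (hν i)
  simp only [cost_shade_eq hνi]
  have h1 := integrable_surplus_integrand hlo hν hνi.le i
  have h2 : Integrable (fun w : mkt.Draw => w.1 i
      - max (mkt.Δ * w.1 i - ν i * mkt.competingBid w.2 (mkt.shade ν w.1) i) 0) mkt.draw :=
    (integrable_valuation i).sub h1
  rw [integral_sub h2 ((integrable_payment_shade hlo hν i).const_mul _),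
    integral_sub (integrable_valuation i) h1, integral_const_mul, expenditure_eq, surplus]

/-- The surplus is convex in the multiplier. -/
theorem surplus_sub_surplus_le {lo : ℝ} (hlo : 0 < lo) {ν : Fin mkt.N → ℝ} (hν : ∀ j, lo ≤ ν j)
    (i : Fin mkt.N) {θ : ℝ} (hθ : lo ≤ θ) :
    surplus ν θ i - surplus ν (ν i) i
      ≤ (ν i - θ) * mkt.expenditure (Function.update ν i θ) i := by
  have hθ0 : 0 < θ := hlo.trans_le hθ
  have hν' : ∀ j, lo ≤ Function.update ν i θ j := by
    intro j
    rcases eq_or_ne j i with rfl | hj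
    · simpa using hθ
    · simpa [Function.update_of_ne hj] using hν j
  unfold surplus
  rw [← integral_sub (integrable_surplus_integrand hlo hν hθ0.le i)
    (integrable_surplus_integrand hlo hν (hlo.le.trans (hν i)) i), expenditure_eq,
    ← integral_const_mul]
  refine integral_mono ((integrable_surplus_integrand hlo hν hθ0.le i).sub
    (integrable_surplus_integrand hlo hν (hlo.le.trans (hν i)) i))
    ((integrable_payment_shade hlo hν' i).const_mul _) fun w => ?_
  have hd : mkt.competingBid w.2 (mkt.shade (Function.update ν i θ) w.1) i
      = mkt.competingBid w.2 (mkt.shade ν w.1) i :=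
    competingBid_congr fun j hj => by simp [shade, Function.update_of_ne hj]
  have hθ' : 0 < Function.update ν i θ i := by simpa using hθ0
  -- For each draw, minus the payment made with multiplier `θ` is a subgradient at `θ` of the
  -- surplus.
  change _ ≤ (ν i - θ) * mkt.payment w.2 (mkt.shade (Function.update ν i θ) w.1) i
  unfold payment wins
  simp only [competingBid_lt_shade_iff hθ', hd, Function.update_self]
  have h1 := le_max_left (mkt.Δ * w.1 i - ν i * mkt.competingBid w.2 (mkt.shade ν w.1) i) 0
  have h2 := le_max_right (mkt.Δ * w.1 i - ν i * mkt.competingBid w.2 (mkt.shade ν w.1) i) 0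
  split_ifs with h
  · rw [max_eq_left (by linarith : 0 ≤
      mkt.Δ * w.1 i - θ * mkt.competingBid w.2 (mkt.shade ν w.1) i)]
    linarith
  · rw [max_eq_right (by linarith :
      mkt.Δ * w.1 i - θ * mkt.competingBid w.2 (mkt.shade ν w.1) i ≤ 0)]
    linarith

/-- The duality gap of one period. By convexity it is at most `(ν_i - μ⋆_i)(Z' - ρ_i) + ν_i (ρ_i -
Z_i(ν))`, with `Z'` the payment of `i` at its stationary multiplier. The first product is of second
order. In the second, `ν_i` is split as `(ν_i - lo) + lo`, since the two parts are summed by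
different arguments. -/
theorem Regular.surplus_gap_le {p : Params mkt.N} {νlo νhi lam κ : ℝ} {μs : Fin mkt.N → ℝ}
    (H : mkt.Regular p νlo νhi lam κ μs) {ν : Fin mkt.N → ℝ}
    (hν : ∀ j, ν j ∈ Set.Icc p.lo p.hi) (i : Fin mkt.N) :
    surplus ν (μs i) i - surplus ν (ν i) i - ν i * mkt.expenditure ν i + μs i * mkt.ρ i
      ≤ ((ν i - μs i) ^ 2 + payLip mkt.Δ p.lo p.hi νhi ^ 2 * mkt.matchNorm i ^ 2 *
          ∑ j, (ν j - μs j) ^ 2) / 2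
        + (ν i - p.lo) * (mkt.ρ i - mkt.expenditure ν i)
        + p.lo * (mkt.ρ i - mkt.expenditure ν i) := by
  have h1 := surplus_sub_surplus_le p.lo_pos (fun j => (hν j).1) i (H.stat_Icc i).1
  have h2 := H.abs_expenditure_update_sub_le hν i
  set Z' := mkt.expenditure (Function.update ν i (μs i)) i
  set S := ∑ j, (ν j - μs j) ^ 2 with hS
  have hS0 : 0 ≤ S := Finset.sum_nonneg fun _ _ => sq_nonneg _
  set X := payLip mkt.Δ p.lo p.hi νhi * (mkt.matchNorm i * √S)
  have hX : payLip mkt.Δ p.lo p.hi νhi ^ 2 * mkt.matchNorm i ^ 2 * S = X ^ 2 := by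
    simp only [X, mul_pow, Real.sq_sqrt hS0]
    ring
  rw [hX]
  have h3 : (ν i - μs i) * (Z' - mkt.ρ i) ≤ ((ν i - μs i) ^ 2 + X ^ 2) / 2 := by
    have h4 := sq_le_sq.2 (h2.trans (le_abs_self X))
    nlinarith [sq_nonneg ((ν i - μs i) - (Z' - mkt.ρ i))]
  linarith

end Surplus

end Market

end Pacing

/-! ### The joint law of records and unconstrained multipliers. -/

namespace Pacing

namespace Market

variable {mkt : Market}

section Functionals

/-- The current multiplier of adaptive pacing of agent `j`, computed from the past. -/
noncomputable def mult (p : Params mkt.N) {t : ℕ} (past : mkt.Past t) (j : Fin mkt.N) : ℝ :=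
  multiplier p.lo p.hi p.eps (mkt.ρ j) (p.init j) t (past j)

/-- The total payments of agent `j`. -/
noncomputable def spent {t : ℕ} (past : mkt.Past t) (j : Fin mkt.N) : ℝ := ∑ s, (past j s).pay

/-- The total costs of agent `j`. -/
noncomputable def costs {t : ℕ} (past : mkt.Past t) (j : Fin mkt.N) : ℝ := ∑ s, (past j s).cost

variable (p : Params mkt.N) (T t : ℕ)

theorem mult_nextPast (w : (mkt.Past t × mkt.Draw) × (Fin mkt.N → ℝ)) (j : Fin mkt.N) :
    mult p (mkt.nextPast T t w) j = clip p.lo p.hi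
      (mult p w.1.1 j + p.eps * (mkt.payment w.1.2.2 w.2 j - mkt.ρ j)) := by
  simp [mult, multiplier, nextPast, clip, mkRecord, Record.pay]

theorem spent_nextPast (w : (mkt.Past t × mkt.Draw) × (Fin mkt.N → ℝ)) (j : Fin mkt.N) :
    spent (mkt.nextPast T t w) j = spent w.1.1 j + mkt.payment w.1.2.2 w.2 j := by
  simp [spent, Fin.sum_univ_castSucc, nextPast, mkRecord, Record.pay]

theorem costs_nextPast (w : (mkt.Past t × mkt.Draw) × (Fin mkt.N → ℝ)) (j : Fin mkt.N) :
    costs (mkt.nextPast T t w) j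
      = costs w.1.1 j + w.1.2.1 j * (1 - mkt.wins w.1.2.2 w.2 j * mkt.Δ) := by
  simp [costs, Fin.sum_univ_castSucc, nextPast, mkRecord, Record.cost]

theorem mult_mem (past : mkt.Past t) (j : Fin mkt.N) : mult p past j ∈ Set.Icc p.lo p.hi := by
  cases t with
  | zero => exact p.init_mem j
  | succ t => exact clip_mem p.lo_lt_hi.le _

theorem measurable_mult (j : Fin mkt.N) : Measurable fun past : mkt.Past t => mult p past j :=
  (measurable_multiplier _ _ _ _ _ t).comp (measurable_pi_apply j)

theorem measurable_spent (j : Fin mkt.N) : Measurable fun past : mkt.Past t => spent past j := by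
  unfold spent Record.pay
  fun_prop

theorem measurable_costs (j : Fin mkt.N) : Measurable fun past : mkt.Past t => costs past j := by
  unfold costs Record.cost
  fun_prop

end Functionals

section Joint

variable (mkt) in
/-- The unconstrained multipliers together with the past records. -/
abbrev State (t : ℕ) : Type := (Fin mkt.N → ℝ) × mkt.Past t

/-- The joint transition of unconstrained multipliers and records under common draws. -/
noncomputable def jointStep (p : Params mkt.N) (T t : ℕ)
    (x : (mkt.State t × mkt.Draw) × (Fin mkt.N → ℝ)) : mkt.State (t + 1) :=
  (idealStep p x.1.1.1 x.1.2, mkt.nextPast T t ((x.1.1.2, x.1.2), x.2))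

theorem measurable_jointStep (p : Params mkt.N) (T t : ℕ) : Measurable (jointStep p T t) :=
  ((measurable_idealStep p).comp (by fun_prop :
    Measurable fun x : (mkt.State t × mkt.Draw) × (Fin mkt.N → ℝ) => (x.1.1.1, x.1.2))).prodMk
  ((mkt.measurable_nextPast T t).comp (by fun_prop :
    Measurable fun x : (mkt.State t × mkt.Draw) × (Fin mkt.N → ℝ) => ((x.1.1.2, x.1.2), x.2)))

theorem measurable_forget (t : ℕ) :
    Measurable fun x : mkt.State t × mkt.Draw => (x.1.2, x.2) := by
  fun_prop

instance (T : ℕ) (β : Fin mkt.N → Strategy) (t : ℕ) : IsMarkovKernel (mkt.bids T β t) :=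
  ⟨fun w => by
    change IsProbabilityMeasure (Measure.pi fun i => (β i).bid t (mkt.historyOf T t i w))
    infer_instance⟩

/-- The joint law of the unconstrained multipliers and the records under the profile `β`. -/
noncomputable def joint (p : Params mkt.N) (T : ℕ) (β : Fin mkt.N → Strategy) :
    (t : ℕ) → Measure (mkt.State t)
  | 0 => Measure.dirac (p.init, fun _ => Fin.elim0)
  | t + 1 => (((joint p T β t).prod mkt.draw) ⊗ₘ
      (mkt.bids T β t).comap _ (measurable_forget t)).map (jointStep p T t)

instance isProbabilityMeasure_joint (p : Params mkt.N) (T : ℕ) (β : Fin mkt.N → Strategy)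
    (t : ℕ) : IsProbabilityMeasure (joint p T β t) := by
  induction t with
  | zero => exact Measure.dirac.isProbabilityMeasure
  | succ t ih => exact Measure.isProbabilityMeasure_map (measurable_jointStep p T t).aemeasurable

/-- The law of the unconstrained multipliers. -/
noncomputable def idealLaw (p : Params mkt.N) : ℕ → Measure (Fin mkt.N → ℝ)
  | 0 => Measure.dirac p.init
  | t + 1 => ((idealLaw p t).prod mkt.draw).map fun s => idealStep p s.1 s.2

instance isProbabilityMeasure_idealLaw (p : Params mkt.N) (t : ℕ) :
    IsProbabilityMeasure (idealLaw p t) := by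
  induction t with
  | zero => exact Measure.dirac.isProbabilityMeasure
  | succ t ih => exact Measure.isProbabilityMeasure_map (measurable_idealStep p).aemeasurable

variable (p : Params mkt.N) (T : ℕ) (β : Fin mkt.N → Strategy)

/-- The unconstrained step does not read the bids. Hence the same expectations appear in the upper
bound for pacing and in the lower bound for a deviation, and they can be subtracted. -/
theorem map_fst_joint (t : ℕ) : (joint p T β t).map Prod.fst = idealLaw p t := by
  induction t with
  | zero => rw [joint, idealLaw, Measure.map_dirac' measurable_fst]
  | succ t ih =>
    rw [joint, Measure.map_map measurable_fst (measurable_jointStep p T t), idealLaw, ← ih]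
    have h1 := Measure.map_prod_map (joint p T β t) mkt.draw measurable_fst measurable_id
    rw [Measure.map_id] at h1
    rw [h1, Measure.map_map (measurable_idealStep p) (measurable_fst.prodMap measurable_id)]
    have h2 : (((joint p T β t).prod mkt.draw) ⊗ₘ
      (mkt.bids T β t).comap _ (measurable_forget t)).map Prod.fst
      = (joint p T β t).prod mkt.draw := Measure.fst_compProd _ _
    conv_rhs => rw [← h2]
    rw [Measure.map_map ((measurable_idealStep p).comp (measurable_fst.prodMap measurable_id))
      measurable_fst]
    rfl

theorem map_snd_joint (t : ℕ) : (joint p T β t).map Prod.snd = mkt.law T β t := by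
  induction t with
  | zero => rw [joint, law, Measure.map_dirac' measurable_snd]
  | succ t ih =>
    rw [joint, Measure.map_map measurable_snd (measurable_jointStep p T t), law, ← ih]
    have h1 := Measure.map_prod_map (joint p T β t) mkt.draw measurable_snd measurable_id
    rw [Measure.map_id] at h1
    have h2 : (((joint p T β t).map Prod.snd).prod mkt.draw) ⊗ₘ mkt.bids T β t
        = (((joint p T β t).prod mkt.draw) ⊗ₘ
          (mkt.bids T β t).comap _ (measurable_forget t)).map
          fun x => ((x.1.1.2, x.1.2), x.2) := by
      refine Measure.ext_of_lintegral _ fun f hf => ?_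
      have hg : Measurable fun a : mkt.Past t × mkt.Draw => ∫⁻ b, f (a, b) ∂mkt.bids T β t a :=
        hf.lintegral_kernel_prod_right'
      have hq : Measurable fun x : (mkt.State t × mkt.Draw) × (Fin mkt.N → ℝ) =>
          f ((x.1.1.2, x.1.2), x.2) := hf.comp (by fun_prop)
      rw [lintegral_map hf (by fun_prop), Measure.lintegral_compProd hf,
        Measure.lintegral_compProd hq, h1,
        lintegral_map hg (measurable_snd.prodMap measurable_id)]
      rfl
    rw [h2, Measure.map_map (mkt.measurable_nextPast T t) (by fun_prop)]
    rfl

variable {p T β} {t : ℕ}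

theorem ae_joint_succ {P : mkt.State (t + 1) → Prop} (hP : MeasurableSet {s | P s})
    (h : ∀ᵐ s ∂joint p T β t, ∀ᵐ w ∂mkt.draw, ∀ᵐ b ∂mkt.bids T β t (s.2, w),
      P (jointStep p T t ((s, w), b))) : ∀ᵐ s ∂joint p T β (t + 1), P s := by
  rw [joint, ae_map_iff (measurable_jointStep p T t).aemeasurable hP]
  have hm : MeasurableSet {x | P (jointStep p T t x)} := measurable_jointStep p T t hP
  rw [Measure.ae_compProd_iff hm]
  have hm2 : MeasurableSet {a : mkt.State t × mkt.Draw |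
      ∀ᵐ b ∂(mkt.bids T β t).comap _ (measurable_forget t) a, P (jointStep p T t (a, b))} := by
    have h3 : Measurable fun a : mkt.State t × mkt.Draw =>
        (mkt.bids T β t).comap _ (measurable_forget t) a
          (Prod.mk a ⁻¹' {x | P (jointStep p T t x)}ᶜ) :=
      Kernel.measurable_kernel_prodMk_left hm.compl
    exact h3 (measurableSet_singleton 0)
  rw [Measure.ae_prod_iff_ae_ae hm2]
  exact h

/-- One-step comparison. The bids are first replaced by a bound `G` that depends on the draw alone,
so nothing needs to be known about the deviating strategy. Then the fresh draw, which is independent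
of the state, is integrated out. -/
theorem integral_joint_succ_le {F : mkt.State (t + 1) → ℝ} {H : mkt.State t → ℝ}
    (hFm : Measurable F) (hF : Integrable F (joint p T β (t + 1)))
    (hH : Integrable H (joint p T β t))
    (h : ∀ᵐ s ∂joint p T β t, ∃ G : mkt.Draw → ℝ, Integrable G mkt.draw ∧
      (∀ᵐ w ∂mkt.draw, ∀ᵐ b ∂mkt.bids T β t (s.2, w), F (jointStep p T t ((s, w), b)) ≤ G w) ∧
      ∫ w, G w ∂mkt.draw ≤ H s) :
    ∫ s, F s ∂joint p T β (t + 1) ≤ ∫ s, H s ∂joint p T β t := by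
  have hS := measurable_jointStep p T t
  rw [joint] at hF ⊢
  have hF2 := (integrable_map_measure hFm.aestronglyMeasurable hS.aemeasurable).1 hF
  rw [integral_map hS.aemeasurable hFm.aestronglyMeasurable]
  have e1 := Measure.integral_compProd hF2
  simp only [Function.comp_apply] at e1
  -- The measure is viewed as a kernel on a one-point space, which gives integrability after
  -- averaging over the bids.
  have hF3 := Integrable.integral_compProd (a := ()) (κ := Kernel.const Unit _)
    (η := Kernel.prodMkLeft Unit _) hF2
  simp only [Kernel.prodMkLeft_apply, Kernel.const_apply] at hF3
  have e2 := integral_prod _ hF3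
  simp only [Function.comp_apply] at e2
  rw [e1, e2]
  have hF4 := (Measure.integrable_compProd_iff hF2.aestronglyMeasurable).1 hF2
  have hF5 := Measure.ae_ae_of_ae_prod hF4.1
  refine integral_mono_ae hF3.integral_prod_left hH ?_
  filter_upwards [h, hF5, hF3.prod_right_ae] with s ⟨G, hG, hFG, hGH⟩ h5 h6
  refine le_trans (integral_mono_ae h6 hG ?_) hGH
  filter_upwards [hFG, h5] with w hw h7
  have h8 := integral_mono_ae h7 (integrable_const (G w)) hw
  simpa using h8

theorem integral_idealLaw_succ_le {F H : (Fin mkt.N → ℝ) → ℝ} (hFm : Measurable F)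
    (hF : Integrable F (idealLaw p (t + 1))) (hH : Integrable H (idealLaw p t))
    (h : ∀ᵐ ν ∂idealLaw p t, ∫ w, F (idealStep p ν w) ∂mkt.draw ≤ H ν) :
    ∫ ν, F ν ∂idealLaw p (t + 1) ≤ ∫ ν, H ν ∂idealLaw p t := by
  have hS := measurable_idealStep p
  rw [idealLaw] at hF ⊢
  have hF2 := (integrable_map_measure hFm.aestronglyMeasurable hS.aemeasurable).1 hF
  rw [integral_map hS.aemeasurable hFm.aestronglyMeasurable]
  have e1 := integral_prod _ hF2
  simp only [Function.comp_apply] at e1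
  rw [e1]
  exact integral_mono_ae hF2.integral_prod_left hH h

theorem integral_joint_fst {F : (Fin mkt.N → ℝ) → ℝ} (hF : Measurable F) :
    ∫ s, F s.1 ∂joint p T β t = ∫ ν, F ν ∂idealLaw p t := by
  rw [← map_fst_joint p T β t, integral_map measurable_fst.aemeasurable hF.aestronglyMeasurable]

theorem ae_idealLaw_mem : ∀ᵐ ν ∂idealLaw p t, ∀ j, ν j ∈ Set.Icc p.lo p.hi := by
  have hm : MeasurableSet {ν : Fin mkt.N → ℝ | ∀ j, ν j ∈ Set.Icc p.lo p.hi} := by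
    have : {ν : Fin mkt.N → ℝ | ∀ j, ν j ∈ Set.Icc p.lo p.hi}
        = Set.univ.pi fun _ => Set.Icc p.lo p.hi := by
      ext ν
      simp only [Set.mem_ofPred_eq, Set.mem_univ_pi]
    rw [this]
    exact MeasurableSet.univ_pi fun _ => measurableSet_Icc
  cases t with
  | zero => exact (ae_dirac_iff hm).2 p.init_mem
  | succ t =>
    rw [idealLaw, ae_map_iff (measurable_idealStep p).aemeasurable hm]
    exact ae_of_all _ fun s => idealStep_mem p s.1 s.2

theorem ae_joint_mem : ∀ᵐ s ∂joint p T β t, ∀ j, s.1 j ∈ Set.Icc p.lo p.hi := by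
  have h := ae_idealLaw_mem (p := p) (t := t)
  rw [← map_fst_joint p T β t] at h
  exact ae_of_ae_map measurable_fst.aemeasurable h

end Joint

/-! ### Budgets: bounded overspending, and no binding before the final periods. -/

section Invariants

variable {p : Params mkt.N} {T : ℕ} {β : Fin mkt.N → Strategy} {t : ℕ}

theorem ae_bids_feasible {past : mkt.Past t} (hs : ∀ j, spent past j ≤ mkt.ρ j * T)
    {w : mkt.Draw} (hw : ∀ j, w.1 j ∈ Set.Icc (0 : ℝ) 1) :
    ∀ᵐ b ∂mkt.bids T β t (past, w), ∀ j, b j ∈ Set.Icc 0 (mkt.ρ j * T - spent past j) := by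
  refine ae_all_iff.2 fun j => ?_
  have h := (β j).feasible t (mkt.historyOf T t j (past, w)) (hw j) (sub_nonneg.2 (hs j))
  exact Measure.tendsto_eval_ae_ae h

/-- The set `S` of agents that follow adaptive pacing is everyone for the equilibrium profile and
`{j | j ≠ i}` for a deviation of `i`. -/
theorem ae_bids_pacing {S : Set (Fin mkt.N)} (hS : ∀ j ∈ S, β j = pacing mkt p j)
    (past : mkt.Past t) (w : mkt.Draw) :
    ∀ᵐ b ∂mkt.bids T β t (past, w), ∀ j ∈ S,
      b j = min (mkt.shade (mult p past) w.1 j) (mkt.ρ j * T - spent past j) := by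
  refine ae_all_iff.2 fun j => ?_
  by_cases hj : j ∈ S
  · have h : ∀ᵐ x ∂(β j).bid t (mkt.historyOf T t j (past, w)),
        x = min (mkt.shade (mult p past) w.1 j) (mkt.ρ j * T - spent past j) := by
      rw [hS j hj]
      simp only [pacing]
      rw [Kernel.deterministic_apply]
      exact (ae_dirac_iff (measurableSet_singleton _)).2 rfl
    have h2 := Measure.tendsto_eval_ae_ae
      (μ := fun i => (β i).bid t (mkt.historyOf T t i (past, w))) h
    filter_upwards [h2] with b hb _ using hb
  · exact ae_of_all _ fun b h => absurd h hj

/-- Payments and costs are bounded by the rules of the market. -/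
theorem ae_joint_bounds : ∀ᵐ s ∂joint p T β t, ∀ j,
    (spent s.2 j ∈ Set.Icc 0 (mkt.ρ j * T)) ∧ costs s.2 j ∈ Set.Icc (0 : ℝ) t := by
  induction t with
  | zero =>
    refine ae_of_all _ fun s j => ?_
    have h := mul_nonneg (mkt.ρ_pos j).le (Nat.cast_nonneg (α := ℝ) T)
    simp [spent, costs, h]
  | succ t ih =>
    refine ae_joint_succ ?_ ?_
    · have h : ∀ j : Fin mkt.N, MeasurableSet {s : mkt.State (t + 1) |
          (spent s.2 j ∈ Set.Icc 0 (mkt.ρ j * T)) ∧ costs s.2 j ∈ Set.Icc (0 : ℝ) ↑(t + 1)} :=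
        fun j => (((measurable_spent (t + 1) j).comp measurable_snd) measurableSet_Icc).inter
          (((measurable_costs (t + 1) j).comp measurable_snd) measurableSet_Icc)
      have h2 := MeasurableSet.iInter h
      convert h2 using 1
      ext s
      simp
    · filter_upwards [ih] with s hs
      filter_upwards [mkt.ae_draw_mem] with w hw
      filter_upwards [ae_bids_feasible (β := β) (fun j => (hs j).1.2) hw] with b hb j
      have h1 : 0 ≤ mkt.payment w.2 b j := payment_nonneg fun k _ => (hb k).1
      have h2 : mkt.payment w.2 b j ≤ b j := payment_le_bid (hb j).1
      have h3 := wins_mem w.2 b j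
      have h4 := mkt.Δ_pos
      have h5 := mkt.Δ_le_one
      have h6 : mkt.wins w.2 b j * mkt.Δ ≤ 1 := by nlinarith [h3.1, h3.2]
      have h7 : 0 ≤ mkt.wins w.2 b j * mkt.Δ := mul_nonneg h3.1 h4.le
      have h8 := hw j
      simp only [jointStep, spent_nextPast, costs_nextPast]
      obtain ⟨⟨h9, h10⟩, h11, h12⟩ := hs j
      refine ⟨⟨by linarith, by linarith [(hb j).2]⟩, ?_, ?_⟩
      · nlinarith [mul_nonneg h8.1 (sub_nonneg.2 h6)]
      · push_cast
        nlinarith [mul_nonneg h8.1 h7, h8.2]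

/-- For small step sizes the projection at the upper bound is never active. -/
theorem step_le_hi {ρ : ℝ} {Δ lo hi ε m z : ℝ} (hlo : 0 < lo) (hm : m ∈ Set.Icc lo hi)
    (hε : 0 ≤ ε) (hε' : ε * Δ ≤ lo ^ 2) (hz : z ≤ Δ / m) (hρ : Δ / hi ≤ ρ) :
    m + ε * (z - ρ) ≤ hi := by
  have hm0 : 0 < m := hlo.trans_le hm.1
  have hhi : 0 < hi := hm0.trans_le hm.2
  -- The payment is at most the bid `Δ / m` and the rate at least `Δ / hi`, so the increment is a
  -- multiple of `hi - m`, with factor at most 1 for small `ε`.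
  have h1 : ε * (z - ρ) ≤ ε * (Δ / m - Δ / hi) := by gcongr
  have h2 : ε * (Δ / m - Δ / hi) = ε * Δ / (m * hi) * (hi - m) := by
    field_simp
  have h3 : ε * Δ / (m * hi) ≤ 1 := by
    rw [div_le_one (by positivity)]
    nlinarith [hm.1, hm.2]
  nlinarith [mul_le_mul_of_nonneg_right h3 (sub_nonneg.2 hm.2)]

/-- An agent that follows adaptive pacing overspends at most by a constant. -/
theorem ae_joint_spent_le {S : Set (Fin mkt.N)} (hS : ∀ j ∈ S, β j = pacing mkt p j)
    (hrate : ∀ j, mkt.Δ / p.hi ≤ mkt.ρ j) (hε : p.eps * mkt.Δ ≤ p.lo ^ 2) :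
    ∀ᵐ s ∂joint p T β t, ∀ j ∈ S,
      p.eps * (spent s.2 j - mkt.ρ j * t) ≤ mult p s.2 j - p.init j := by
  induction t with
  | zero => exact ae_of_all _ fun s j _ => by simp [spent, mult, multiplier]
  | succ t ih =>
    refine ae_joint_succ ?_ ?_
    · have h : ∀ j : Fin mkt.N, MeasurableSet {s : mkt.State (t + 1) | j ∈ S →
          p.eps * (spent s.2 j - mkt.ρ j * ↑(t + 1)) ≤ mult p s.2 j - p.init j} := by
        intro j
        by_cases hj : j ∈ S
        · simp only [hj, true_implies]
          have h1 := (measurable_spent (mkt := mkt) (t + 1) j)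
          have h2 := (measurable_mult p (t + 1) j)
          exact measurableSet_le (by fun_prop) (by fun_prop)
        · simp [hj]
      have h2 := MeasurableSet.iInter h
      convert h2 using 1
      ext s
      simp
    · filter_upwards [ih, ae_joint_bounds] with s hs hs2
      filter_upwards [mkt.ae_draw_mem] with w hw
      filter_upwards [ae_bids_feasible (β := β) (fun j => (hs2 j).1.2) hw,
        ae_bids_pacing (T := T) hS s.2 w] with b hb hb2 j hj
      simp only [jointStep, spent_nextPast, mult_nextPast]
      have hm := mult_mem p t s.2 j
      have h2 : mkt.payment w.2 b j ≤ mkt.Δ / mult p s.2 j := by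
        refine (payment_le_bid (hb j).1).trans ?_
        rw [hb2 j hj]
        exact (min_le_left _ _).trans (shade_le_div j (p.lo_pos.trans_le hm.1) (hw j))
      have h3 := step_le_hi p.lo_pos hm p.eps_pos.le hε h2 (hrate j)
      have h4 := hs j hj
      -- With the upper cut inactive, projection only raises the multiplier. Each overspent unit
      -- therefore leaves a permanent trace in it.
      have h5 : mult p s.2 j + p.eps * (mkt.payment w.2 b j - mkt.ρ j) ≤ clip p.lo p.hi
          (mult p s.2 j + p.eps * (mkt.payment w.2 b j - mkt.ρ j)) :=
        le_min (le_max_left _ _) h3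
      push_cast
      linarith

/-- The number of final periods in which budgets may bind. -/
noncomputable def slack (p : Params mkt.N) : ℝ :=
  p.hi / mkt.Δ * ((p.hi - p.lo) / p.eps + mkt.Δ / p.lo)

/-- Before the final periods budgets do not bind. -/
theorem ae_bids_shade {S : Set (Fin mkt.N)} (hS : ∀ j ∈ S, β j = pacing mkt p j)
    (hrate : ∀ j, mkt.Δ / p.hi ≤ mkt.ρ j) (hε : p.eps * mkt.Δ ≤ p.lo ^ 2)
    (ht : t + slack p ≤ T) :
    ∀ᵐ s ∂joint p T β t, ∀ᵐ w ∂mkt.draw, ∀ᵐ b ∂mkt.bids T β t (s.2, w),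
      ∀ j ∈ S, b j = mkt.shade (mult p s.2) w.1 j := by
  filter_upwards [ae_joint_spent_le hS hrate hε] with s hs
  filter_upwards [mkt.ae_draw_mem] with w hw
  filter_upwards [ae_bids_pacing (T := T) hS s.2 w] with b hb j hj
  rw [hb j hj]
  refine min_eq_left ((shade_le p.lo_pos j (mult_mem p t s.2 j).1 (hw j)).trans ?_)
  have h1 := hs j hj
  have h2 := (mult_mem p t s.2 j).2
  have h3 := (p.init_mem j).1
  have hε0 := p.eps_pos
  have hΔ := mkt.Δ_pos
  have hhi : 0 < p.hi := p.lo_pos.trans p.lo_lt_hi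
  have h4 : spent s.2 j - mkt.ρ j * t ≤ (p.hi - p.lo) / p.eps := by
    rw [le_div_iff₀ hε0]
    linarith
  have h5 : 0 ≤ (p.hi - p.lo) / p.eps + mkt.Δ / p.lo := add_nonneg
    (div_nonneg (sub_nonneg.2 p.lo_lt_hi.le) hε0.le) (div_nonneg hΔ.le p.lo_pos.le)
  have h6 : 0 ≤ slack p := mul_nonneg (div_nonneg hhi.le hΔ.le) h5
  -- At a rate of at least `Δ / hi`, the budget planned for `slack p` periods covers the largest
  -- possible overspending and one more bid of at most `Δ / lo`.
  have h7 : mkt.Δ / p.hi * slack p = (p.hi - p.lo) / p.eps + mkt.Δ / p.lo := by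
    unfold slack
    field_simp
  have h8 : mkt.Δ / p.hi * slack p ≤ mkt.ρ j * (T - t) := by
    have := hrate j
    have := mkt.ρ_pos j
    exact mul_le_mul (hrate j) (by linarith) h6 (mkt.ρ_pos j).le
  linarith

/-- Before the final periods, the multipliers of the pacing profile are unconstrained. -/
theorem ae_joint_mult_eq (hβ : ∀ j, β j = pacing mkt p j)
    (hrate : ∀ j, mkt.Δ / p.hi ≤ mkt.ρ j) (hε : p.eps * mkt.Δ ≤ p.lo ^ 2)
    (ht : t + slack p ≤ T + 1) :
    ∀ᵐ s ∂joint p T β t, ∀ j, mult p s.2 j = s.1 j := by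
  have hm : ∀ t, MeasurableSet {s : mkt.State t | ∀ j, mult p s.2 j = s.1 j} := by
    intro t
    have h : ∀ j : Fin mkt.N, MeasurableSet {s : mkt.State t | mult p s.2 j = s.1 j} := by
      intro j
      have h2 := (measurable_mult p t j)
      exact measurableSet_eq_fun (by fun_prop) (by fun_prop)
    have h2 := MeasurableSet.iInter h
    convert h2 using 1
    ext s
    simp
  induction t with
  | zero => exact (ae_dirac_iff (hm 0)).2 fun j => rfl
  | succ t ih =>
    -- The multiplier after `t + 1` periods depends on bids placed after at most `t` of them, hence
    -- the `+ 1` on the right of `ht`.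
    push_cast at ht
    refine ae_joint_succ (hm _) ?_
    filter_upwards [ih (by linarith), ae_bids_shade (S := Set.univ) (fun j _ => hβ j) hrate hε
      (by linarith : t + slack p ≤ T)] with s hs hs2
    filter_upwards [hs2] with w hw
    filter_upwards [hw] with b hb j
    have h1 : b = mkt.shade s.1 w.1 := by
      ext k
      rw [hb k (Set.mem_univ k), shade, shade, hs k]
    simp only [jointStep, mult_nextPast, idealStep, hs j, h1]

end Invariants

end Market

end Pacing

/-! ### Summation over the periods: distances, slackness, unspent budget and coupling gap. -/

namespace Pacing

/-- Summation of a linear recursion. -/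
theorem mul_sum_le_of_recursion {u g : ℕ → ℝ} {c : ℝ} {n : ℕ}
    (h : ∀ t < n, u (t + 1) ≤ (1 - c) * u t + g t) (hn : 0 ≤ u n) :
    c * ∑ t ∈ Finset.range n, u t ≤ u 0 + ∑ t ∈ Finset.range n, g t := by
  have h2 : ∀ k ≤ n, u k + c * ∑ t ∈ Finset.range k, u t ≤ u 0 + ∑ t ∈ Finset.range k, g t := by
    intro k
    induction k with
    | zero => simp
    | succ k ih =>
      intro hk
      rw [Finset.sum_range_succ, Finset.sum_range_succ]
      have := h k hk
      have := ih (Nat.le_of_succ_le hk)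
      linarith
  linarith [h2 n le_rfl]

namespace Market

variable {mkt : Market} {p : Params mkt.N}

section Integrability

theorem integrable_idealLaw_of_bound {F : (Fin mkt.N → ℝ) → ℝ} (hF : Measurable F) (C : ℝ)
    (h : ∀ ν : Fin mkt.N → ℝ, (∀ j, ν j ∈ Set.Icc p.lo p.hi) → |F ν| ≤ C) (t : ℕ) :
    Integrable F (idealLaw p t) :=
  Integrable.of_bound hF.aestronglyMeasurable C (by
    filter_upwards [ae_idealLaw_mem] with ν hν using h ν hν)

theorem integrable_idealLaw_sq {c : ℝ} (hc : c ∈ Set.Icc p.lo p.hi) (j : Fin mkt.N) (t : ℕ) :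
    Integrable (fun ν : Fin mkt.N → ℝ => (ν j - c) ^ 2) (idealLaw p t) := by
  refine integrable_idealLaw_of_bound (by fun_prop) ((p.hi - p.lo) ^ 2) (fun ν hν => ?_) t
  rw [abs_of_nonneg (sq_nonneg _)]
  refine sq_le_sq.2 ?_
  rw [abs_of_pos (sub_pos.2 p.lo_lt_hi), abs_le]
  constructor <;> linarith [(hν j).1, (hν j).2, hc.1, hc.2]

theorem measurable_expenditure (i : Fin mkt.N) :
    Measurable fun μ : Fin mkt.N → ℝ => mkt.expenditure μ i := by
  have h1 : Measurable fun s : (Fin mkt.N → ℝ) × mkt.Draw => mkt.shade s.1 s.2.1 := by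
    unfold shade
    fun_prop
  have h2 := mkt.measurable_payment_comp
    (measurable_snd.comp measurable_snd : Measurable fun s : (Fin mkt.N → ℝ) × mkt.Draw => s.2.2)
    h1 i
  exact (h2.stronglyMeasurable.integral_prod_right' (ν := mkt.draw)).measurable

theorem measurable_surplus {f : (Fin mkt.N → ℝ) → ℝ} (hf : Measurable f) (i : Fin mkt.N) :
    Measurable fun μ : Fin mkt.N → ℝ => surplus μ (f μ) i := by
  have h1 : Measurable fun s : (Fin mkt.N → ℝ) × mkt.Draw => mkt.shade s.1 s.2.1 := by
    unfold shade
    fun_prop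
  have h2 := mkt.measurable_competingBid_comp
    (measurable_snd.comp measurable_snd : Measurable fun s : (Fin mkt.N → ℝ) × mkt.Draw => s.2.2)
    h1 i
  have h3 : Measurable fun s : (Fin mkt.N → ℝ) × mkt.Draw =>
      max (mkt.Δ * s.2.1 i - f s.1 * mkt.competingBid s.2.2 (mkt.shade s.1 s.2.1) i) 0 := by
    have h4 := hf.comp (measurable_fst : Measurable fun s : (Fin mkt.N → ℝ) × mkt.Draw => s.1)
    simp only [Function.comp_def] at h2 h4
    fun_prop
  exact (h3.stronglyMeasurable.integral_prod_right' (ν := mkt.draw)).measurable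

theorem surplus_mem {lo : ℝ} (hlo : 0 < lo) {μ : Fin mkt.N → ℝ} (hμ : ∀ j, lo ≤ μ j) {θ : ℝ}
    (hθ : 0 ≤ θ) (i : Fin mkt.N) : surplus μ θ i ∈ Set.Icc 0 1 := by
  refine ⟨integral_nonneg fun w => le_max_right _ _, ?_⟩
  have h := integral_mono_ae (integrable_surplus_integrand hlo hμ hθ i) (integrable_const (1 : ℝ))
    (by filter_upwards [mkt.ae_draw_mem] with w hw using (surplus_integrand_mem hlo hμ hθ i hw).2)
  unfold surplus
  simpa using h

theorem integrable_idealLaw_expenditure (i : Fin mkt.N) (t : ℕ) :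
    Integrable (fun ν : Fin mkt.N → ℝ => mkt.expenditure ν i) (idealLaw p t) := by
  refine integrable_idealLaw_of_bound (measurable_expenditure i) (mkt.Δ / p.lo) (fun ν hν => ?_) t
  rw [abs_of_nonneg (expenditure_nonneg p.lo_pos (fun j => (hν j).1) i)]
  exact expenditure_le p.lo_pos (fun j => (hν j).1) i

theorem integrable_idealLaw_mul_expenditure (i : Fin mkt.N) (t : ℕ) :
    Integrable (fun ν : Fin mkt.N → ℝ => ν i * mkt.expenditure ν i) (idealLaw p t) := by
  have hm : Measurable fun ν : Fin mkt.N → ℝ => ν i * mkt.expenditure ν i :=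
    (measurable_pi_apply i).mul (measurable_expenditure i)
  refine integrable_idealLaw_of_bound hm (p.hi * (mkt.Δ / p.lo)) (fun ν hν => ?_) t
  have h1 := expenditure_nonneg p.lo_pos (fun j => (hν j).1) i
  have h2 := p.lo_pos.le.trans (hν i).1
  rw [abs_of_nonneg (mul_nonneg h2 h1)]
  exact mul_le_mul (hν i).2 (expenditure_le p.lo_pos (fun j => (hν j).1) i) h1
    (h2.trans (hν i).2)

theorem integrable_idealLaw_coord (i : Fin mkt.N) (t : ℕ) :
    Integrable (fun ν : Fin mkt.N → ℝ => ν i) (idealLaw p t) := by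
  refine integrable_idealLaw_of_bound (measurable_pi_apply i) p.hi (fun ν hν => ?_) t
  rw [abs_of_nonneg (p.lo_pos.le.trans (hν i).1)]
  exact (hν i).2

theorem integrable_idealLaw_surplus {f : (Fin mkt.N → ℝ) → ℝ} (hf : Measurable f)
    (hf0 : ∀ ν : Fin mkt.N → ℝ, (∀ j, ν j ∈ Set.Icc p.lo p.hi) → 0 ≤ f ν)
    (i : Fin mkt.N) (t : ℕ) :
    Integrable (fun ν : Fin mkt.N → ℝ => surplus ν (f ν) i) (idealLaw p t) := by
  refine integrable_idealLaw_of_bound (measurable_surplus hf i) 1 (fun ν hν => ?_) t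
  have h := surplus_mem p.lo_pos (fun j => (hν j).1) (hf0 ν hν) i
  rw [abs_of_nonneg h.1]
  exact h.2

theorem integrable_sub_lo_mul (p : Params mkt.N) (i : Fin mkt.N) (t : ℕ) :
    Integrable (fun ν => (ν i - p.lo) * (mkt.ρ i - mkt.expenditure ν i)) (idealLaw p t) := by
  have h1 := (((integrable_idealLaw_coord (p := p) i t).sub (integrable_const p.lo)).mul_const
    (mkt.ρ i)).sub ((integrable_idealLaw_mul_expenditure (p := p) i t).sub
      ((integrable_idealLaw_expenditure (p := p) i t).const_mul p.lo))
  refine h1.congr (ae_of_all _ fun ν => ?_)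
  simp only [Pi.sub_apply]
  ring

variable {T : ℕ} {β : Fin mkt.N → Strategy} {t : ℕ}

theorem integrable_joint_costs (i : Fin mkt.N) :
    Integrable (fun s : mkt.State t => costs s.2 i) (joint p T β t) := by
  refine Integrable.of_bound
    ((measurable_costs t i).comp measurable_snd).aestronglyMeasurable t ?_
  filter_upwards [ae_joint_bounds] with s hs
  have h := (hs i).2
  rw [Real.norm_of_nonneg h.1]
  exact h.2

theorem integrable_joint_spent (i : Fin mkt.N) :
    Integrable (fun s : mkt.State t => spent s.2 i) (joint p T β t) := by
  refine Integrable.of_bound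
    ((measurable_spent t i).comp measurable_snd).aestronglyMeasurable (mkt.ρ i * T) ?_
  filter_upwards [ae_joint_bounds] with s hs
  have h := (hs i).1
  rw [Real.norm_of_nonneg h.1]
  exact h.2

theorem integrable_joint_fst {F : (Fin mkt.N → ℝ) → ℝ} (hF : Integrable F (idealLaw p t)) :
    Integrable (fun s : mkt.State t => F s.1) (joint p T β t) := by
  rw [← map_fst_joint p T β t] at hF
  exact (integrable_map_measure hF.aestronglyMeasurable measurable_fst.aemeasurable).1 hF

/-- The squared distance between the multipliers of the agents other than `i` and the
unconstrained ones. -/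
noncomputable def gapSq (p : Params mkt.N) {t : ℕ} (i : Fin mkt.N) (s : mkt.State t) : ℝ :=
  ∑ j ∈ Finset.univ.erase i, (mult p s.2 j - s.1 j) ^ 2

theorem measurable_gapSq (i : Fin mkt.N) : Measurable fun s : mkt.State t => gapSq p i s := by
  unfold gapSq
  refine Finset.measurable_sum _ fun j _ => ?_
  have h := (measurable_mult p t j).comp
    (measurable_snd : Measurable fun s : mkt.State t => s.2)
  simp only [Function.comp_def] at h
  fun_prop

theorem integrable_gapSq (i : Fin mkt.N) :
    Integrable (fun s : mkt.State t => gapSq p i s) (joint p T β t) := by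
  refine Integrable.of_bound (measurable_gapSq i).aestronglyMeasurable
    (∑ j ∈ Finset.univ.erase i, (p.hi - p.lo) ^ 2) ?_
  filter_upwards [ae_joint_mem] with s hs
  have h0 : 0 ≤ gapSq p i s := Finset.sum_nonneg fun _ _ => sq_nonneg _
  rw [Real.norm_of_nonneg h0]
  refine Finset.sum_le_sum fun j _ => sq_le_sq.2 ?_
  have h := mult_mem p t s.2 j
  rw [abs_of_pos (sub_pos.2 p.lo_lt_hi), abs_le]
  constructor <;> linarith [(hs j).1, (hs j).2, h.1, h.2]

end Integrability

namespace Regular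

variable {νlo νhi lam κ : ℝ} {μs : Fin mkt.N → ℝ}

/-- Contraction at rate `2 λ ε` against noise of order `N ε²` per step, so the sum is of order `N
(1/ε + n ε)`. -/
theorem sum_dist_sq_le (H : mkt.Regular p νlo νhi lam κ μs) (n : ℕ) :
    2 * lam * p.eps * ∑ t ∈ Finset.range n, ∫ ν, ∑ j, (ν j - μs j) ^ 2 ∂idealLaw p t
      ≤ mkt.N * (p.hi - p.lo) ^ 2 + n * (p.eps ^ 2 * (mkt.N * (mkt.Δ / p.lo) ^ 2)) := by
  have hint : ∀ t, Integrable (fun ν => ∑ j, (ν j - μs j) ^ 2) (idealLaw p t) := fun t =>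
    integrable_finsetSum _ fun j _ => integrable_idealLaw_sq (H.stat_Icc j) j t
  refine (mul_sum_le_of_recursion (g := fun _ => p.eps ^ 2 * (mkt.N * (mkt.Δ / p.lo) ^ 2))
    (fun t _ => ?_) (integral_nonneg fun ν => Finset.sum_nonneg fun _ _ => sq_nonneg _)).trans ?_
  · refine (integral_idealLaw_succ_le (by fun_prop) (hint (t + 1))
      (((hint t).const_mul (1 - 2 * lam * p.eps)).add (integrable_const _)) (by
        filter_upwards [ae_idealLaw_mem] with ν hν using H.integral_sum_sq_le hν)).trans ?_
    refine (integral_add ((hint t).const_mul _) (integrable_const _)).le.trans ?_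
    rw [integral_const_mul]
    simp
  · rw [Finset.sum_const, Finset.card_range, nsmul_eq_mul]
    refine add_le_add_left ?_ _
    have h : ∀ j : Fin mkt.N, (p.init j - μs j) ^ 2 ≤ (p.hi - p.lo) ^ 2 := fun j => by
      refine sq_le_sq.2 ?_
      rw [abs_of_pos (sub_pos.2 p.lo_lt_hi), abs_le]
      constructor <;> linarith [(p.init_mem j).1, (p.init_mem j).2, (H.stat_Icc j).1,
        (H.stat_Icc j).2]
    simp only [idealLaw]
    rw [integral_dirac]
    refine (Finset.sum_le_sum fun j _ => h j).trans ?_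
    simp

/-- The total distance is of order `N` but enters with weight `‖a_i‖²`. Since `N ‖a_i‖² ≤ κ²`, the
sum for a single agent is of order `1/ε + n ε`, uniformly in `N`. -/
theorem sum_coord_sq_le (H : mkt.Regular p νlo νhi lam κ μs) (i : Fin mkt.N) (n : ℕ) :
    lam * p.eps * ∑ t ∈ Finset.range n, ∫ ν, (ν i - μs i) ^ 2 ∂idealLaw p t
      ≤ (p.hi - p.lo) ^ 2 + p.eps * (payLip mkt.Δ p.lo p.hi νhi ^ 2 * mkt.matchNorm i ^ 2 / lam
          * ∑ t ∈ Finset.range n, ∫ ν, ∑ j, (ν j - μs j) ^ 2 ∂idealLaw p t)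
        + n * (p.eps ^ 2 * (mkt.Δ / p.lo) ^ 2) := by
  have hint : ∀ t, Integrable (fun ν => ∑ j, (ν j - μs j) ^ 2) (idealLaw p t) := fun t =>
    integrable_finsetSum _ fun j _ => integrable_idealLaw_sq (H.stat_Icc j) j t
  have hi := integrable_idealLaw_sq (H.stat_Icc i) i
  refine (mul_sum_le_of_recursion (g := fun t =>
    p.eps * (payLip mkt.Δ p.lo p.hi νhi ^ 2 * mkt.matchNorm i ^ 2 / lam
      * ∫ ν, ∑ j, (ν j - μs j) ^ 2 ∂idealLaw p t) + p.eps ^ 2 * (mkt.Δ / p.lo) ^ 2)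
    (fun t _ => ?_) (integral_nonneg fun ν => sq_nonneg _)).trans ?_
  · have h1 : Integrable (fun ν => (1 - lam * p.eps) * (ν i - μs i) ^ 2
        + p.eps * (payLip mkt.Δ p.lo p.hi νhi ^ 2 * mkt.matchNorm i ^ 2 / lam
          * ∑ j, (ν j - μs j) ^ 2)) (idealLaw p t) :=
      ((hi t).const_mul _).add (((hint t).const_mul _).const_mul _)
    refine (integral_idealLaw_succ_le (by fun_prop) (hi (t + 1))
      (h1.add (integrable_const (p.eps ^ 2 * (mkt.Δ / p.lo) ^ 2))) (by
        filter_upwards [ae_idealLaw_mem] with ν hν using H.integral_coord_sq_le hν i)).trans ?_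
    refine (integral_add h1 (integrable_const _)).le.trans ?_
    rw [integral_add ((hi t).const_mul _) (((hint t).const_mul _).const_mul _),
      integral_const_mul, integral_const_mul, integral_const_mul]
    simp
    linarith
  · have h : (p.init i - μs i) ^ 2 ≤ (p.hi - p.lo) ^ 2 := by
      refine sq_le_sq.2 ?_
      rw [abs_of_pos (sub_pos.2 p.lo_lt_hi), abs_le]
      constructor <;> linarith [(p.init_mem i).1, (p.init_mem i).2, (H.stat_Icc i).1,
        (H.stat_Icc i).2]
    rw [Finset.sum_add_distrib, Finset.sum_const, Finset.card_range, nsmul_eq_mul,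
      ← Finset.mul_sum, ← Finset.mul_sum, ← add_assoc]
    refine add_le_add_left (add_le_add_left ?_ _) _
    simp only [idealLaw]
    rw [integral_dirac]
    exact h

/-- Approximate complementary slackness. The squared distance to `lo` cannot be increased by the
projection, so it telescopes without any assumption on how close the stationary multiplier is to
`lo`. -/
theorem sum_slackness_le (H : mkt.Regular p νlo νhi lam κ μs) (i : Fin mkt.N) (n : ℕ) :
    2 * p.eps * ∑ t ∈ Finset.range n,
        ∫ ν, (ν i - p.lo) * (mkt.ρ i - mkt.expenditure ν i) ∂idealLaw p t
      ≤ (p.hi - p.lo) ^ 2 + n * (p.eps ^ 2 * (mkt.Δ / p.lo) ^ 2) := by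
  have hlo : p.lo ∈ Set.Icc p.lo p.hi := ⟨le_rfl, p.lo_lt_hi.le⟩
  have hi := integrable_idealLaw_sq hlo i
  have hm := integrable_sub_lo_mul p i
  -- With `c = 0` the recursion is a plain telescoping sum.
  have h := mul_sum_le_of_recursion (c := 0) (n := n)
    (u := fun t => ∫ ν, (ν i - p.lo) ^ 2 ∂idealLaw p t)
    (g := fun t => p.eps ^ 2 * (mkt.Δ / p.lo) ^ 2
      - 2 * p.eps * ∫ ν, (ν i - p.lo) * (mkt.ρ i - mkt.expenditure ν i) ∂idealLaw p t)
    (fun t _ => by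
      have h1 : Integrable (fun ν => (ν i - p.lo) ^ 2
          - 2 * p.eps * ((ν i - p.lo) * (mkt.ρ i - mkt.expenditure ν i))) (idealLaw p t) :=
        (hi t).sub ((hm t).const_mul _)
      refine (integral_idealLaw_succ_le (by fun_prop) (hi (t + 1))
        (h1.add (integrable_const (p.eps ^ 2 * (mkt.Δ / p.lo) ^ 2))) (by
          filter_upwards [ae_idealLaw_mem] with ν hν
          refine (H.integral_idealStep_sq_le hν i hlo).trans (le_of_eq ?_)
          simp only [Pi.add_apply]
          ring)).trans ?_
      refine (integral_add h1 (integrable_const _)).le.trans ?_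
      rw [integral_sub (hi t) ((hm t).const_mul _), integral_const_mul]
      simp
      linarith) (integral_nonneg fun ν => sq_nonneg _)
  rw [Finset.sum_sub_distrib, ← Finset.mul_sum (a := 2 * p.eps) (s := Finset.range n),
    Finset.sum_const, Finset.card_range, nsmul_eq_mul] at h
  have h0 : ∫ ν, (ν i - p.lo) ^ 2 ∂idealLaw p 0 ≤ (p.hi - p.lo) ^ 2 := by
    simp only [idealLaw]
    rw [integral_dirac]
    exact pow_le_pow_left₀ (sub_nonneg.2 (p.init_mem i).1) (by linarith [(p.init_mem i).2]) 2
  linarith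

/-- Underspending lowers `ν_i`, which cannot fall below `lo`. The telescoping is spoilt only by cuts
at `lo`, and the margin `η` charges these to the squared distance from the stationary multiplier. -/
theorem sum_underspend_le (H : mkt.Regular p νlo νhi lam κ μs) {i : Fin mkt.N} {η : ℝ}
    (hη : 0 < η) (hηi : p.lo + η ≤ μs i) (hε : p.eps * (mkt.Δ / p.lo) ≤ η / 2) (n : ℕ) :
    p.eps * ∑ t ∈ Finset.range n, ∫ ν, (mkt.ρ i - mkt.expenditure ν i) ∂idealLaw p t
      ≤ (p.hi - p.lo) + p.eps * (mkt.Δ / p.lo * (4 / η ^ 2)) *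
        ∑ t ∈ Finset.range n, ∫ ν, (ν i - μs i) ^ 2 ∂idealLaw p t := by
  have hi := integrable_idealLaw_coord (p := p) i
  have hz : ∀ t, Integrable (fun ν => mkt.ρ i - mkt.expenditure ν i) (idealLaw p t) := fun t =>
    (integrable_const _).sub (integrable_idealLaw_expenditure i t)
  have hq := integrable_idealLaw_sq (H.stat_Icc i) i
  have hl : ∀ t, Integrable (fun ν : Fin mkt.N → ℝ => ν i - p.lo) (idealLaw p t) := fun t =>
    (hi t).sub (integrable_const _)
  have h := mul_sum_le_of_recursion (c := 0) (n := n)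
    (u := fun t => ∫ ν, (ν i - p.lo) ∂idealLaw p t)
    (g := fun t => p.eps * (mkt.Δ / p.lo * (4 / η ^ 2)) * ∫ ν, (ν i - μs i) ^ 2 ∂idealLaw p t
      - p.eps * ∫ ν, (mkt.ρ i - mkt.expenditure ν i) ∂idealLaw p t)
    (fun t _ => by
      have h1 : Integrable (fun ν => ν i - p.lo
          - p.eps * (mkt.ρ i - mkt.expenditure ν i)) (idealLaw p t) :=
        ((hi t).sub (integrable_const _)).sub ((hz t).const_mul _)
      have h2 := (hq t).const_mul (p.eps * (mkt.Δ / p.lo * (4 / η ^ 2)))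
      refine (integral_idealLaw_succ_le (by fun_prop) (hl (t + 1))
        (h1.add h2) (by
          filter_upwards [ae_idealLaw_mem] with ν hν
          rw [integral_sub (integrable_idealStep p ν i) (integrable_const _)]
          have := H.integral_idealStep_le hν hη hηi hε
          simp
          linarith)).trans ?_
      refine (integral_add h1 h2).le.trans ?_
      rw [integral_sub (hl t) ((hz t).const_mul _), integral_const_mul,
        integral_const_mul]
      linarith) (integral_nonneg_of_ae (by
        filter_upwards [ae_idealLaw_mem] with ν hν using sub_nonneg.2 (hν i).1))
  rw [Finset.sum_sub_distrib, ← Finset.mul_sum, ← Finset.mul_sum] at h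
  have h0 : ∫ ν, (ν i - p.lo) ∂idealLaw p 0 ≤ p.hi - p.lo := by
    simp only [idealLaw]
    rw [integral_dirac]
    linarith [(p.init_mem i).2]
  linarith

/-- The substitute when there is no margin. Lipschitz continuity bounds underspending by a
first-order distance, and `x ≤ ω/2 + x²/(2ω)` passes to second moments, with the scale `ω` left free
for later optimisation. -/
theorem integral_underspend_le (H : mkt.Regular p νlo νhi lam κ μs) (i : Fin mkt.N) {ω : ℝ}
    (hω : 0 < ω) (t : ℕ) :
    ∫ ν, (mkt.ρ i - mkt.expenditure ν i) ∂idealLaw p t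
      ≤ payLip mkt.Δ p.lo p.hi νhi * (ω + (∫ ν, (ν i - μs i) ^ 2 ∂idealLaw p t
        + mkt.matchNorm i ^ 2 * ∫ ν, ∑ j, (ν j - μs j) ^ 2 ∂idealLaw p t) / (2 * ω)) := by
  have hint : Integrable (fun ν => ∑ j, (ν j - μs j) ^ 2) (idealLaw p t) :=
    integrable_finsetSum _ fun j _ => integrable_idealLaw_sq (H.stat_Icc j) j t
  have hi := integrable_idealLaw_sq (H.stat_Icc i) i t
  have h1 : Integrable (fun ν => (ν i - μs i) ^ 2
      + mkt.matchNorm i ^ 2 * ∑ j, (ν j - μs j) ^ 2) (idealLaw p t) := hi.add (hint.const_mul _)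
  rw [← integral_const_mul, ← integral_add hi (hint.const_mul _), ← integral_div]
  have h2 := (integrable_const (μ := idealLaw p t) ω).add (h1.div_const (2 * ω))
  have h3 : ∫ ν, payLip mkt.Δ p.lo p.hi νhi * (ω + ((ν i - μs i) ^ 2
      + mkt.matchNorm i ^ 2 * ∑ j, (ν j - μs j) ^ 2) / (2 * ω)) ∂idealLaw p t
      = payLip mkt.Δ p.lo p.hi νhi * (ω + ∫ ν, ((ν i - μs i) ^ 2
      + mkt.matchNorm i ^ 2 * ∑ j, (ν j - μs j) ^ 2) / (2 * ω) ∂idealLaw p t) := by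
    rw [integral_const_mul, integral_add (integrable_const _) (h1.div_const _)]
    simp
  rw [← h3]
  refine integral_mono_ae ((integrable_const _).sub (integrable_idealLaw_expenditure i t))
    (h2.const_mul _) ?_
  filter_upwards [ae_idealLaw_mem] with ν hν
  have h4 := H.abs_expenditure_sub_rate_le hν i
  have hS0 : 0 ≤ ∑ j, (ν j - μs j) ^ 2 := Finset.sum_nonneg fun _ _ => sq_nonneg _
  rw [abs_sub_comm] at h4
  refine (le_abs_self _).trans (h4.trans (mul_le_mul_of_nonneg_left ?_ H.L_nonneg))
  have h5 : ∀ x : ℝ, x ≤ ω / 2 + x ^ 2 / (2 * ω) := fun x => by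
    have : ω / 2 + x ^ 2 / (2 * ω) - x = (x - ω) ^ 2 / (2 * ω) := by
      field_simp
      ring
    have : 0 ≤ (x - ω) ^ 2 / (2 * ω) := by positivity
    linarith
  have h6 := h5 |ν i - μs i|
  have h7 := h5 (mkt.matchNorm i * √(∑ j, (ν j - μs j) ^ 2))
  rw [sq_abs] at h6
  rw [mul_pow, Real.sq_sqrt hS0] at h7
  rw [add_div]
  linarith

/-- The multipliers of the other agents stay close to the unconstrained ones when `i` deviates. -/
theorem sum_gapSq_le (H : mkt.Regular p νlo νhi lam κ μs) {T : ℕ}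
    {β : Fin mkt.N → Strategy} {i : Fin mkt.N} (hβ : ∀ j, j ≠ i → β j = pacing mkt p j)
    (hε : p.eps * mkt.Δ ≤ p.lo ^ 2) {n : ℕ} (hn : ∀ t < n, t + slack p ≤ T) :
    lam * p.eps * ∑ t ∈ Finset.range n, ∫ s, gapSq p i s ∂joint p T β t
      ≤ n * (p.eps * ((2 * (mkt.Δ / p.lo) * mkt.matchNorm i
            + p.eps * √mkt.N * (mkt.Δ / p.lo * payLip mkt.Δ p.lo p.hi νhi * (1 + κ))) ^ 2
            / (4 * lam)) + p.eps ^ 2 * ((mkt.Δ / p.lo) ^ 2 * κ)) := by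
  set X := p.eps * ((2 * (mkt.Δ / p.lo) * mkt.matchNorm i
      + p.eps * √mkt.N * (mkt.Δ / p.lo * payLip mkt.Δ p.lo p.hi νhi * (1 + κ))) ^ 2
      / (4 * lam)) with hX
  set Y := p.eps ^ 2 * ((mkt.Δ / p.lo) ^ 2 * κ) with hY
  have h := mul_sum_le_of_recursion (c := lam * p.eps) (n := n)
    (u := fun t => ∫ s, gapSq p i s ∂joint p T β t) (g := fun _ => X + Y)
    (fun t ht => by
      have h1 := ((integrable_gapSq (p := p) (T := T) (β := β) (t := t) i).const_mul
        (1 - lam * p.eps))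
      refine (integral_joint_succ_le (measurable_gapSq i) (integrable_gapSq i)
        (h1.add (integrable_const (X + Y))) ?_).trans ?_
      · filter_upwards [ae_joint_mem, ae_joint_bounds, ae_bids_shade (S := {j | j ≠ i})
          (fun j hj => hβ j hj) H.rate hε (hn t ht)] with s hs hs2 hs3
        -- The deviator need not bid according to a multiplier. Its coordinate is set to the
        -- unconstrained value so that the two profiles agree there, as the one-step bound requires.
        have hmem : ∀ j, Function.update (mult p s.2) i (s.1 i) j ∈ Set.Icc p.lo p.hi := by
          intro j
          rcases eq_or_ne j i with rfl | hj
          · simpa using hs j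
          · simpa [Function.update_of_ne hj] using mult_mem p t s.2 j
        refine ⟨couplingBound p (Function.update (mult p s.2) i (s.1 i)) s.1 i,
          integrable_couplingBound p (fun j => (hmem j).1) (fun j => (hs j).1) i, ?_, ?_⟩
        · filter_upwards [mkt.ae_draw_mem, hs3] with w hw hw3
          filter_upwards [hw3, ae_bids_feasible (β := β) (fun j => (hs2 j).1.2) hw] with b hb hb2
          refine le_trans (le_of_eq ?_) (sum_sq_step_le_couplingBound p
            (fun j => (hmem j).1) (fun j => (hs j).1) hw (b := b) (fun j hj => ?_) (hb2 i).1)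
          · refine Finset.sum_congr rfl fun j hj => ?_
            rw [Function.update_of_ne (Finset.ne_of_mem_erase hj)]
            simp only [jointStep, mult_nextPast]
          · rw [hb j hj, shade, shade, Function.update_of_ne hj]
        · refine (H.integral_couplingBound_le hmem hs (by simp)).trans (le_of_eq ?_)
          have h2 : ∑ j ∈ Finset.univ.erase i,
              (Function.update (mult p s.2) i (s.1 i) j - s.1 j) ^ 2 = gapSq p i s :=
            Finset.sum_congr rfl fun j hj => by
              rw [Function.update_of_ne (Finset.ne_of_mem_erase hj)]
          rw [h2]
          simp only [Pi.add_apply]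
          rw [hX, hY]
          ring
      · refine (integral_add h1 (integrable_const _)).le.trans ?_
        rw [integral_const_mul]
        simp)
    (integral_nonneg fun s => Finset.sum_nonneg fun _ _ => sq_nonneg _)
  have h0 : ∫ s, gapSq p i s ∂joint p T β 0 = 0 := by
    simp only [joint]
    rw [integral_dirac' _ _ (measurable_gapSq i).stronglyMeasurable]
    simp [gapSq, mult, multiplier]
  rw [Finset.sum_const, Finset.card_range, nsmul_eq_mul, h0, zero_add] at h
  exact h

end Regular

end Market

end Pacing

/-! ### Total costs: an upper bound for pacing and a lower bound for a deviation. -/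

namespace Pacing

namespace Market

variable {mkt : Market} {p : Params mkt.N}

section Costs

variable {T : ℕ} {β : Fin mkt.N → Strategy} {t : ℕ}

theorem totalCost_eq (p : Params mkt.N) (T : ℕ) (β : Fin mkt.N → Strategy) (i : Fin mkt.N) :
    mkt.totalCost T β i = ∫ s, costs s.2 i ∂joint p T β T := by
  rw [totalCost, ← map_snd_joint p T β T]
  exact integral_map measurable_snd.aemeasurable (measurable_costs T i).aestronglyMeasurable

theorem totalCost_nonneg (p : Params mkt.N) (T : ℕ) (β : Fin mkt.N → Strategy) (i : Fin mkt.N) :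
    0 ≤ mkt.totalCost T β i := by
  rw [totalCost_eq p]
  exact integral_nonneg_of_ae (by filter_upwards [ae_joint_bounds] with s hs using (hs i).2.1)

theorem totalCost_le (p : Params mkt.N) (T : ℕ) (β : Fin mkt.N → Strategy) (i : Fin mkt.N) :
    mkt.totalCost T β i ≤ T := by
  rw [totalCost_eq p]
  have h := integral_mono_ae (integrable_joint_costs (p := p) (T := T) (β := β) (t := T) i)
    (integrable_const (T : ℝ)) (by filter_upwards [ae_joint_bounds] with s hs using (hs i).2.2)
  simpa using h

theorem cost_mem {v : ℝ} (hv : v ∈ Set.Icc (0 : ℝ) 1) (m : Fin mkt.N → Fin mkt.M)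
    (b : Fin mkt.N → ℝ) (i : Fin mkt.N) :
    v * (1 - mkt.wins m b i * mkt.Δ) ∈ Set.Icc (0 : ℝ) 1 := by
  have h3 := wins_mem m b i
  have h4 := mkt.Δ_pos
  have h5 := mkt.Δ_le_one
  have h6 : mkt.wins m b i * mkt.Δ ≤ 1 := by nlinarith [h3.1, h3.2]
  have h7 : 0 ≤ mkt.wins m b i * mkt.Δ := mul_nonneg h3.1 h4.le
  exact ⟨mul_nonneg hv.1 (by linarith), by nlinarith [mul_nonneg hv.1 h7, hv.2]⟩

theorem measurable_state_costs (i : Fin mkt.N) :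
    Measurable fun s : mkt.State t => costs s.2 i :=
  (measurable_costs t i).comp measurable_snd

theorem measurable_state_spent (i : Fin mkt.N) :
    Measurable fun s : mkt.State t => spent s.2 i :=
  (measurable_spent t i).comp measurable_snd

theorem integral_costs_succ_le (i : Fin mkt.N) :
    ∫ s, costs s.2 i ∂joint p T β (t + 1) ≤ ∫ s, costs s.2 i ∂joint p T β t + 1 := by
  have h1 := integrable_joint_costs (p := p) (T := T) (β := β) (t := t) i
  refine (integral_joint_succ_le (measurable_state_costs i) (integrable_joint_costs i)
    (h1.add (integrable_const 1)) ?_).trans ?_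
  · refine ae_of_all _ fun s => ⟨fun _ => costs s.2 i + 1, integrable_const _, ?_, by simp⟩
    filter_upwards [mkt.ae_draw_mem] with w hw
    refine ae_of_all _ fun b => ?_
    simp only [jointStep, costs_nextPast]
    linarith [(cost_mem (hw i) w.2 b i).2]
  · refine (integral_add h1 (integrable_const _)).le.trans ?_
    simp

theorem integral_costs_le_succ (i : Fin mkt.N) :
    ∫ s, costs s.2 i ∂joint p T β t ≤ ∫ s, costs s.2 i ∂joint p T β (t + 1) := by
  have h1 := integrable_joint_costs (p := p) (T := T) (β := β) (t := t) i
  have h2 := integrable_joint_costs (p := p) (T := T) (β := β) (t := t + 1) i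
  have h := integral_joint_succ_le (F := fun s => -costs s.2 i) (H := fun s => -costs s.2 i)
    (measurable_state_costs i).neg h2.neg h1.neg (by
      refine ae_of_all _ fun s => ⟨fun _ => -costs s.2 i, integrable_const _, ?_, by simp⟩
      filter_upwards [mkt.ae_draw_mem] with w hw
      refine ae_of_all _ fun b => ?_
      simp only [jointStep, costs_nextPast]
      linarith [(cost_mem (hw i) w.2 b i).1])
  rw [integral_neg, integral_neg] at h
  linarith

theorem integral_costs_mono (i : Fin mkt.N) {n m : ℕ} (hnm : n ≤ m) :
    ∫ s, costs s.2 i ∂joint p T β n ≤ ∫ s, costs s.2 i ∂joint p T β m :=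
  monotone_nat_of_le_succ (f := fun t => ∫ s, costs s.2 i ∂joint p T β t)
    (fun _ => integral_costs_le_succ i) hnm

theorem integral_costs_le_add (i : Fin mkt.N) (n k : ℕ) :
    ∫ s, costs s.2 i ∂joint p T β (n + k) ≤ ∫ s, costs s.2 i ∂joint p T β n + k := by
  induction k with
  | zero => simp
  | succ k ih =>
    have := integral_costs_succ_le (p := p) (T := T) (β := β) (t := n + k) i
    push_cast
    rw [← add_assoc]
    linarith

theorem integral_costs_zero (i : Fin mkt.N) : ∫ s, costs s.2 i ∂joint p T β 0 = 0 := by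
  simp only [joint]
  rw [integral_dirac' _ _ (measurable_state_costs i).stronglyMeasurable]
  simp [costs]

theorem integral_spent_zero (i : Fin mkt.N) : ∫ s, spent s.2 i ∂joint p T β 0 = 0 := by
  simp only [joint]
  rw [integral_dirac' _ _ (measurable_state_spent i).stronglyMeasurable]
  simp [spent]

/-- The expected valuation of agent `i`. -/
noncomputable def meanValuation (i : Fin mkt.N) : ℝ := ∫ w, w.1 i ∂mkt.draw

end Costs

namespace Regular

variable {νlo νhi lam κ : ℝ} {μs : Fin mkt.N → ℝ}

theorem integrable_surplus_self (p : Params mkt.N) (i : Fin mkt.N) (t : ℕ) :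
    Integrable (fun ν : Fin mkt.N → ℝ => surplus ν (ν i) i) (idealLaw p t) :=
  integrable_idealLaw_surplus (measurable_pi_apply i)
    (fun _ hν => p.lo_pos.le.trans (hν i).1) i t

theorem integrable_surplus_stat (H : mkt.Regular p νlo νhi lam κ μs) (i : Fin mkt.N) (t : ℕ) :
    Integrable (fun ν : Fin mkt.N → ℝ => surplus ν (μs i) i) (idealLaw p t) :=
  integrable_idealLaw_surplus measurable_const
    (fun _ _ => p.lo_pos.le.trans (H.stat_Icc i).1) i t

/-- The cost of adaptive pacing in terms of the unconstrained multipliers. -/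
theorem totalCost_pacing_le (H : mkt.Regular p νlo νhi lam κ μs) {T : ℕ}
    (hε : p.eps * mkt.Δ ≤ p.lo ^ 2) (i : Fin mkt.N) {n : ℕ} (hnT : n ≤ T)
    (hn : ∀ t < n, t + slack p ≤ T) :
    mkt.totalCost T (pacing mkt p) i ≤ ∑ t ∈ Finset.range n, (meanValuation i
      - ∫ ν, surplus ν (ν i) i ∂idealLaw p t - ∫ ν, ν i * mkt.expenditure ν i ∂idealLaw p t)
      + (T - n) := by
  have hstep : ∀ t < n, ∫ s, costs s.2 i ∂joint p T (pacing mkt p) (t + 1)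
      ≤ ∫ s, costs s.2 i ∂joint p T (pacing mkt p) t + (meanValuation i
      - ∫ ν, surplus ν (ν i) i ∂idealLaw p t
      - ∫ ν, ν i * mkt.expenditure ν i ∂idealLaw p t) := by
    intro t ht
    have h1 := integrable_joint_costs (p := p) (T := T) (β := pacing mkt p) (t := t) i
    have h2 := integrable_surplus_self p i t
    have h3 := integrable_idealLaw_mul_expenditure (p := p) i t
    have h4 : Integrable (fun ν : Fin mkt.N → ℝ => meanValuation i - surplus ν (ν i) i
        - ν i * mkt.expenditure ν i) (idealLaw p t) := ((integrable_const _).sub h2).sub h3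
    have h5 := integrable_joint_fst (T := T) (β := pacing mkt p) h4
    refine (integral_joint_succ_le (measurable_state_costs i) (integrable_joint_costs i)
      (h1.add h5) ?_).trans ?_
    · filter_upwards [ae_joint_mem, ae_joint_mult_eq (β := pacing mkt p) (fun _ => rfl) H.rate hε
        (by linarith [hn t ht] : t + slack p ≤ T + 1),
        ae_bids_shade (S := Set.univ) (β := pacing mkt p) (fun _ _ => rfl) H.rate hε
        (hn t ht)] with s hs hs2 hs3
      have hm : Measurable fun w : mkt.Draw =>
          w.1 i * (1 - mkt.wins w.2 (mkt.shade s.1 w.1) i * mkt.Δ) := by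
        have := mkt.measurable_wins_comp (measurable_snd : Measurable fun w : mkt.Draw => w.2)
          ((mkt.measurable_shade s.1).comp measurable_fst) i
        simp only [Function.comp_def] at this
        fun_prop
      have hi : Integrable (fun w : mkt.Draw =>
          w.1 i * (1 - mkt.wins w.2 (mkt.shade s.1 w.1) i * mkt.Δ)) mkt.draw := by
        refine Integrable.of_bound hm.aestronglyMeasurable 1 ?_
        filter_upwards [mkt.ae_draw_mem] with w hw
        have h := cost_mem (hw i) w.2 (mkt.shade s.1 w.1) i
        rw [Real.norm_of_nonneg h.1]
        exact h.2
      refine ⟨fun w => costs s.2 i + w.1 i * (1 - mkt.wins w.2 (mkt.shade s.1 w.1) i * mkt.Δ),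
        (integrable_const _).add hi, ?_, ?_⟩
      · filter_upwards [hs3] with w hw
        filter_upwards [hw] with b hb
        have h1 : b = mkt.shade s.1 w.1 := by
          ext k
          rw [hb k (Set.mem_univ k), shade, shade, hs2 k]
        simp only [jointStep, costs_nextPast, h1]
        exact le_rfl
      · rw [integral_add (integrable_const _) hi,
          integral_cost_shade p.lo_pos (fun j => (hs j).1) i]
        simp [meanValuation]
    · refine (integral_add h1 h5).le.trans (le_of_eq ?_)
      have h6 : Measurable fun ν : Fin mkt.N → ℝ => meanValuation i - surplus ν (ν i) i
          - ν i * mkt.expenditure ν i := by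
        have := measurable_surplus (measurable_pi_apply i) i
        have := measurable_expenditure i
        fun_prop
      have h7 : Integrable (fun ν : Fin mkt.N → ℝ => meanValuation i - surplus ν (ν i) i)
          (idealLaw p t) := (integrable_const _).sub h2
      rw [integral_joint_fst h6, integral_sub h7 h3,
        integral_sub (integrable_const _) h2]
      simp
  have hsum : ∀ k ≤ n, ∫ s, costs s.2 i ∂joint p T (pacing mkt p) k
      ≤ ∑ t ∈ Finset.range k, (meanValuation i
      - ∫ ν, surplus ν (ν i) i ∂idealLaw p t
      - ∫ ν, ν i * mkt.expenditure ν i ∂idealLaw p t) := by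
    intro k
    induction k with
    | zero => simp [integral_costs_zero]
    | succ k ih =>
      intro hk
      rw [Finset.sum_range_succ]
      have := hstep k hk
      have := ih (Nat.le_of_succ_le hk)
      linarith
  have h := integral_costs_le_add (p := p) (T := T) (β := pacing mkt p) i n (T - n)
  rw [Nat.add_sub_cancel' hnT, Nat.cast_sub hnT] at h
  rw [totalCost_eq p]
  linarith [hsum n le_rfl]

/-- Weak duality: a lower bound for the cost of a deviation. -/
theorem le_totalCost (H : mkt.Regular p νlo νhi lam κ μs) {T : ℕ}
    {β : Fin mkt.N → Strategy} {i : Fin mkt.N} (hβ : ∀ j, j ≠ i → β j = pacing mkt p j)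
    (hε : p.eps * mkt.Δ ≤ p.lo ^ 2) {n : ℕ} (hnT : n ≤ T) (hn : ∀ t < n, t + slack p ≤ T)
    {S : ℝ} (hS : 0 < S) :
    ∑ t ∈ Finset.range n, (meanValuation i - ∫ ν, surplus ν (μs i) i ∂idealLaw p t
      - μs i * (mkt.Δ / p.lo ^ 2) * mkt.matchNorm i *
        (S / 2 + (∫ s, gapSq p i s ∂joint p T β t) / (2 * S)))
      - μs i * (mkt.ρ i * T) ≤ mkt.totalCost T β i := by
  set θ := μs i with hθ
  have hθ0 : 0 ≤ θ := p.lo_pos.le.trans (H.stat_Icc i).1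
  set A := θ * (mkt.Δ / p.lo ^ 2) * mkt.matchNorm i with hA
  -- The Lagrangian `costs + θ * spent` grows in each period by at least the dual value. Only at the
  -- end is the spending replaced by its bound `ρ i * T`.
  have hstep : ∀ t < n, ∫ s, costs s.2 i ∂joint p T β t + θ * ∫ s, spent s.2 i ∂joint p T β t
      + (meanValuation i - ∫ ν, surplus ν θ i ∂idealLaw p t
        - A * (S / 2 + (∫ s, gapSq p i s ∂joint p T β t) / (2 * S)))
      ≤ ∫ s, costs s.2 i ∂joint p T β (t + 1) + θ * ∫ s, spent s.2 i ∂joint p T β (t + 1) := by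
    intro t ht
    have c0 := integrable_joint_costs (p := p) (T := T) (β := β) (t := t) i
    have c1 := integrable_joint_costs (p := p) (T := T) (β := β) (t := t + 1) i
    have s0 := integrable_joint_spent (p := p) (T := T) (β := β) (t := t) i
    have s1 := integrable_joint_spent (p := p) (T := T) (β := β) (t := t + 1) i
    have g0 := integrable_gapSq (p := p) (T := T) (β := β) (t := t) i
    have u0 : Integrable (fun s : mkt.State t => surplus s.1 θ i) (joint p T β t) :=
      integrable_joint_fst (T := T) (β := β) (H.integrable_surplus_stat i t)
    have f1 : Integrable (fun s : mkt.State (t + 1) => -(costs s.2 i + θ * spent s.2 i))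
        (joint p T β (t + 1)) := (c1.add (s1.const_mul θ)).neg
    have f0 : Integrable (fun s : mkt.State t => costs s.2 i + θ * spent s.2 i)
        (joint p T β t) := c0.add (s0.const_mul θ)
    have u1 : Integrable (fun s : mkt.State t => surplus s.1 θ i - meanValuation i)
        (joint p T β t) := u0.sub (integrable_const _)
    have k0 : Integrable (fun s : mkt.State t => A * (S / 2 + gapSq p i s / (2 * S)))
        (joint p T β t) := ((integrable_const _).add (g0.div_const _)).const_mul A
    have k1 : Integrable (fun s : mkt.State t => surplus s.1 θ i - meanValuation i
        + A * (S / 2 + gapSq p i s / (2 * S))) (joint p T β t) := u1.add k0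
    have h := integral_joint_succ_le (F := fun s => -(costs s.2 i + θ * spent s.2 i))
      (H := fun s => surplus s.1 θ i - meanValuation i + A * (S / 2 + gapSq p i s / (2 * S))
        - (costs s.2 i + θ * spent s.2 i))
      (((measurable_state_costs i).add ((measurable_state_spent i).const_mul θ)).neg)
      f1 (k1.sub f0) (by
        filter_upwards [ae_joint_mem, ae_bids_shade (S := {j | j ≠ i})
          (fun j hj => hβ j hj) H.rate hε (hn t ht)] with s hs hs3
        -- The competing bid of `i` ignores coordinate `i`, so this coordinate may be chosen freely
        -- inside the box.
        set μ := Function.update (mult p s.2) i (s.1 i) with hμ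
        have hmem : ∀ j, p.lo ≤ μ j := by
          intro j
          rcases eq_or_ne j i with rfl | hj
          · simpa [hμ] using (hs j).1
          · simpa [hμ, Function.update_of_ne hj] using (mult_mem p t s.2 j).1
        have hi := integrable_surplus_integrand p.lo_pos hmem hθ0 i
        have hi2 : Integrable (fun w : mkt.Draw =>
            max (mkt.Δ * w.1 i - θ * mkt.competingBid w.2 (mkt.shade μ w.1) i) 0 - w.1 i)
            mkt.draw := hi.sub (integrable_valuation i)
        refine ⟨fun w =>
            max (mkt.Δ * w.1 i - θ * mkt.competingBid w.2 (mkt.shade μ w.1) i) 0 - w.1 i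
            - (costs s.2 i + θ * spent s.2 i), hi2.sub (integrable_const _), ?_, ?_⟩
        · filter_upwards [hs3] with w hw
          filter_upwards [hw] with b hb
          have hd : mkt.competingBid w.2 b i = mkt.competingBid w.2 (mkt.shade μ w.1) i :=
            competingBid_congr fun j hj => by
              rw [hb j hj, shade, shade, hμ, Function.update_of_ne hj]
          have h := valuation_sub_max_le w.2 b i (w.1 i) θ
          rw [hd] at h
          simp only [jointStep, costs_nextPast, spent_nextPast]
          linarith
        · rw [integral_sub hi2 (integrable_const _), integral_sub hi (integrable_valuation i)]
          have h1 := surplus_le_add p.lo_pos hmem (fun j => (hs j).1) hθ0 i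
          have h2 := sum_match_mul_le i fun j => |μ j - s.1 j|
          have h3 : ∑ j ∈ Finset.univ.erase i, |μ j - s.1 j| ^ 2 = gapSq p i s :=
            Finset.sum_congr rfl fun j hj => by
              rw [hμ, Function.update_of_ne (Finset.ne_of_mem_erase hj), sq_abs]
          rw [h3] at h2
          have hg : 0 ≤ gapSq p i s := Finset.sum_nonneg fun _ _ => sq_nonneg _
          -- The root is linearised at the free scale `S`, so that only the mean of `gapSq` is
          -- needed.
          have h4 : √(gapSq p i s) ≤ S / 2 + gapSq p i s / (2 * S) := by
            have h5 : S / 2 + √(gapSq p i s) ^ 2 / (2 * S) - √(gapSq p i s)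
                = (√(gapSq p i s) - S) ^ 2 / (2 * S) := by
              field_simp
              ring
            have h6 : 0 ≤ (√(gapSq p i s) - S) ^ 2 / (2 * S) := by positivity
            rw [Real.sq_sqrt hg] at h5
            linarith
          have h7 : θ * (mkt.Δ / p.lo ^ 2 *
              ∑ j ∈ Finset.univ.erase i, mkt.matchProb i j * |μ j - s.1 j|)
              ≤ A * (S / 2 + gapSq p i s / (2 * S)) := by
            have h8 := mul_le_mul_of_nonneg_left h4 (mkt.matchNorm_nonneg i)
            have h9 : 0 ≤ θ * (mkt.Δ / p.lo ^ 2) :=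
              mul_nonneg hθ0 (div_nonneg mkt.Δ_pos.le (sq_nonneg _))
            have h10 := mul_le_mul_of_nonneg_left (h2.trans h8) h9
            rw [hA]
            linarith
          unfold surplus at h1
          simp only [integral_const, probReal_univ, one_smul, meanValuation]
          unfold surplus
          linarith)
    rw [integral_neg, integral_add c1 (s1.const_mul θ), integral_const_mul,
      integral_sub k1 f0, integral_add c0 (s0.const_mul θ), integral_const_mul,
      integral_add u1 k0, integral_sub u0 (integrable_const _),
      integral_const_mul, integral_add (integrable_const _) (g0.div_const _),
      integral_div (2 * S), integral_joint_fst (measurable_surplus measurable_const i)] at h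
    simp only [integral_const, probReal_univ, one_smul] at h
    linarith
  have hsum : ∀ k ≤ n, ∑ t ∈ Finset.range k, (meanValuation i
      - ∫ ν, surplus ν θ i ∂idealLaw p t
      - A * (S / 2 + (∫ s, gapSq p i s ∂joint p T β t) / (2 * S)))
      ≤ ∫ s, costs s.2 i ∂joint p T β k + θ * ∫ s, spent s.2 i ∂joint p T β k := by
    intro k
    induction k with
    | zero => simp [integral_costs_zero, integral_spent_zero]
    | succ k ih =>
      intro hk
      rw [Finset.sum_range_succ]
      have := hstep k hk
      have := ih (Nat.le_of_succ_le hk)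
      linarith
  have h1 := integral_costs_mono (p := p) (T := T) (β := β) i hnT
  have h2 : ∫ s, spent s.2 i ∂joint p T β n ≤ mkt.ρ i * T := by
    have h := integral_mono_ae (integrable_joint_spent (p := p) (T := T) (β := β) (t := n) i)
      (integrable_const (mkt.ρ i * T))
      (by filter_upwards [ae_joint_bounds] with s hs using (hs i).1.2)
    simpa using h
  have h3 := mul_le_mul_of_nonneg_left h2 hθ0
  rw [totalCost_eq p]
  linarith [hsum n le_rfl]

theorem integral_surplus_gap_le (H : mkt.Regular p νlo νhi lam κ μs) (i : Fin mkt.N) (t : ℕ) :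
    ∫ ν, surplus ν (μs i) i ∂idealLaw p t - ∫ ν, surplus ν (ν i) i ∂idealLaw p t
      - ∫ ν, ν i * mkt.expenditure ν i ∂idealLaw p t + μs i * mkt.ρ i
      ≤ (∫ ν, (ν i - μs i) ^ 2 ∂idealLaw p t
          + payLip mkt.Δ p.lo p.hi νhi ^ 2 * mkt.matchNorm i ^ 2 *
          ∫ ν, ∑ j, (ν j - μs j) ^ 2 ∂idealLaw p t) / 2
        + ∫ ν, (ν i - p.lo) * (mkt.ρ i - mkt.expenditure ν i) ∂idealLaw p t
        + p.lo * ∫ ν, (mkt.ρ i - mkt.expenditure ν i) ∂idealLaw p t := by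
  have i1 := H.integrable_surplus_stat i t
  have i2 := integrable_surplus_self p i t
  have i3 := integrable_idealLaw_mul_expenditure (p := p) i t
  have i4 := integrable_idealLaw_sq (H.stat_Icc i) i t
  have i5 : Integrable (fun ν => ∑ j, (ν j - μs j) ^ 2) (idealLaw p t) :=
    integrable_finsetSum _ fun j _ => integrable_idealLaw_sq (H.stat_Icc j) j t
  have i6 := integrable_sub_lo_mul p i t
  have i7 : Integrable (fun ν => mkt.ρ i - mkt.expenditure ν i) (idealLaw p t) :=
    (integrable_const _).sub (integrable_idealLaw_expenditure i t)
  have j12 : Integrable (fun ν => surplus ν (μs i) i - surplus ν (ν i) i) (idealLaw p t) :=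
    i1.sub i2
  have j123 : Integrable (fun ν => surplus ν (μs i) i - surplus ν (ν i) i
    - ν i * mkt.expenditure ν i) (idealLaw p t) := j12.sub i3
  have j45 : Integrable (fun ν => (ν i - μs i) ^ 2 + payLip mkt.Δ p.lo p.hi νhi ^ 2 *
      mkt.matchNorm i ^ 2 * ∑ j, (ν j - μs j) ^ 2) (idealLaw p t) := i4.add (i5.const_mul _)
  have j456 : Integrable (fun ν => ((ν i - μs i) ^ 2 + payLip mkt.Δ p.lo p.hi νhi ^ 2 *
      mkt.matchNorm i ^ 2 * ∑ j, (ν j - μs j) ^ 2) / 2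
      + (ν i - p.lo) * (mkt.ρ i - mkt.expenditure ν i)) (idealLaw p t) := (j45.div_const 2).add i6
  have h := integral_mono_ae (j123.add (integrable_const (μs i * mkt.ρ i)))
    (j456.add (i7.const_mul p.lo)) (by
      filter_upwards [ae_idealLaw_mem] with ν hν using H.surplus_gap_le hν i)
  rw [integral_add' j123 (integrable_const _), integral_add' j456 (i7.const_mul _),
    integral_sub j12 i3, integral_sub i1 i2, integral_add (j45.div_const 2) i6, integral_div,
    integral_add i4 (i5.const_mul _), integral_const_mul, integral_const_mul] at h
  rw [← integral_const_mul p.lo]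
  simpa using h

end Regular

end Market

end Pacing

/-! ### The regret bound with uniform constants. -/

namespace Pacing

namespace Market

variable {mkt : Market} {p : Params mkt.N}

theorem slack_nonneg (p : Params mkt.N) : 0 ≤ slack p := by
  have h1 := p.lo_pos
  have h2 := p.lo_lt_hi
  have h3 := p.eps_pos
  have h4 := mkt.Δ_pos
  have h5 : 0 ≤ p.hi - p.lo := by linarith
  have h6 : 0 < p.hi := by linarith
  unfold slack
  positivity

namespace Regular

variable {νlo νhi lam κ : ℝ} {μs : Fin mkt.N → ℝ}

/-- The regret of adaptive pacing against a deviation `β` of agent `i`, in terms of the distances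
of the multipliers to the stationary and to the unconstrained profile. -/
theorem regret_le (H : mkt.Regular p νlo νhi lam κ μs) {T : ℕ}
    {β : Fin mkt.N → Strategy} {i : Fin mkt.N} (hβ : ∀ j, j ≠ i → β j = pacing mkt p j)
    (hε : p.eps * mkt.Δ ≤ p.lo ^ 2) {n : ℕ} (hnT : n ≤ T) (hn : ∀ t < n, t + slack p ≤ T)
    {S : ℝ} (hS : 0 < S) :
    mkt.totalCost T (pacing mkt p) i - mkt.totalCost T β i
      ≤ (T - n) * (1 + μs i * mkt.ρ i)
        + (∑ t ∈ Finset.range n, ∫ ν, (ν i - μs i) ^ 2 ∂idealLaw p t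
          + payLip mkt.Δ p.lo p.hi νhi ^ 2 * (mkt.matchNorm i ^ 2 *
          ∑ t ∈ Finset.range n, ∫ ν, ∑ j, (ν j - μs j) ^ 2 ∂idealLaw p t)) / 2
        + ∑ t ∈ Finset.range n,
          ∫ ν, (ν i - p.lo) * (mkt.ρ i - mkt.expenditure ν i) ∂idealLaw p t
        + p.lo * ∑ t ∈ Finset.range n, ∫ ν, (mkt.ρ i - mkt.expenditure ν i) ∂idealLaw p t
        + μs i * (mkt.Δ / p.lo ^ 2) * mkt.matchNorm i * (n * (S / 2)
          + (∑ t ∈ Finset.range n, ∫ s, gapSq p i s ∂joint p T β t) / (2 * S)) := by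
  have h1 := H.totalCost_pacing_le hε i hnT hn
  have h2 := H.le_totalCost hβ hε hnT hn hS
  have h3 : ∑ t ∈ Finset.range n, (∫ ν, surplus ν (μs i) i ∂idealLaw p t
      - ∫ ν, surplus ν (ν i) i ∂idealLaw p t
      - ∫ ν, ν i * mkt.expenditure ν i ∂idealLaw p t + μs i * mkt.ρ i)
      ≤ ∑ t ∈ Finset.range n, ((∫ ν, (ν i - μs i) ^ 2 ∂idealLaw p t
          + payLip mkt.Δ p.lo p.hi νhi ^ 2 * mkt.matchNorm i ^ 2 *
          ∫ ν, ∑ j, (ν j - μs j) ^ 2 ∂idealLaw p t) / 2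
        + ∫ ν, (ν i - p.lo) * (mkt.ρ i - mkt.expenditure ν i) ∂idealLaw p t
        + p.lo * ∫ ν, (mkt.ρ i - mkt.expenditure ν i) ∂idealLaw p t) :=
    Finset.sum_le_sum fun t _ => H.integral_surplus_gap_le i t
  simp only [Finset.sum_add_distrib, Finset.sum_sub_distrib, ← Finset.mul_sum, ← Finset.sum_div,
    Finset.sum_const, Finset.card_range, nsmul_eq_mul] at h1 h2 h3
  linarith

end Regular

set_option maxHeartbeats 1000000 in
/-- The regret bound with constants that depend only on the parameters of the class of markets:
the regret is small up to the unspent budget, and the unspent budget is controlled with and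
without a margin between the stationary multiplier and the lower bound. -/
theorem exists_regret_bound (Δ lo hi νlo νhi lam κ : ℝ) :
    ∃ C : ℝ, 0 ≤ C ∧ ∀ (mkt : Market) (p : Params mkt.N) (μs : Fin mkt.N → ℝ) (T : ℕ),
      mkt.Δ = Δ → p.lo = lo → p.hi = hi → mkt.Regular p νlo νhi lam κ μs → 0 < T →
      p.eps * Δ ≤ lo ^ 2 → ∀ (i : Fin mkt.N) (β : Strategy), ∃ U : ℝ,
        1 / (T : ℝ) * (mkt.totalCost T (pacing mkt p) i
          - mkt.totalCost T (Function.update (pacing mkt p) i β) i)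
          ≤ C * (1 / (p.eps * T) + p.eps + 1 / T + mkt.matchNorm i ^ 2) + lo * U ∧
        (∀ ω : ℝ, 0 < ω → U ≤ C * (ω + (1 / (p.eps * T) + p.eps) / ω)) ∧
        (∀ η : ℝ, 0 < η → lo + η ≤ μs i → p.eps * (Δ / lo) ≤ η / 2 →
          U ≤ C * (1 + 1 / η ^ 2) * (1 / (p.eps * T) + p.eps)) := by
  -- The constant must be chosen before any market is given. If the parameters violate these signs,
  -- no market is admissible and `0` works.
  by_cases hpar : 0 < Δ ∧ 0 < lo ∧ lo < hi ∧ 0 ≤ νhi ∧ 0 < lam ∧ 0 ≤ κ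
  swap
  · refine ⟨0, le_rfl, fun mkt p μs T hΔ hlo hhi H => absurd ?_ hpar⟩
    exact ⟨hΔ ▸ mkt.Δ_pos, hlo ▸ p.lo_pos, hlo ▸ hhi ▸ p.lo_lt_hi, H.dens.nonneg H.νlo_pos,
      H.lam_pos, H.κ_nonneg⟩
  obtain ⟨hΔ, hlo, hlh, hνhi, hlam, hκ⟩ := hpar
  have hhi : 0 < hi := hlo.trans hlh
  obtain ⟨δ, hδ⟩ : ∃ δ, δ = hi - lo := ⟨_, rfl⟩
  have hδ0 : 0 < δ := by rw [hδ]; linarith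
  obtain ⟨B, hB⟩ : ∃ B, B = Δ / lo := ⟨_, rfl⟩
  have hB0 : 0 < B := by rw [hB]; positivity
  obtain ⟨L, hL⟩ : ∃ L, L = payLip Δ lo hi νhi := ⟨_, rfl⟩
  have hL0 : 0 ≤ L := by rw [hL]; exact payLip_nonneg hΔ.le hlo hhi.le hνhi
  obtain ⟨c0, hc0⟩ : ∃ c0, c0 = 2 * B + B * L * (1 + κ) := ⟨_, rfl⟩
  obtain ⟨c1, hc1⟩ : ∃ c1, c1 = κ ^ 2 * (δ ^ 2 + B ^ 2) / (2 * lam) := ⟨_, rfl⟩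
  obtain ⟨c2, hc2⟩ : ∃ c2, c2 = (δ ^ 2 + L ^ 2 / lam * c1 + B ^ 2) / lam := ⟨_, rfl⟩
  obtain ⟨c3, hc3⟩ : ∃ c3, c3 = (δ ^ 2 + B ^ 2) / 2 := ⟨_, rfl⟩
  obtain ⟨c4, hc4⟩ : ∃ c4, c4 = (c0 ^ 2 / (4 * lam) + B ^ 2 * κ) / lam := ⟨_, rfl⟩
  obtain ⟨c5, hc5⟩ : ∃ c5, c5 = hi / Δ * δ + hi / lo + 1 := ⟨_, rfl⟩
  have p0 : 0 ≤ c0 := by rw [hc0]; positivity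
  have p1 : 0 ≤ c1 := by rw [hc1]; positivity
  have p2 : 0 ≤ c2 := by rw [hc2]; positivity
  have p3 : 0 ≤ c3 := by rw [hc3]; positivity
  have p4 : 0 ≤ c4 := by rw [hc4]; positivity
  have p5 : 0 ≤ c5 := by rw [hc5]; positivity
  obtain ⟨K, hK⟩ : ∃ K, K = c5 * (1 + hi * B) + (c2 + L ^ 2 * c1) / 2 + c3
    + hi * (Δ / lo ^ 2) * ((1 + c4) / 2 * (2 + κ)) := ⟨_, rfl⟩
  have hK0 : 0 ≤ K := by rw [hK]; positivity
  obtain ⟨C, hC⟩ : ∃ C, C = K + L * (1 + c2 + c1) + δ + 4 * B * c2 := ⟨_, rfl⟩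
  have hC0 : 0 ≤ C := by rw [hC]; positivity
  refine ⟨C, hC0, fun mkt p μs T eΔ elo ehi H hT hε i β => ?_⟩
  have hβ : ∀ j, j ≠ i → Function.update (pacing mkt p) i β j = pacing mkt p j := fun j hj =>
    Function.update_of_ne hj _ _
  have hε' : p.eps * mkt.Δ ≤ p.lo ^ 2 := by rw [eΔ, elo]; exact hε
  -- Subtraction is truncated: for short horizons `n = 0`, all periods count as final, and `T - n ≤
  -- slack p + 1` still holds.
  set n := T - ⌈slack p⌉₊ with hn
  have hnT : n ≤ T := Nat.sub_le _ _
  have hnt : ∀ t < n, (t : ℝ) + slack p ≤ T := by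
    intro t ht
    have h1 : t + ⌈slack p⌉₊ ≤ T := by omega
    have h2 : (t : ℝ) + ⌈slack p⌉₊ ≤ T := by exact_mod_cast h1
    linarith [Nat.le_ceil (slack p)]
  have hTn : (T : ℝ) - n ≤ slack p + 1 := by
    have h1 : T ≤ n + ⌈slack p⌉₊ := by omega
    have h2 : (T : ℝ) ≤ n + ⌈slack p⌉₊ := by exact_mod_cast h1
    linarith [Nat.ceil_lt_add_one (slack_nonneg p)]
  have hT0 : (0 : ℝ) < T := by exact_mod_cast hT
  have hnT' : (n : ℝ) ≤ T := by exact_mod_cast hnT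
  have hn0 : (0 : ℝ) ≤ n := Nat.cast_nonneg _
  have hε0 := p.eps_pos
  have hρ := H.ρ_le i
  have hρ0 := mkt.ρ_pos i
  have hμ := H.stat_Icc i
  have ha0 := mkt.matchNorm_nonneg i
  have haκ := H.matching i
  have b1 := H.sum_dist_sq_le n
  have b2 := H.sum_coord_sq_le i n
  have b3 := H.sum_gapSq_le hβ hε' hnt
  have b4 := H.sum_slackness_le i n
  have b5 := fun (η : ℝ) (hη : 0 < η) hηi hηε =>
    H.sum_underspend_le (i := i) hη hηi hηε n
  have b6 : ∀ ω : ℝ, 0 < ω → _ := fun ω hω =>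
    Finset.sum_le_sum fun t (_ : t ∈ Finset.range n) => H.integral_underspend_le i hω t
  obtain ⟨a, ea⟩ : ∃ a, a = mkt.matchNorm i := ⟨_, rfl⟩
  obtain ⟨ε, eε⟩ : ∃ ε, ε = p.eps := ⟨_, rfl⟩
  obtain ⟨r, er⟩ : ∃ r, r = √(mkt.N : ℝ) := ⟨_, rfl⟩
  have hr0 : 0 ≤ r := er ▸ Real.sqrt_nonneg _
  have hr2 : (mkt.N : ℝ) = r ^ 2 := by rw [er, Real.sq_sqrt (Nat.cast_nonneg _)]
  have hslack : slack p = hi / Δ * (δ / ε + B) := by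
    unfold slack
    rw [ehi, elo, eΔ, ← eε, hδ, hB]
  rw [hslack] at hTn
  rw [← ea] at ha0 haκ b2 b3
  rw [← er] at haκ b3
  simp only [← ea, eΔ, elo, ehi, ← eε, ← hB, ← hδ, ← hL] at b2 b3 b4 b5 b6 b1 hρ hμ hε0
  rw [hr2] at b1
  -- This is the order of the root mean square gap caused by the deviation. The summand `√ε` makes
  -- `S` positive and gives `ε ≤ S ^ 2`.
  obtain ⟨S, hS⟩ : ∃ S, S = a + ε * r + √ε := ⟨_, rfl⟩
  have hsε : 0 < √ε := Real.sqrt_pos.2 hε0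
  have hsε2 : √ε ^ 2 = ε := Real.sq_sqrt hε0.le
  have hS0 : 0 < S := by rw [hS]; positivity
  have b7 := H.regret_le hβ hε' hnT hnt hS0
  simp only [← ea, eΔ, elo, ehi, ← hL] at b7
  simp only [Finset.sum_add_distrib, ← Finset.mul_sum, ← Finset.sum_div,
    Finset.sum_const, Finset.card_range, nsmul_eq_mul] at b6
  rw [← ea, ← eε]
  generalize mkt.totalCost T (pacing mkt p) i
    - mkt.totalCost T (Function.update (pacing mkt p) i β) i = reg at b7 ⊢
  have e0 : 0 ≤ ∑ t ∈ Finset.range n, ∫ ν, ∑ j, (ν j - μs j) ^ 2 ∂idealLaw p t :=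
    Finset.sum_nonneg fun t _ => integral_nonneg fun ν => Finset.sum_nonneg fun _ _ => sq_nonneg _
  generalize ∑ t ∈ Finset.range n, ∫ ν, ∑ j, (ν j - μs j) ^ 2 ∂idealLaw p t = E at *
  generalize ∑ t ∈ Finset.range n, ∫ ν, (ν i - μs i) ^ 2 ∂idealLaw p t = F at *
  generalize ∑ t ∈ Finset.range n,
    ∫ s, gapSq p i s ∂joint p T (Function.update (pacing mkt p) i β) t = Q at *
  generalize ∑ t ∈ Finset.range n,
    ∫ ν, (ν i - lo) * (mkt.ρ i - mkt.expenditure ν i) ∂idealLaw p t = G at *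
  generalize ∑ t ∈ Finset.range n,
    ∫ ν, (mkt.ρ i - mkt.expenditure ν i) ∂idealLaw p t = V at *
  clear_value n
  clear H hβ hε' hnt hslack hn
  -- The common order of the summed errors: `1 / ε` from the initial distance and `T * ε` from the
  -- noise.
  obtain ⟨R, hR⟩ : ∃ R, R = 1 / ε + T * ε := ⟨_, rfl⟩
  have hR0 : 0 < R := by rw [hR]; positivity
  have hR1 : 1 / ε ≤ R := by rw [hR]; linarith only [mul_pos hT0 hε0]
  have hR2 : T * ε ≤ R := by rw [hR]; linarith only [one_div_pos.2 hε0]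
  have hRε : ε * R = 1 + T * ε ^ 2 := by
    rw [hR]
    field_simp
  have hRT : 1 / (ε * T) + ε = R / T := by
    rw [hR]
    field_simp
  -- This cancels the factor `N = r ^ 2` in the total squared distance.
  have har : a ^ 2 * r ^ 2 ≤ κ ^ 2 := by
    have h := pow_le_pow_left₀ (mul_nonneg hr0 ha0) haκ 2
    linarith only [h, mul_pow r a 2]
  have hnε : (n : ℝ) * ε ^ 2 ≤ T * ε ^ 2 := by gcongr
  -- The drift sums share the shape of an initial value plus accumulated noise, and `ε * R = 1 + T *
  -- ε ^ 2` dominates both parts.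
  have aux : ∀ x y : ℝ, 0 ≤ x → 0 ≤ y → x + n * (ε ^ 2 * y) ≤ ε * ((x + y) * R) := by
    intro x y hx hy
    have h1 : ε * ((x + y) * R) = (x + y) * (1 + T * ε ^ 2) := by rw [← hRε]; ring
    rw [h1]
    linarith only [mul_le_mul_of_nonneg_right hnε hy, hy,
      mul_nonneg hx (by positivity : 0 ≤ T * ε ^ 2)]
  have d1 : a ^ 2 * E ≤ c1 * R := by
    have h1 := aux (δ ^ 2) (B ^ 2) (sq_nonneg _) (sq_nonneg _)
    have h2 : 2 * lam * ε * (a ^ 2 * E) ≤ κ ^ 2 * (ε * ((δ ^ 2 + B ^ 2) * R)) := by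
      calc 2 * lam * ε * (a ^ 2 * E) = a ^ 2 * (2 * lam * ε * E) := by ring
        _ ≤ a ^ 2 * (r ^ 2 * δ ^ 2 + n * (ε ^ 2 * (r ^ 2 * B ^ 2))) := by gcongr
        _ = a ^ 2 * r ^ 2 * (δ ^ 2 + n * (ε ^ 2 * B ^ 2)) := by ring
        _ ≤ κ ^ 2 * (ε * ((δ ^ 2 + B ^ 2) * R)) := by gcongr
    have h3 : 2 * lam * ε * (c1 * R) = κ ^ 2 * (ε * ((δ ^ 2 + B ^ 2) * R)) := by
      rw [hc1]
      field_simp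
    rw [← h3] at h2
    exact le_of_mul_le_mul_left h2 (by positivity)
  have d2 : F ≤ c2 * R := by
    have h1 := aux (δ ^ 2) (B ^ 2) (sq_nonneg _) (sq_nonneg _)
    have h2 : lam * ε * F ≤ ε * ((δ ^ 2 + B ^ 2) * R) + ε * (L ^ 2 / lam * (c1 * R)) := by
      have h3 : L ^ 2 * a ^ 2 / lam * E = L ^ 2 / lam * (a ^ 2 * E) := by ring
      have h4 : L ^ 2 / lam * (a ^ 2 * E) ≤ L ^ 2 / lam * (c1 * R) := by gcongr
      rw [h3] at b2
      linarith only [b2, h1, mul_le_mul_of_nonneg_left h4 hε0.le]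
    have h3 : lam * ε * (c2 * R)
        = ε * ((δ ^ 2 + B ^ 2) * R) + ε * (L ^ 2 / lam * (c1 * R)) := by
      rw [hc2]
      field_simp
      ring
    rw [← h3] at h2
    exact le_of_mul_le_mul_left h2 (by positivity)
  have d3 : G ≤ c3 * R := by
    have h1 := aux (δ ^ 2) (B ^ 2) (sq_nonneg _) (sq_nonneg _)
    have h3 : 2 * ε * (c3 * R) = ε * ((δ ^ 2 + B ^ 2) * R) := by
      rw [hc3]
      ring
    have h2 := b4.trans h1
    rw [← h3] at h2
    exact le_of_mul_le_mul_left h2 (by positivity)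
  have hεS : ε ≤ S ^ 2 := by
    rw [← hsε2]
    refine pow_le_pow_left₀ hsε.le ?_ 2
    rw [hS]
    linarith only [mul_nonneg hε0.le hr0, ha0]
  have d4 : Q ≤ c4 * (T * S ^ 2) := by
    have h1 : 2 * B * a + ε * r * (B * L * (1 + κ)) ≤ c0 * S := by
      rw [hc0, hS]
      have h2 : 0 ≤ B * L * (1 + κ) := by positivity
      have h3 := mul_nonneg hε0.le hr0
      linarith only [mul_nonneg hB0.le h3, mul_nonneg h2 ha0, mul_nonneg hB0.le hsε.le,
        mul_nonneg h2 hsε.le]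
    have h0 : 0 ≤ 2 * B * a + ε * r * (B * L * (1 + κ)) := by positivity
    have h2 : (2 * B * a + ε * r * (B * L * (1 + κ))) ^ 2 ≤ (c0 * S) ^ 2 :=
      pow_le_pow_left₀ h0 h1 2
    have h3 : lam * ε * Q ≤ T * (ε * ((c0 * S) ^ 2 / (4 * lam)) + ε * S ^ 2 * (B ^ 2 * κ)) := by
      refine b3.trans ?_
      have h4 : ε ^ 2 ≤ ε * S ^ 2 := by
        rw [sq ε]
        gcongr
      gcongr
    have h4 : lam * ε * (c4 * (T * S ^ 2))
        = T * (ε * ((c0 * S) ^ 2 / (4 * lam)) + ε * S ^ 2 * (B ^ 2 * κ)) := by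
      rw [hc4]
      field_simp
    rw [← h4] at h3
    exact le_of_mul_le_mul_left h3 (by positivity)
  have d5 : (T : ℝ) - n ≤ c5 * (R + 1) := by
    refine hTn.trans ?_
    have h1 : hi / Δ * (δ / ε + B) = hi / Δ * δ * (1 / ε) + hi / lo := by
      rw [hB]
      field_simp
    rw [h1, hc5]
    have h2 : 0 ≤ hi / Δ * δ := by positivity
    have h3 : 0 ≤ hi / lo := by positivity
    linarith only [mul_le_mul_of_nonneg_left hR1 h2, mul_nonneg h3 hR0.le, h2, h3, hR0]
  obtain ⟨P, hP⟩ : ∃ P, P = R + 1 + T * a ^ 2 := ⟨_, rfl⟩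
  have hTa : 0 ≤ T * a ^ 2 := by positivity
  have hRP : R ≤ P := by rw [hP]; linarith only [hTa]
  have hR1P : R + 1 ≤ P := by rw [hP]; linarith only [hTa]
  have d6 : hi * (Δ / lo ^ 2) * a * (T * (S / 2) + c4 * (T * S ^ 2) / (2 * S))
      ≤ hi * (Δ / lo ^ 2) * ((1 + c4) / 2 * (2 + κ)) * P := by
    -- Here `a * r ≤ κ` removes the dependence on `N`, and `a * √ε` is split by the inequality of
    -- means.
    have h1 : a * S ≤ (2 + κ) * (a ^ 2 + ε) := by
      rw [hS]
      linarith only [sq_nonneg (a - √ε), mul_le_mul_of_nonneg_left haκ hε0.le,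
        mul_nonneg hκ (sq_nonneg a), sq_nonneg a, hε0, hsε2]
    have h2 : hi * (Δ / lo ^ 2) * a * (T * (S / 2) + c4 * (T * S ^ 2) / (2 * S))
        = hi * (Δ / lo ^ 2) * ((1 + c4) / 2) * (T * (a * S)) := by
      field_simp
    have h3 : T * (a * S) ≤ (2 + κ) * P := by
      have h4 : (T : ℝ) * (a ^ 2 + ε) ≤ P := by rw [hP]; linarith only [hR2]
      calc T * (a * S) ≤ T * ((2 + κ) * (a ^ 2 + ε)) := by gcongr
        _ = (2 + κ) * (T * (a ^ 2 + ε)) := by ring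
        _ ≤ (2 + κ) * P := by gcongr
    rw [h2]
    calc _ ≤ hi * (Δ / lo ^ 2) * ((1 + c4) / 2) * ((2 + κ) * P) := by gcongr
      _ = _ := by ring
  have hμ0 : 0 ≤ μs i := hlo.le.trans hμ.1
  have hreg : reg ≤ K * P + lo * V := by
    have h1 : (T - n) * (1 + μs i * mkt.ρ i) ≤ c5 * (1 + hi * B) * P := by
      have h2 : μs i * mkt.ρ i ≤ hi * B := mul_le_mul hμ.2 hρ hρ0.le hhi.le
      calc (T - n) * (1 + μs i * mkt.ρ i) ≤ (c5 * (R + 1)) * (1 + hi * B) := by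
            gcongr
        _ = c5 * (1 + hi * B) * (R + 1) := by ring
        _ ≤ c5 * (1 + hi * B) * P := by gcongr
    have h2 : (F + L ^ 2 * (a ^ 2 * E)) / 2 ≤ (c2 + L ^ 2 * c1) / 2 * P := by
      have h3 : L ^ 2 * (a ^ 2 * E) ≤ L ^ 2 * (c1 * P) := by
        exact mul_le_mul_of_nonneg_left (d1.trans (by gcongr)) (sq_nonneg L)
      have h4 : F ≤ c2 * P := d2.trans (by gcongr)
      linarith only [h3, h4]
    have h3 : G ≤ c3 * P := d3.trans (by gcongr)
    have h4 : μs i * (Δ / lo ^ 2) * a * (n * (S / 2) + Q / (2 * S))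
        ≤ hi * (Δ / lo ^ 2) * ((1 + c4) / 2 * (2 + κ)) * P := by
      refine le_trans ?_ d6
      have h6 : (n : ℝ) * (S / 2) + Q / (2 * S) ≤ T * (S / 2) + c4 * (T * S ^ 2) / (2 * S) := by
        gcongr
      have h7 : 0 ≤ T * (S / 2) + c4 * (T * S ^ 2) / (2 * S) := by positivity
      have h8 : μs i * (Δ / lo ^ 2) * a ≤ hi * (Δ / lo ^ 2) * a := by
        gcongr
        exact hμ.2
      exact (mul_le_mul_of_nonneg_left h6 (by positivity)).trans
        (mul_le_mul_of_nonneg_right h8 h7)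
    rw [hK]
    linarith only [b7, h1, h2, h3, h4]
  -- The witness is the expected unspent budget of the unconstrained dynamics over the first `n`
  -- periods, divided by `T`.
  refine ⟨V / T, ?_, fun ω hω => ?_, fun η hη hηi hηε => ?_⟩
  · have h1 : 1 / (ε * T) + ε + 1 / T + a ^ 2 = P / T := by
      rw [hRT, hP]
      field_simp
    rw [h1]
    have h2 : K * P ≤ C * P := by
      have : K ≤ C := by
        rw [hC]
        have h3 : 0 ≤ L * (1 + c2 + c1) := by positivity
        have h4 : 0 ≤ 4 * B * c2 := by positivity
        linarith only [h3, h4, hδ0]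
      exact mul_le_mul_of_nonneg_right this (hR0.le.trans hRP)
    calc 1 / (T : ℝ) * reg ≤ 1 / T * (C * P + lo * V) := by
          gcongr
          linarith only [hreg, h2]
      _ = _ := by ring
  · rw [hRT, div_le_iff₀ hT0]
    have h1 : C * (ω + R / T / ω) * T = C * (T * ω + R / ω) := by
      field_simp
    rw [h1]
    refine (b6 ω hω).trans ?_
    have h2 : (n : ℝ) * ω ≤ T * ω := by gcongr
    have h3 : (F + a ^ 2 * E) / (2 * ω) ≤ (c2 + c1) * (R / ω) := by
      rw [div_le_iff₀ (by positivity)]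
      have : (c2 + c1) * (R / ω) * (2 * ω) = 2 * ((c2 + c1) * R) := by
        field_simp
      rw [this]
      linarith only [d1, d2, mul_nonneg (add_nonneg p2 p1) hR0.le]
    have h4 : 0 ≤ T * ω := by positivity
    have h5 : 0 ≤ R / ω := by positivity
    calc L * (n * ω + (F + a ^ 2 * E) / (2 * ω)) ≤ L * (T * ω + (c2 + c1) * (R / ω)) := by gcongr
      _ ≤ L * ((1 + c2 + c1) * (T * ω + R / ω)) := by
          gcongr
          linarith only [mul_nonneg (add_nonneg p2 p1) h4, h5]
      _ = L * (1 + c2 + c1) * (T * ω + R / ω) := by ring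
      _ ≤ C * (T * ω + R / ω) := by
          gcongr
          rw [hC]
          have h6 : 0 ≤ 4 * B * c2 := by positivity
          linarith only [h6, hK0, hδ0]
  · rw [hRT, div_le_iff₀ hT0]
    have h1 : C * (1 + 1 / η ^ 2) * (R / T) * T = C * (1 + 1 / η ^ 2) * R := by
      field_simp
    rw [h1]
    have h2 := b5 η hη hηi (by rw [hB]; exact hηε)
    have h3 : ε * (B * (4 / η ^ 2)) * F ≤ ε * (B * (4 / η ^ 2)) * (c2 * R) := by gcongr
    have h4 : V ≤ δ * (1 / ε) + B * (4 / η ^ 2) * (c2 * R) := by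
      have h5 : ε * (δ * (1 / ε) + B * (4 / η ^ 2) * (c2 * R))
          = δ + ε * (B * (4 / η ^ 2)) * (c2 * R) := by
        field_simp
      exact le_of_mul_le_mul_left (by rw [h5]; linarith only [h2, h3]) hε0
    have h5 : 0 ≤ 1 / η ^ 2 := by positivity
    calc V ≤ δ * R + B * (4 / η ^ 2) * (c2 * R) := by
          refine h4.trans ?_
          gcongr
      _ = (δ + 4 * B * c2 * (1 / η ^ 2)) * R := by ring
      _ ≤ C * (1 + 1 / η ^ 2) * R := by
          gcongr
          have h6 : δ ≤ C := by
            rw [hC]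
            have h8 : 0 ≤ L * (1 + c2 + c1) := by positivity
            have h9 : 0 ≤ 4 * B * c2 := by positivity
            linarith only [hK0, h8, h9]
          have h7 : 4 * B * c2 ≤ C := by
            rw [hC]
            have h8 : 0 ≤ L * (1 + c2 + c1) := by positivity
            linarith only [hK0, h8, hδ0]
          linarith only [mul_le_mul_of_nonneg_right h7 h5, h6]

end Market

end Pacing

/-! ### Conclusion: comparison with the stated rate, and the limit. -/

namespace Pacing

namespace Market

theorem regret_le_one (mkt : Market) (p : Params mkt.N) {T : ℕ} (hT : 0 < T) (i : Fin mkt.N)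
    (β : Strategy) :
    1 / (T : ℝ) * (mkt.totalCost T (pacing mkt p) i
      - mkt.totalCost T (Function.update (pacing mkt p) i β) i) ≤ 1 := by
  have hT0 : (0 : ℝ) < T := by exact_mod_cast hT
  have h1 := totalCost_le p T (pacing mkt p) i
  have h2 := totalCost_nonneg p T (Function.update (pacing mkt p) i β) i
  rw [one_div_mul_eq_div, div_le_one hT0]
  linarith

end Market

/-- The error terms of the regret bound are dominated by the rate of the theorem as soon as
`√N ‖a_i‖` is bounded below. -/
theorem error_le_rate {a s ε t h : ℝ} (ha : 0 ≤ a) (hs : 0 ≤ s) (hε : 0 < ε) (ht : 0 < t)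
    (hh : 0 ≤ h) (hsa : 1 ≤ h * (s * a)) :
    1 / (ε * t) + ε + 1 / t + a ^ 2
        ≤ (1 + h) * (a * (s * (ε + 1 / (ε * t)) + a) + (1 + ε) / (ε * t)) ∧
      ε ≤ (1 + h) * (a * (s * (ε + 1 / (ε * t)) + a) + (1 + ε) / (ε * t)) := by
  have e1 : (1 + ε) / (ε * t) = 1 / (ε * t) + 1 / t := by field_simp
  have h1 : 0 < 1 / (ε * t) := by positivity
  have h2 : 0 < 1 / t := by positivity
  have h3 : 0 ≤ s * a := by positivity
  have h4 := mul_le_mul_of_nonneg_right hsa hε.le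
  rw [e1]
  generalize 1 / (ε * t) = τ at *
  generalize 1 / t = u at *
  have h5 : 0 ≤ a * s * ε := by positivity
  have h6 : 0 ≤ a * s * τ := by positivity
  have h7 := mul_nonneg hh h6
  have h8 := mul_nonneg hh h1.le
  have h9 := mul_nonneg hh h2.le
  have h10 := mul_nonneg hh (sq_nonneg a)
  have h11 := sq_nonneg a
  constructor <;> linarith only [h1, h2, h4, h5, h6, h7, h8, h9, h10, h11]

end Pacing

theorem theoremB3 (Δ μlo μhi νlo νhi lam κ : ℝ)
    (hμlo : 0 < μlo) (hνlo : 0 < νlo) (hlam : 0 < lam) :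
    (∀ η : ℝ, 0 < η → ∃ C : ℝ, 0 ≤ C ∧
      ∀ (mkt : Pacing.Market) (p : Pacing.Params mkt.N) (T : ℕ),
        mkt.Δ = Δ → p.lo = μlo → p.hi = μhi → 0 < T →
        mkt.HasDensities νlo νhi →
        mkt.StronglyMonotone lam μlo μhi →
        (∃ μs : Fin mkt.N → ℝ, mkt.IsStationary μs ∧ ∀ i, μlo + η ≤ μs i ∧ μs i < μhi) →
        (∀ i, Δ / μhi ≤ mkt.ρ i) →
        (∀ i, Real.sqrt mkt.N * mkt.matchNorm i ≤ κ) →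
        ∀ (i : Fin mkt.N) (β : Pacing.Strategy),
          1 / (T : ℝ) * (mkt.totalCost T (Pacing.pacing mkt p) i
              - mkt.totalCost T (Function.update (Pacing.pacing mkt p) i β) i)
            ≤ C * (mkt.matchNorm i *
                (Real.sqrt mkt.N * (p.eps + 1 / (p.eps * T)) + mkt.matchNorm i)
                + (1 + p.eps) / (p.eps * T))) ∧
    (∀ (mkt : ℕ → Pacing.Market) (p : ∀ n, Pacing.Params (mkt n).N) (T : ℕ → ℕ) (r : ℝ),
        (∀ n, (mkt n).Δ = Δ) → (∀ n, (p n).lo = μlo) → (∀ n, (p n).hi = μhi) →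
        (∀ n, (mkt n).HasDensities νlo νhi) →
        (∀ n, (mkt n).StronglyMonotone lam μlo μhi) →
        (∀ n, ∃ μs : Fin (mkt n).N → ℝ, (mkt n).IsStationary μs ∧
          ∀ i, μs i ∈ Set.Ioo μlo μhi) →
        (∀ n i, Δ / μhi ≤ (mkt n).ρ i) →
        Tendsto T atTop atTop →
        Tendsto (fun n => (mkt n).N) atTop atTop →
        Tendsto (fun n => (mkt n).M) atTop atTop →
        Tendsto (fun n => (p n).eps) atTop (𝓝 0) →
        Tendsto (fun n => (T n : ℝ) * (p n).eps) atTop atTop →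
        (∀ n, ((mkt n).M * (mkt n).γ : ℝ) / (mkt n).N = r) →
        (∀ n i, Real.sqrt (mkt n).N * (mkt n).matchNorm i ≤ κ) →
        Tendsto (fun n => ⨆ i, (mkt n).matchNorm i) atTop (𝓝 0) →
        ∀ i : ∀ n, Fin (mkt n).N,
          Tendsto (fun n => 1 / (T n : ℝ) *
            ((mkt n).totalCost (T n) (Pacing.pacing (mkt n) (p n)) (i n)
              - ⨅ β : Pacing.Strategy, (mkt n).totalCost (T n)
                  (Function.update (Pacing.pacing (mkt n) (p n)) (i n) β) (i n)))
            atTop (𝓝 0)) := by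
  obtain ⟨C, hC0, hC⟩ := Pacing.Market.exists_regret_bound Δ μlo μhi νlo νhi lam κ
  constructor
  · intro η hη
    by_cases hpar : 0 < Δ ∧ 0 < μhi
    swap
    · exact ⟨0, le_rfl, fun mkt p T hΔ hlo hhi => absurd
        ⟨hΔ ▸ mkt.Δ_pos, hhi ▸ p.lo_pos.trans p.lo_lt_hi⟩ hpar⟩
    obtain ⟨hΔ0, hμhi⟩ := hpar
    -- Below `e₀` the upper projection is inactive and one step covers at most half of the margin.
    -- Above it the trivial bound `1` on the regret per period suffices, since the rate is at least
    -- a multiple of `ε`.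
    obtain ⟨e₀, he₀⟩ : ∃ e, e = min (μlo ^ 2 / Δ) (η / 2 / (Δ / μlo)) := ⟨_, rfl⟩
    have he0 : 0 < e₀ := by rw [he₀]; positivity
    refine ⟨(C + μlo * (C * (1 + 1 / η ^ 2)) + 1 / e₀) * (1 + μhi / μlo), by positivity,
      fun mkt p T hΔ hlo hhi hT hdens hmono ⟨μs, hst, hμs⟩ hrate hmatch i β => ?_⟩
    have H : mkt.Regular p νlo νhi lam κ μs :=
      { νlo_pos := hνlo
        lam_pos := hlam
        dens := hdens
        mono := by rw [hlo, hhi]; exact hmono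
        stat_mem := fun j => by
          rw [hlo, hhi]
          exact ⟨by linarith [(hμs j).1], (hμs j).2⟩
        stat := hst.2
        rate := fun j => by rw [hΔ, hhi]; exact hrate j
        matching := hmatch }
    have hT0 : (0 : ℝ) < T := by exact_mod_cast hT
    have ha0 := mkt.matchNorm_nonneg i
    have hε0 := p.eps_pos
    have hsa : 1 ≤ μhi / μlo * (√(mkt.N : ℝ) * mkt.matchNorm i) := by
      have h1 := H.le_sqrt_mul_matchNorm i
      rw [hlo, hhi, div_le_iff₀ hμhi] at h1
      rw [div_mul_eq_mul_div, one_le_div hμlo]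
      linarith
    obtain ⟨r1, r2⟩ := Pacing.error_le_rate ha0 (Real.sqrt_nonneg _) hε0 hT0
      (by positivity : 0 ≤ μhi / μlo) hsa
    rw [mul_assoc]
    generalize (1 + μhi / μlo) * (mkt.matchNorm i *
      (√(mkt.N : ℝ) * (p.eps + 1 / (p.eps * T)) + mkt.matchNorm i)
      + (1 + p.eps) / (p.eps * T)) = W at r1 r2 ⊢
    have hW : 0 ≤ W := hε0.le.trans r2
    have q1 : 0 ≤ μlo * (C * (1 + 1 / η ^ 2)) := by positivity
    have q2 : 0 ≤ 1 / e₀ := by positivity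
    rcases le_or_gt p.eps e₀ with hle | hgt
    · have hle1 : p.eps * Δ ≤ μlo ^ 2 :=
        (le_div_iff₀ hΔ0).1 (hle.trans (he₀ ▸ min_le_left _ _))
      have hle2 : p.eps * (Δ / μlo) ≤ η / 2 :=
        (le_div_iff₀ (by positivity)).1 (hle.trans (he₀ ▸ min_le_right _ _))
      obtain ⟨U, hU1, -, hU2⟩ := hC mkt p μs T hΔ hlo hhi H hT hle1 i β
      have h1 := hU2 η hη (hμs i).1 hle2
      have h2 : 1 / (p.eps * T) + p.eps ≤ W := by
        have : (0 : ℝ) ≤ 1 / T := by positivity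
        linarith [sq_nonneg (mkt.matchNorm i)]
      have h3 : μlo * U ≤ μlo * (C * (1 + 1 / η ^ 2)) * W :=
        (mul_le_mul_of_nonneg_left h1 hμlo.le).trans (by
          rw [← mul_assoc]
          exact mul_le_mul_of_nonneg_left h2 q1)
      have h4 := mul_le_mul_of_nonneg_left r1 hC0
      linarith [mul_nonneg q2 hW]
    · have h1 := mkt.regret_le_one p hT i β
      have h2 : 1 ≤ 1 / e₀ * W := by
        rw [one_div_mul_eq_div, one_le_div he0]
        exact hgt.le.trans r2
      linarith [mul_nonneg (add_nonneg hC0 q1) hW]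
  · intro mkt p T r hΔ hlo hhi hdens hmono hst hrate hT _ _ hε hTε _ hmatch ha i
    choose μs hμs hμm using hst
    have H : ∀ n, (mkt n).Regular (p n) νlo νhi lam κ (μs n) := fun n =>
      { νlo_pos := hνlo
        lam_pos := hlam
        dens := hdens n
        mono := by rw [hlo, hhi]; exact hmono n
        stat_mem := fun j => by rw [hlo, hhi]; exact hμm n j
        stat := (hμs n).2
        rate := fun j => by rw [hΔ, hhi]; exact hrate n j
        matching := hmatch n }
    have ha' : Tendsto (fun n => (mkt n).matchNorm (i n)) atTop (𝓝 0) :=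
      squeeze_zero (fun n => (mkt n).matchNorm_nonneg _)
        (fun n => le_ciSup (f := (mkt n).matchNorm) (Set.finite_range _).bddAbove (i n)) ha
    have hy : Tendsto (fun n => 1 / ((p n).eps * T n) + (p n).eps) atTop (𝓝 0) := by
      have h1 : Tendsto (fun n => 1 / ((p n).eps * T n)) atTop (𝓝 0) := by
        simp only [one_div, mul_comm (p _).eps]
        exact hTε.inv_tendsto_atTop
      simpa using h1.add hε
    have hu : Tendsto (fun n => 1 / (T n : ℝ)) atTop (𝓝 0) := by
      simp only [one_div]
      exact (tendsto_natCast_atTop_atTop.comp hT).inv_tendsto_atTop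
    have hb : Tendsto (fun n => C * (1 / ((p n).eps * T n) + (p n).eps + 1 / T n
        + (mkt n).matchNorm (i n) ^ 2)
        + μlo * (C * (2 * √(1 / ((p n).eps * T n) + (p n).eps)))) atTop (𝓝 0) := by
      have h1 := ((hy.add hu).add (ha'.pow 2)).const_mul C
      -- The unspent budget is bounded at the optimal scale: for `ω = √y` one has `ω + y / ω = 2 *
      -- √y`.
      have h2 := ((hy.sqrt.const_mul 2).const_mul C).const_mul μlo
      simpa using h1.add h2
    have hsm : ∀ᶠ n in atTop, (p n).eps * Δ ≤ μlo ^ 2 := by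
      have h1 : Tendsto (fun n => (p n).eps * Δ) atTop (𝓝 0) := by
        simpa using hε.mul_const Δ
      exact h1.eventually_le_const (by positivity)
    refine squeeze_zero' ?_ ?_ hb
    · refine Eventually.of_forall fun n => mul_nonneg (by positivity) (sub_nonneg.2 ?_)
      -- Pacing is itself an admissible deviation, so the regret is nonnegative.
      refine (ciInf_le ⟨0, ?_⟩ (Pacing.pacing (mkt n) (p n) (i n))).trans_eq ?_
      · rintro _ ⟨β, rfl⟩
        exact Pacing.Market.totalCost_nonneg (p n) _ _ _
      · rw [Function.update_eq_self]
    · filter_upwards [hsm, hT.eventually_gt_atTop 0] with n hn hTn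
      have hT0 : (0 : ℝ) < T n := by exact_mod_cast hTn
      have hε0 := (p n).eps_pos
      have hy0 : 0 < 1 / ((p n).eps * T n) + (p n).eps := by positivity
      -- The infimum is isolated so that the bound, which is uniform in `β`, can be proved for each
      -- deviation separately.
      rw [one_div_mul_eq_div, div_le_iff₀ hT0, sub_le_comm]
      have : Nonempty Pacing.Strategy := ⟨Pacing.pacing (mkt n) (p n) (i n)⟩
      refine le_ciInf fun β => ?_
      rw [sub_le_comm, ← div_le_iff₀ hT0, ← one_div_mul_eq_div]
      obtain ⟨U, hU1, hU2, -⟩ := hC (mkt n) (p n) (μs n) (T n) (hΔ n) (hlo n) (hhi n) (H n) hTn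
        hn (i n) β
      have h1 := hU2 _ (Real.sqrt_pos.2 hy0)
      rw [Real.div_sqrt, ← two_mul] at h1
      exact hU1.trans (by gcongr)
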